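/- Let $B=\{x\in\mathbb R^n:\ \ell_k(x):=\langle x,v_k\rangle+\lambda_k\ge 0,\ k=1,\dots,d\}$ be a Delzant lattice polytope ($v_k\in N=\mathbb Z^n$, $\lambda_k\in\mathbb Z$; $B$ is compact, every $\{\ell_k=0\}$ meets $B$, and at each vertex of $B$ the $v_k$ with $\ell_k=0$ form a $\mathbb Z$-basis of $N$), and let $M=\mathbb Z^n$ be the dual lattice. Let $\check X=U/G$ be the smooth projective toric variety of the normal fan of $B$ with homogeneous coordinates $z_1,\dots,z_d$, where $U\subset\mathbb C^d$ is the set of $z$ for which the facets $\{\ell_k=0\}\cap B$ with $z_k=0$ have a common point, and $G=\{t\in(\mathbb C^\times)^d:\prod_k t_k^{\langle u,v_k\rangle}=1\ \forall u\in M\}$. For $u\in B\cap M$ put $s_u=\prod_k z_k^{\ell_k(u)}$, a section of the ample line bundle $\mathcal O(\sum_k\lambda_kD_k)$. Let $c_u\ge 0$ $(u\in B\cap M)$ be weights such that the sections $\sqrt{c_u}\,s_u$ embed $\check X$ in a projective space (equivalently, $c_u>0$ whenever $u$ is a vertex of $B$ or the first lattice point after a vertex on an edge of $B$). Put $H=\sum_u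 c_u|s_u|^2$, $$\phi(\xi)=\frac1{4\pi}\log\sum_{u\in B\cap M}c_ue^{4\pi\langle u,\xi\rangle}\quad(\xi\in N_{\mathbb R}=\mathbb R^n),\qquad \check p=\frac{\sum_u c_u|s_u|^2\,u}{\sum_u c_u|s_u|^2}:\check X\to\mathbb R^n.$$ The dense torus of $\check X$ is identified with $TN_{\mathbb R}/N$, with coordinates $(\xi,\check y)$ and $z^j=\check y^j+i\xi^j$, the character of $u$ being $e^{-2\pi i\langle u,z\rangle}$. Let $\check L_\phi=\mathcal O(\sum_k\lambda_kD_k)$ carry the Chern connection $\nabla$ of the metric $|s|^2/H$; on the dense torus let $\check e_\phi=\prod_k z_k^{\lambda_k}$ be the holomorphic frame and $\check 1=e^{2\pi\phi}\check e_\phi$ the unitary frame. Call a subset $S\subset\check X$ Bohr–Sommerfeld if $\check L_\phi|_S$ has a nowhere vanishing covariantly constant section along $S$ (parallel along every smooth curve in $S$, curves being taken with smooth lifts to $U$). Let $\Gamma_{P_{\mathbb R}}$ be the space of sections of $\check L_\phi$ over $\check X$ that are covariantly constant along every fibre of $\check p$ (no regularity is required transversally to the fibres), and let $\Gamma_{P_{\mathbb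 C}}$ be the space of smooth sections with $\nabla_vs=0$ for all $v\in T^{0,1}\check X$, that is, of holomorphic sections. Let $L_0$ and $L_\phi=\{(\xi,d\phi(\xi))\}$ be the zero section and the graph of $d\phi$ in $T^*N_{\mathbb R}/M$. Let $\overline{L_0\cap L_\phi}$ be the set of continuous rays $r:[0,\infty)\to N_{\mathbb R}$ for which $\lim_{t\to\infty}d\phi(r(t))$ exists in $M$, modulo equality of the limits. On functions $f(\xi,m)$ on the path space $P(L_0,L_\phi)=N_{\mathbb R}\times M$ consider $d_Wf=df+2\pi f\,(d\phi+m)$ and the SYZ transform $\mathcal F(f)=\sum_{m\in M}f(\xi,m)e^{2\pi i\langle m,\check y\rangle}\,\check 1$. Let $W$ be the space of smooth, rapidly decaying, bounded $f$ with $d_Wf=0$, and for $u\in B\cap M$ let $f_u(\xi,m)=e^{-2\pi\phi(\xi)}e^{2\pi\langle u,\xi\rangle}$ for $m=-u$ and $0$ for $m\ne-u$. Then: 1. $\check p(\check X)=B$, and $\check p(\xi,\check y)=d\phi(\xi)$ on the dense torus. Over the dense torus, in the frame $\check 1$, $\nabla$ is the SYZ transform $d+2\pi i\sum_j\frac{\partial\phi}{\partial\xi^j}d\check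 y^j$ of $L_\phi$, and it is prequantum there: $\frac{i}{2\pi}F_\nabla=2i\partial\bar\partial\phi=\sum_{j,k}\frac{\partial^2\phi}{\partial\xi^j\partial\xi^k}d\check y^j\wedge d\xi^k$. 2. The Bohr–Sommerfeld fibres $\check p^{-1}(x)$, $x\in B$ (the degenerate isotropic fibres over $\partial B$ included), the points of $\overline{L_0\cap L_\phi}$ and the lattice points $B\cap M$ are in bijection, through $\check p^{-1}(u)\leftrightarrow[r]\leftrightarrow u=\lim_{t\to\infty}d\phi(r(t))$. The lattice points in the interior of $B$ are exactly those that come from actual intersection points $(\xi,0)\in L_0\cap L_\phi$, by $u=d\phi(\xi)$. 3. $\Gamma_{P_{\mathbb R}}$ has a basis indexed by the Bohr–Sommerfeld fibres; the element for the fibre over $u$ is the unit length parallel section $\frac{s_u}{|s_u|}\sqrt H$ on that fibre (which is $e^{-2\pi i\langle u,\check y\rangle}\check 1$ on interior fibres), extended by zero to the other fibres. $W$ has a basis indexed by $\overline{L_0\cap L_\phi}$, formed by the $f_u$, $u\in B\cap M$. The SYZ transform is a linear isomorphism $\mathcal F:W\to\Gamma_{P_{\mathbb C}}$: for $f\in W$,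 $\mathcal F(f)$ is the restriction to the dense torus of a holomorphic section over $\check X$, and every holomorphic section arises so, from a unique $f$. 4. Consequently there is a canonical linear isomorphism $\Phi:\Gamma_{P_{\mathbb R}}\to\Gamma_{P_{\mathbb C}}$ that takes the basis element of the Bohr–Sommerfeld fibre over $u\in B\cap M$ to $\mathcal F(f_u)$, that is, to the holomorphic section whose restriction to the dense torus is $e^{-2\pi\phi}e^{2\pi\langle u,\xi\rangle}e^{-2\pi i\langle u,\check y\rangle}\,\check 1=e^{-2\pi i\langle u,z\rangle}\,\check e_\phi$, the character section of $u$. -/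

import Mathlib

open Set Filter Topology

namespace ToricSYZ

noncomputable section

/-- The pairing `⟨u, ξ⟩` of `u ∈ M = ℤⁿ` with `ξ ∈ N_ℝ = ℝⁿ`. -/
def pair {n : ℕ} (u : Fin n → ℤ) (ξ : Fin n → ℝ) : ℝ := ∑ i, (u i : ℝ) * ξ i

/-- The inclusion of the lattice `M = ℤⁿ` in `M_ℝ = ℝⁿ`. -/
def toReal {n : ℕ} (u : Fin n → ℤ) : Fin n → ℝ := fun i => (u i : ℝ)

/-- The polyhedron `{x : ⟨x, v_k⟩ + λ_k ≥ 0 for all k}`. -/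
def polyhedron {n d : ℕ} (v : Fin d → Fin n → ℤ) (lam : Fin d → ℤ) : Set (Fin n → ℝ) :=
  {x | ∀ k, 0 ≤ pair (v k) x + (lam k : ℝ)}

/-- A Delzant lattice polytope with facets `⟨x, v_k⟩ + λ_k = 0`. This is the same thing as a smooth
complete fan (the normal fan, with primitive ray generators `v_k`) together with an ample
line bundle `O(∑ λ_k D_k)` on its toric variety. -/
structure DelzantPolytope (n d : ℕ) where
  /-- the primitive generators of the rays of the fan -/
  v : Fin d → Fin n → ℤ
  /-- the support numbers -/
  lam : Fin d → ℤ
  compact : IsCompact (polyhedron v lam)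
  facet : ∀ k, ∃ x ∈ polyhedron v lam, pair (v k) x + (lam k : ℝ) = 0
  smooth_indep : ∀ x ∈ (polyhedron v lam).extremePoints ℝ,
    LinearIndependent ℤ (fun k : {k // pair (v k) x + (lam k : ℝ) = 0} => v k)
  smooth_span : ∀ x ∈ (polyhedron v lam).extremePoints ℝ,
    Submodule.span ℤ (Set.range (fun k : {k // pair (v k) x + (lam k : ℝ) = 0} => v k)) = ⊤

namespace DelzantPolytope

variable {n d : ℕ} (P : DelzantPolytope n d)

/-- The moment polytope `B`. -/
def body : Set (Fin n → ℝ) := polyhedron P.v P.lam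

/-- The affine function `ℓ_k(x) = ⟨x, v_k⟩ + λ_k`. -/
def ell (k : Fin d) (x : Fin n → ℝ) : ℝ := pair (P.v k) x + (P.lam k : ℝ)

/-- `ℓ_k` at a lattice point, as an integer. -/
def ellZ (k : Fin d) (u : Fin n → ℤ) : ℤ := (∑ i, P.v k i * u i) + P.lam k

/-- The lattice points `B ∩ M`. -/
def latticePts : Set (Fin n → ℤ) := {u | toReal u ∈ P.body}

theorem latticePts_finite : P.latticePts.Finite := by
  obtain ⟨R, hR⟩ := P.compact.isBounded.subset_closedBall (0 : Fin n → ℝ)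
  refine (Set.finite_Icc (fun _ : Fin n => -⌈R⌉) (fun _ => ⌈R⌉)).subset ?_
  intro u hu
  have h1 : ‖toReal u‖ ≤ R := by simpa using hR hu
  have h2 : ∀ i, |(u i : ℝ)| ≤ (⌈R⌉ : ℝ) := fun i =>
    ((norm_le_pi_norm (toReal u) i).trans h1).trans (Int.le_ceil R)
  refine ⟨fun i => ?_, fun i => ?_⟩
  · have := (abs_le.1 (h2 i)).1
    exact_mod_cast this
  · have := (abs_le.1 (h2 i)).2
    exact_mod_cast this

/-- The lattice points `B ∩ M` as a finite set. -/
def latticeFinset : Finset (Fin n → ℤ) := P.latticePts_finite.toFinset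

open Classical in
/-- Weights `c_u ≥ 0` for which the monomial sections `√c_u s_u`, `u ∈ B ∩ M`, embed the toric
manifold in a projective space: at the fixed point of a vertex `x` the only non-vanishing monomial
section is the one at `x` itself, and the only ones with non-zero differential in the toric chart
are those at the first lattice points on the edges at `x`. These are exactly the lattice points
`u` of `B` with `∑ ℓ_k(u) ≤ 1`, the sum over the facets through `x`. -/
def IsEmbeddingWeight (c : (Fin n → ℤ) → ℝ) : Prop :=
  (∀ u ∈ P.latticePts, 0 ≤ c u) ∧
  ∀ x ∈ P.body.extremePoints ℝ, ∀ u ∈ P.latticePts,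
    (∑ k with P.ell k x = 0, P.ellZ k u) ≤ 1 → 0 < c u

/-! ### The Kähler potential, the Lagrangian section and its intersection with the zero section -/

/-- The Kähler potential `φ(ξ) = (1/4π) log ∑_{u ∈ B ∩ M} c_u e^{4π⟨u,ξ⟩}` on `N_ℝ`. -/
def phi (c : (Fin n → ℤ) → ℝ) (ξ : Fin n → ℝ) : ℝ :=
  1 / (4 * Real.pi) * Real.log (∑ u ∈ P.latticeFinset, c u * Real.exp (4 * Real.pi * pair u ξ))

/-- `dφ : N_ℝ → M_ℝ`. -/
def dphi (c : (Fin n → ℤ) → ℝ) (ξ : Fin n → ℝ) : Fin n → ℝ :=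
  fun i => fderiv ℝ (P.phi c) ξ (Pi.single i 1)

/-- The zero section `L₀` of the mirror `T^*N_ℝ / M = ℝⁿ × (ℝ/ℤ)ⁿ`. -/
def zeroSection (n : ℕ) : Set ((Fin n → ℝ) × (Fin n → UnitAddCircle)) := {q | q.2 = 0}

/-- The Lagrangian section `L_φ`, the graph of `dφ`, in `T^*N_ℝ / M`. -/
def lagrangian (c : (Fin n → ℤ) → ℝ) : Set ((Fin n → ℝ) × (Fin n → UnitAddCircle)) :=
  {q | q.2 = fun i => (P.dphi c q.1 i : UnitAddCircle)}

/-- Paths `[0, ∞) → N_ℝ` along which `dφ` converges to a lattice point. -/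
def IntegralRay (c : (Fin n → ℤ) → ℝ) : Type :=
  {r : NNReal → (Fin n → ℝ) // Continuous r ∧
    ∃ u : Fin n → ℤ, Tendsto (fun t => P.dphi c (r t)) atTop (𝓝 (toReal u))}

/-- Integral equivalence of rays: `dφ` has the same limit along both. -/
def integralEquiv (c : (Fin n → ℤ) → ℝ) : Setoid (P.IntegralRay c) where
  r a b := ∃ x : Fin n → ℝ, Tendsto (fun t => P.dphi c (a.1 t)) atTop (𝓝 x) ∧
    Tendsto (fun t => P.dphi c (b.1 t)) atTop (𝓝 x)
  iseqv :=
    { refl := fun a => ⟨_, a.2.2.choose_spec, a.2.2.choose_spec⟩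
      symm := fun ⟨x, h1, h2⟩ => ⟨x, h2, h1⟩
      trans := by
        rintro a b e ⟨x, h1, h2⟩ ⟨y, h3, h4⟩
        obtain rfl := tendsto_nhds_unique h2 h3
        exact ⟨x, h1, h4⟩ }

/-- The intersection points of `L₀` and `L_φ`, those at infinity included. -/
def IntersectionAtInfinity (c : (Fin n → ℤ) → ℝ) : Type := Quotient (P.integralEquiv c)

/-! ### The toric manifold, as the quotient of homogeneous coordinates -/

/-- The homogeneous coordinate space `U ⊆ ℂ^d`: the `k` with `z_k = 0` have to span a cone of the
normal fan, that is, the corresponding facets have to meet. It is open in `ℂ^d`. -/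
def coxSet : Set (Fin d → ℂ) := {z | ∃ x ∈ P.body, ∀ k, z k = 0 → P.ell k x = 0}

/-- The group `G = {t ∈ (ℂˣ)^d : ∏ t_k^{⟨u,v_k⟩} = 1 for all u ∈ M}`. -/
def coxGroup : Subgroup (Fin d → ℂˣ) where
  carrier := {t | ∀ i, ∏ k, t k ^ P.v k i = 1}
  one_mem' := by simp
  mul_mem' := by
    intro a b ha hb i
    simp only [Pi.mul_apply, mul_zpow, Finset.prod_mul_distrib]
    rw [ha i, hb i, one_mul]
  inv_mem' := by
    intro a ha i
    simp only [Pi.inv_apply, inv_zpow, Finset.prod_inv_distrib]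
    rw [ha i, inv_one]

/-- Two points of `U` lie in the same `G`-orbit. -/
def coxSetoid : Setoid P.coxSet where
  r z w := ∃ t ∈ P.coxGroup, ∀ k, w.1 k = (t k : ℂ) * z.1 k
  iseqv :=
    { refl := fun z => ⟨1, one_mem _, by simp⟩
      symm := by
        rintro z w ⟨t, ht, h⟩
        exact ⟨t⁻¹, inv_mem ht, fun k => by simp [h k]⟩
      trans := by
        rintro z w y ⟨t, ht, h⟩ ⟨s, hs, h'⟩
        exact ⟨s * t, mul_mem hs ht, fun k => by simp [h k, h' k, mul_assoc]⟩ }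

/-- The projective toric manifold `X̌ = U / G` of the normal fan of `B`. -/
def Space : Type := Quotient P.coxSetoid

/-- The projection `U → X̌`. -/
def proj (z : P.coxSet) : P.Space := Quotient.mk P.coxSetoid z

/-- The monomial `s_u(z) = ∏ z_k^{⟨u,v_k⟩ + λ_k}`, the character section of `u ∈ B ∩ M`. -/
def mono (u : Fin n → ℤ) (z : Fin d → ℂ) : ℂ := ∏ k, z k ^ P.ellZ k u

/-- The character `χ(t) = ∏ t_k^{λ_k}` of `G` that defines the line bundle. -/
def chi (t : Fin d → ℂˣ) : ℂ := ((∏ k, t k ^ P.lam k : ℂˣ) : ℂ)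

/-- `H(z) = ∑ c_u |s_u(z)|²`. -/
def hSum (c : (Fin n → ℤ) → ℝ) (z : Fin d → ℂ) : ℝ :=
  ∑ u ∈ P.latticeFinset, c u * ‖P.mono u z‖ ^ 2

/-- The moment map in homogeneous coordinates, `∑ c_u |s_u|² u / ∑ c_u |s_u|²`. -/
def momentCox (c : (Fin n → ℤ) → ℝ) (z : Fin d → ℂ) : Fin n → ℝ :=
  fun i => (∑ u ∈ P.latticeFinset, c u * ‖P.mono u z‖ ^ 2 * (u i : ℝ)) / P.hSum c z

theorem mono_smul {t : Fin d → ℂˣ} (ht : t ∈ P.coxGroup) (u : Fin n → ℤ) {z w : Fin d → ℂ}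
    (h : ∀ k, w k = (t k : ℂ) * z k) : P.mono u w = P.chi t * P.mono u z := by
  have key : ∏ k, t k ^ P.ellZ k u = ∏ k, t k ^ P.lam k := by
    have h1 : ∏ k, t k ^ (∑ i, P.v k i * u i) = 1 := by
      have h2 : ∀ k, t k ^ (∑ i, P.v k i * u i) = ∏ i, (t k ^ P.v k i) ^ u i := by
        intro k
        simp only [← zpow_mul]
        induction (Finset.univ : Finset (Fin n)) using Finset.induction_on with
        | empty => simp
        | insert a S ha ih => rw [Finset.sum_insert ha, Finset.prod_insert ha, zpow_add, ih]
      simp only [h2]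
      rw [Finset.prod_comm]
      refine Finset.prod_eq_one fun i _ => ?_
      rw [Finset.prod_zpow, ht i, one_zpow]
    simp only [ellZ, zpow_add, Finset.prod_mul_distrib]
    rw [h1, one_mul]
  have key' := congrArg (fun x : ℂˣ => (x : ℂ)) key
  simp only [Units.coe_prod, Units.val_zpow_eq_zpow_val] at key'
  simp only [mono, chi, h, mul_zpow, Finset.prod_mul_distrib, Units.coe_prod,
    Units.val_zpow_eq_zpow_val]
  rw [key']

theorem chi_ne_zero (t : Fin d → ℂˣ) : P.chi t ≠ 0 := Units.ne_zero _

theorem momentCox_smul (c : (Fin n → ℤ) → ℝ) {t : Fin d → ℂˣ} (ht : t ∈ P.coxGroup)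
    {z w : Fin d → ℂ} (h : ∀ k, w k = (t k : ℂ) * z k) : P.momentCox c w = P.momentCox c z := by
  have h0 : ‖P.chi t‖ ^ 2 ≠ 0 := pow_ne_zero _ (norm_ne_zero_iff.2 (P.chi_ne_zero t))
  funext i
  simp only [momentCox, hSum, P.mono_smul ht _ h, norm_mul, mul_pow]
  have e1 : ∀ u, c u * (‖P.chi t‖ ^ 2 * ‖P.mono u z‖ ^ 2)
      = ‖P.chi t‖ ^ 2 * (c u * ‖P.mono u z‖ ^ 2) := fun u => by ring
  simp only [e1, mul_assoc (‖P.chi t‖ ^ 2), ← Finset.mul_sum]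
  exact mul_div_mul_left _ _ h0

/-- The moment map `p̌ : X̌ → M_ℝ`. -/
def moment (c : (Fin n → ℤ) → ℝ) : P.Space → (Fin n → ℝ) :=
  Quotient.lift (fun z : P.coxSet => P.momentCox c z.1)
    (fun _ _ ⟨_, ht, h⟩ => (P.momentCox_smul c ht h).symm)

/-- The fibre of the moment map over `x`. -/
def fibre (c : (Fin n → ℤ) → ℝ) (x : Fin n → ℝ) : Set P.Space := P.moment c ⁻¹' {x}

/-! ### The line bundle `Ľ_φ` over `X̌` and its connection -/

/-- Sections over `X̌`, with no regularity, of the line bundle `(U × ℂ) / G` where `G` acts on `ℂ`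
through `χ`, that is `O(∑ λ_k D_k)`: the `G`-equivariant functions on `U`. -/
def Sections : Submodule ℂ (P.coxSet → ℂ) where
  carrier := {s | ∀ t ∈ P.coxGroup, ∀ z w : P.coxSet, (∀ k, w.1 k = (t k : ℂ) * z.1 k) →
    s w = P.chi t * s z}
  zero_mem' := by intro t _ z w _; simp
  add_mem' := by
    intro a b ha hb t ht z w h
    simp only [Pi.add_apply, ha t ht z w h, hb t ht z w h, mul_add]
  smul_mem' := by
    intro a b hb t ht z w h
    simp only [Pi.smul_apply, smul_eq_mul, hb t ht z w h]
    ring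

open Classical in
/-- Extension by zero from the open set `U` to `ℂ^d`. -/
def extend (s : P.coxSet → ℂ) (z : Fin d → ℂ) : ℂ := if h : z ∈ P.coxSet then s ⟨z, h⟩ else 0

/-- The smooth sections of the line bundle. -/
def IsSmooth (s : P.coxSet → ℂ) : Prop :=
  s ∈ P.Sections ∧ ContDiffOn ℝ ((⊤ : ℕ∞) : WithTop ℕ∞) (P.extend s) P.coxSet

/-- The `(1,0)`-form `∂ log H` on `U`. -/
def delLogH (c : (Fin n → ℤ) → ℝ) (z η : Fin d → ℂ) : ℂ :=
  ((fderiv ℝ (fun w => Real.log (P.hSum c w)) z η : ℝ) -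
    Complex.I * (fderiv ℝ (fun w => Real.log (P.hSum c w)) z (Complex.I • η) : ℝ)) / 2

/-- The connection on the line bundle, `∇_η s = ds(η) - ∂ log H(η) s`. It is the Chern connection of
the metric `|s|² / H`; over the dense torus it is the SYZ transform of the graph of `dφ`. -/
def nabla (c : (Fin n → ℤ) → ℝ) (s : P.coxSet → ℂ) (z : P.coxSet) (η : Fin d → ℂ) : ℂ :=
  fderiv ℝ (P.extend s) z.1 η - P.delLogH c z.1 η * s z

/-- `s` is covariantly constant along `S ⊆ X̌`: it is parallel along every smooth curve of `U` that
lies over `S`. Only the restriction of `s` to `S` matters. -/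
def IsParallelOn (c : (Fin n → ℤ) → ℝ) (S : Set P.Space) (s : P.coxSet → ℂ) : Prop :=
  ∀ γ : ℝ → P.coxSet, ContDiff ℝ ((⊤ : ℕ∞) : WithTop ℕ∞) (fun t => (γ t).1) →
    (∀ t, P.proj (γ t) ∈ S) →
    ∀ t, HasDerivAt (fun t => s (γ t))
      (P.delLogH c (γ t).1 (deriv (fun t => (γ t).1) t) * s (γ t)) t

/-- `S ⊆ X̌` is Bohr-Sommerfeld: the connection restricts to the trivial connection on `S`, that is,
there is a nowhere vanishing parallel section over `S`. -/
def IsBohrSommerfeld (c : (Fin n → ℤ) → ℝ) (S : Set P.Space) : Prop :=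
  ∃ s ∈ P.Sections, (∀ z, P.proj z ∈ S → s z ≠ 0) ∧ P.IsParallelOn c S s

/-- The Bohr-Sommerfeld fibres of the moment map `p̌ : X̌ → B`: tori over the interior of `B`,
lower-dimensional isotropic tori over the boundary. -/
def BSFibres (c : (Fin n → ℤ) → ℝ) : Set (Set P.Space) :=
  {S | ∃ x ∈ P.body, S = P.fibre c x ∧ P.IsBohrSommerfeld c S}

/-- The sections polarized by the real polarization: covariantly constant in all directions tangent
to the fibres of the moment map, with regularity required in these directions only. -/
def RealPolarized (c : (Fin n → ℤ) → ℝ) : Submodule ℂ (P.coxSet → ℂ) where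
  carrier := {s | s ∈ P.Sections ∧ ∀ x ∈ P.body, P.IsParallelOn c (P.fibre c x) s}
  zero_mem' := ⟨zero_mem _, fun _ _ γ _ _ t => by simpa using hasDerivAt_const t (0 : ℂ)⟩
  add_mem' := by
    rintro a b ⟨ha, ha'⟩ ⟨hb, hb'⟩
    refine ⟨add_mem ha hb, fun x hx γ h1 h2 t => ?_⟩
    have := (ha' x hx γ h1 h2 t).add (hb' x hx γ h1 h2 t)
    rw [← mul_add] at this
    exact this
  smul_mem' := by
    rintro r b ⟨hb, hb'⟩
    refine ⟨Submodule.smul_mem _ r hb, fun x hx γ h1 h2 t => ?_⟩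
    have := (hb' x hx γ h1 h2 t).const_mul r
    rw [mul_left_comm] at this
    exact this

theorem coxSet_isOpen : IsOpen P.coxSet := by
  have h : P.coxSet = ⋃ x ∈ P.body, ⋂ k, {z : Fin d → ℂ | z k = 0 → P.ell k x = 0} := by
    ext z; simp [coxSet]
  rw [h]
  refine isOpen_biUnion fun x _ => isOpen_iInter_of_finite fun k => ?_
  by_cases hk : P.ell k x = 0
  · simp [hk]
  · simpa [hk] using isOpen_ne.preimage (continuous_apply k)

theorem extend_differentiableAt {s : P.coxSet → ℂ} (hs : P.IsSmooth s) (z : P.coxSet) :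
    DifferentiableAt ℝ (P.extend s) z.1 :=
  (hs.2.contDiffAt (P.coxSet_isOpen.mem_nhds z.2)).differentiableAt (by simp)

theorem extend_add (a b : P.coxSet → ℂ) : P.extend (a + b) = P.extend a + P.extend b := by
  funext z; by_cases h : z ∈ P.coxSet <;> simp [extend, h]

theorem extend_smul (r : ℂ) (b : P.coxSet → ℂ) : P.extend (r • b) = r • P.extend b := by
  funext z; by_cases h : z ∈ P.coxSet <;> simp [extend, h]

theorem extend_zero : P.extend 0 = 0 := by
  funext z; by_cases h : z ∈ P.coxSet <;> simp [extend, h]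

/-- The sections polarized by the complex polarization `T^{0,1}X̌`: the smooth sections with
`∇_η s + i ∇_{iη} s = 0`, that is, the holomorphic sections of `Ľ_φ`. -/
def ComplexPolarized (c : (Fin n → ℤ) → ℝ) : Submodule ℂ (P.coxSet → ℂ) where
  carrier := {s | P.IsSmooth s ∧ ∀ (z : P.coxSet) (η : Fin d → ℂ),
    P.nabla c s z η + Complex.I * P.nabla c s z (Complex.I • η) = 0}
  zero_mem' := by
    refine ⟨⟨zero_mem _, ?_⟩, fun z η => ?_⟩
    · rw [extend_zero]; exact contDiffOn_const
    · simp [nabla, extend_zero]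
  add_mem' := by
    rintro a b ⟨ha, ha'⟩ ⟨hb, hb'⟩
    refine ⟨⟨add_mem ha.1 hb.1, ?_⟩, fun z η => ?_⟩
    · rw [extend_add]; exact ha.2.add hb.2
    · have h1 := ha' z η
      have h2 := hb' z η
      simp only [nabla, extend_add, Pi.add_apply] at *
      rw [fderiv_add (P.extend_differentiableAt ha z) (P.extend_differentiableAt hb z)]
      simp only [add_apply]
      linear_combination h1 + h2
  smul_mem' := by
    rintro r b ⟨hb, hb'⟩
    refine ⟨⟨Submodule.smul_mem _ r hb.1, ?_⟩, fun z η => ?_⟩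
    · rw [extend_smul]; exact hb.2.const_smul r
    · have h2 := hb' z η
      simp only [nabla, extend_smul, Pi.smul_apply] at *
      rw [fderiv_const_smul (P.extend_differentiableAt hb z)]
      simp only [smul_apply, smul_eq_mul]
      linear_combination r * h2

/-! ### The dense torus `TN_ℝ / N` and the SYZ transforms -/

/-- The universal covering of the dense torus: `θ ↦ [e^{2πθ}]`. -/
def expPt (θ : Fin d → ℂ) : P.coxSet :=
  ⟨fun k => Complex.exp (2 * Real.pi * θ k), by
    by_cases h : ∃ k : Fin d, True
    · obtain ⟨k, -⟩ := h
      obtain ⟨x, hx, -⟩ := P.facet k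
      exact ⟨x, hx, fun k hk => absurd hk (Complex.exp_ne_zero _)⟩
    · exact ⟨0, fun k => absurd ⟨k, trivial⟩ h, fun k => absurd ⟨k, trivial⟩ h⟩⟩

/-- The coordinates `(ξ, y̌)` on `TN_ℝ / N` of the point `[e^{2πθ}]`: the torus coordinates
`∏ z_k^{(v_k)_i}` are `e^{-2πi(y̌_i + iξ_i)}`. -/
def coords (θ : Fin d → ℂ) : (Fin n → ℝ) × (Fin n → ℝ) :=
  (fun i => ∑ k, (P.v k i : ℝ) * (θ k).re, fun i => -∑ k, (P.v k i : ℝ) * (θ k).im)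

/-- The unitary frame `1̌` of the SYZ transform `Ľ_φ` over the dense torus, at `e^{2πθ}`:
`1̌ = e^{2πφ} ě_φ`, where `ě_φ = ∏ z_k^{λ_k}` is the holomorphic frame. -/
def frame (c : (Fin n → ℤ) → ℝ) (θ : Fin d → ℂ) : ℂ :=
  Real.exp (2 * Real.pi * P.phi c (P.coords θ).1) *
    Complex.exp (2 * Real.pi * ∑ k, (P.lam k : ℂ) * θ k)

/-- The section `s` over `X̌` restricts to `σ(ξ, y̌) 1̌` over the dense torus. -/
def RestrictsTo (c : (Fin n → ℤ) → ℝ) (s : P.coxSet → ℂ)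
    (σ : (Fin n → ℝ) × (Fin n → ℝ) → ℂ) : Prop :=
  ∀ θ, s (P.expPt θ) = σ (P.coords θ) * P.frame c θ

/-- Functions on the fibrewise geodesic path space `P(L₀, L_φ) = N_ℝ × M` that are smooth, rapidly
decaying, bounded and `d_W`-closed, where `d_W = d + 2π(dφ + m)` on the component of `m ∈ M`. -/
def WittenKernel (c : (Fin n → ℤ) → ℝ) : Submodule ℂ ((Fin n → ℝ) → (Fin n → ℤ) → ℂ) where
  carrier := {f | (∀ m, ContDiff ℝ ((⊤ : ℕ∞) : WithTop ℕ∞) (fun ξ => f ξ m)) ∧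
    (∀ K : Set (Fin n → ℝ), IsCompact K → ∀ k l : ℕ, ∀ ε > (0 : ℝ), ∀ᶠ m in cofinite, ∀ ξ ∈ K,
      ‖P.dphi c ξ + toReal m‖ ^ k * ‖iteratedFDeriv ℝ l (fun ξ => f ξ m) ξ‖ ≤ ε) ∧
    (∃ C : ℝ, ∀ ξ m, ‖f ξ m‖ ≤ C) ∧
    ∀ m ξ a, fderiv ℝ (fun ξ => f ξ m) ξ a +
      2 * Real.pi * ((fderiv ℝ (P.phi c) ξ a + pair m a : ℝ) : ℂ) * f ξ m = 0}
  zero_mem' := by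
    refine ⟨fun m => contDiff_const, fun K _ k l ε hε => ?_, ⟨0, by simp⟩, fun m ξ a => by simp⟩
    refine Eventually.of_forall fun m ξ _ => ?_
    have : iteratedFDeriv ℝ l (fun ξ : Fin n → ℝ => (0 : (Fin n → ℝ) → (Fin n → ℤ) → ℂ) ξ m) ξ
        = 0 := by
      change iteratedFDeriv ℝ l (fun _ : Fin n → ℝ => (0 : ℂ)) ξ = 0
      rw [iteratedFDeriv_fun_zero]; rfl
    rw [this]
    simpa using hε.le
  add_mem' := by
    rintro f g ⟨hf1, hf2, ⟨C, hC⟩, hf4⟩ ⟨hg1, hg2, ⟨D, hD⟩, hg4⟩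
    refine ⟨fun m => (hf1 m).add (hg1 m), fun K hK k l ε hε => ?_, ⟨C + D, fun ξ m => ?_⟩,
      fun m ξ a => ?_⟩
    · filter_upwards [hf2 K hK k l (ε / 2) (half_pos hε), hg2 K hK k l (ε / 2) (half_pos hε)]
        with m h1 h2 ξ hξ
      have e : iteratedFDeriv ℝ l (fun ξ => (f + g) ξ m) ξ
          = iteratedFDeriv ℝ l (fun ξ => f ξ m) ξ + iteratedFDeriv ℝ l (fun ξ => g ξ m) ξ :=
        iteratedFDeriv_add_apply
          ((hf1 m).of_le (by exact_mod_cast le_top)).contDiffAt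
          ((hg1 m).of_le (by exact_mod_cast le_top)).contDiffAt
      rw [e]
      have h3 := mul_le_mul_of_nonneg_left
        (norm_add_le (iteratedFDeriv ℝ l (fun ξ => f ξ m) ξ)
          (iteratedFDeriv ℝ l (fun ξ => g ξ m) ξ))
        (pow_nonneg (norm_nonneg (P.dphi c ξ + toReal m)) k)
      have h4 := h1 ξ hξ
      have h5 := h2 ξ hξ
      rw [mul_add] at h3
      linarith
    · exact (norm_add_le _ _).trans (add_le_add (hC ξ m) (hD ξ m))
    · have e : fderiv ℝ (fun ξ => (f + g) ξ m) ξ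
          = fderiv ℝ (fun ξ => f ξ m) ξ + fderiv ℝ (fun ξ => g ξ m) ξ :=
        fderiv_add ((hf1 m).differentiable (by simp) ξ) ((hg1 m).differentiable (by simp) ξ)
      rw [e]
      simp only [add_apply, Pi.add_apply]
      linear_combination hf4 m ξ a + hg4 m ξ a
  smul_mem' := by
    rintro r f ⟨hf1, hf2, ⟨C, hC⟩, hf4⟩
    refine ⟨fun m => (hf1 m).const_smul r, fun K hK k l ε hε => ?_, ⟨‖r‖ * C, fun ξ m => ?_⟩,
      fun m ξ a => ?_⟩
    · have hr : 0 < ‖r‖ + 1 := by positivity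
      filter_upwards [hf2 K hK k l (ε / (‖r‖ + 1)) (div_pos hε hr)] with m h1 ξ hξ
      have e : iteratedFDeriv ℝ l (fun ξ => (r • f) ξ m) ξ
          = r • iteratedFDeriv ℝ l (fun ξ => f ξ m) ξ :=
        iteratedFDeriv_const_smul_apply (a := r) (f := fun ξ => f ξ m)
          ((hf1 m).of_le (by exact_mod_cast le_top)).contDiffAt
      have h2 := h1 ξ hξ
      rw [le_div_iff₀ hr] at h2
      rw [e, norm_smul]
      have h3 : 0 ≤ ‖P.dphi c ξ + toReal m‖ ^ k * ‖iteratedFDeriv ℝ l (fun ξ => f ξ m) ξ‖ := by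
        positivity
      nlinarith
    · exact (norm_smul_le _ _).trans (mul_le_mul_of_nonneg_left (hC ξ m) (norm_nonneg r))
    · have e : fderiv ℝ (fun ξ => (r • f) ξ m) ξ = r • fderiv ℝ (fun ξ => f ξ m) ξ :=
        fderiv_const_smul ((hf1 m).differentiable (by simp) ξ) r
      rw [e]
      simp only [smul_apply, Pi.smul_apply, smul_eq_mul]
      linear_combination r * hf4 m ξ a

open Classical in
/-- The function `f_u` on `P(L₀, L_φ)`: `e^{-2πφ} e^{2π⟨u,ξ⟩}` on the component `m = -u`, zero on the
others. -/
def wittenFun (c : (Fin n → ℤ) → ℝ) (u : Fin n → ℤ) : (Fin n → ℝ) → (Fin n → ℤ) → ℂ :=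
  fun ξ m => if m = -u then
    ((Real.exp (-(2 * Real.pi * P.phi c ξ)) * Real.exp (2 * Real.pi * pair u ξ) : ℝ) : ℂ) else 0

open Classical in
/-- The unit length parallel section over the Bohr-Sommerfeld fibre over `u ∈ B ∩ M`, extended by zero
to the other fibres. On an interior fibre it is `e^{-2πi⟨u,y̌⟩} 1̌`; in homogeneous coordinates
it is `s_u / |s_u|` times the unit `√H`. -/
def fibreSection (c : (Fin n → ℤ) → ℝ) (u : Fin n → ℤ) (z : P.coxSet) : ℂ :=
  if P.proj z ∈ P.fibre c (toReal u) then
    P.mono u z.1 / (‖P.mono u z.1‖ : ℂ) * (Real.sqrt (P.hSum c z.1) : ℂ) else 0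

end DelzantPolytope

/-- The SYZ transform of the graph of `dg`: the connection `d + 2πi ∑ (∂g/∂ξ_j) dy̌_j`, here applied
to the section `σ 1̌` at `p = (ξ, y̌)` in the direction `a = (a_ξ, a_y̌)`. -/
def syzNabla {n : ℕ} (g : (Fin n → ℝ) → ℝ) (σ : (Fin n → ℝ) × (Fin n → ℝ) → ℂ)
    (p a : (Fin n → ℝ) × (Fin n → ℝ)) : ℂ :=
  fderiv ℝ σ p a + 2 * Real.pi * Complex.I * (fderiv ℝ g p.1 a.2 : ℝ) * σ p

/-- The curvature `dA` of the connection `d + A`, `A = 2πi ∑ (∂g/∂ξ_j) dy̌_j`. -/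
def syzCurvature {n : ℕ} (g : (Fin n → ℝ) → ℝ) (p a b : (Fin n → ℝ) × (Fin n → ℝ)) : ℂ :=
  fderiv ℝ (fun q : (Fin n → ℝ) × (Fin n → ℝ) =>
      2 * Real.pi * Complex.I * ((fderiv ℝ g q.1 b.2 : ℝ) : ℂ)) p a -
    fderiv ℝ (fun q : (Fin n → ℝ) × (Fin n → ℝ) =>
      2 * Real.pi * Complex.I * ((fderiv ℝ g q.1 a.2 : ℝ) : ℂ)) p b

/-- The Kähler form `2i ∂∂̄g = ∑ (∂²g/∂ξ_j∂ξ_k) dy̌_j ∧ dξ_k` on `TN_ℝ / N`. -/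
def kahlerForm {n : ℕ} (g : (Fin n → ℝ) → ℝ) (p a b : (Fin n → ℝ) × (Fin n → ℝ)) : ℝ :=
  fderiv ℝ (fderiv ℝ g) p.1 a.2 b.1 - fderiv ℝ (fderiv ℝ g) p.1 b.2 a.1

/-- The SYZ transform `𝓕(f) = ∑_m f(ξ, m) e^{2πi⟨m,y̌⟩}` (coefficient of the frame `1̌`). -/
def syzTransform {n : ℕ} (f : (Fin n → ℝ) → (Fin n → ℤ) → ℂ) (p : (Fin n → ℝ) × (Fin n → ℝ)) : ℂ :=
  ∑' m : Fin n → ℤ, f p.1 m * Complex.exp (2 * Real.pi * Complex.I * (pair m p.2 : ℝ))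

end

end ToricSYZ

namespace ToricSYZ

/-! Everything is indexed by `B ∩ M`: the Bohr–Sommerfeld fibres, the intersection points at
infinity, and bases of the three vector spaces. Once these identifications are made, the
isomorphisms only match bases.

Moment map. `p̌` is a weighted average of lattice points of `B`, and `dφ` is the same average on the
dense torus. That every `x ∈ B` is attained is a convexity argument (`exists_sum_exp_smul_eq_zero`,
`exists_balanced`): minimise `∑ c_u e^{⟨u - x, ξ⟩}` over the lattice points of the face of `x`.
Vertices are lattice points of positive weight, which makes the sum proper modulo the directions in
which it is constant. Moving off to infinity against the normals of the face turns the minimiser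
into a ray with limit `x` (`exists_ray`).

Real side. In homogeneous coordinates `∂ log H = ∑ ℓ_k(p̌) dz_k / z_k` (`delLogH_eq`), so rotation
by angles `α` multiplies a parallel section over the fibre of `x` by `exp(i ∑ ℓ_k(x) α_k)`
(`IsParallelOn.rotate_eq`). Rotations that close up force `x` to be integral. Conversely `d log s_u
= ∑ ℓ_k(u) dz_k / z_k` makes `s_u` parallel over the fibre of `u`. By strict convexity a fibre is
one orbit of the compact torus (`exists_rotate_of_momentCox_eq`), so its parallel sections form at
most a line.

Witten side. On the component `m` a closed function is a multiple of `e^{-2π(φ + ⟨m,ξ⟩)}`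
(`wittenKernel_eq`). Comparing with the growth of `φ`, it is bounded exactly when `-m ∈ B`.

Complex side. As `∂ log H` has type `(1,0)`, complex polarized sections are the holomorphic
equivariant functions on `U`. Restricted to the compact torus such a section has a Fourier
expansion. If `ℓ_k(u) < 0`, the mode of `u` vanishes, because the loop in the direction `v_k` bounds
a disc crossing `z_k = 0` and the mean value property applies (`mFourierCoeff_section_eq_zero`). The
remaining finite sum of monomials agrees with the section everywhere by the identity theorem. Since
`𝓕(f_u)` is `s_u` on the dense torus, the transform matches the two bases. -/

theorem pair_eq_dotProduct {n : ℕ} (u : Fin n → ℤ) (ξ : Fin n → ℝ) : pair u ξ = toReal u ⬝ᵥ ξ := rfl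

theorem pair_add {n : ℕ} (u : Fin n → ℤ) (x y : Fin n → ℝ) :
    pair u (x + y) = pair u x + pair u y := by
  simp only [pair_eq_dotProduct, dotProduct_add]

theorem pair_smul {n : ℕ} (u : Fin n → ℤ) (r : ℝ) (x : Fin n → ℝ) :
    pair u (r • x) = r * pair u x := by
  simp only [pair_eq_dotProduct, dotProduct_smul, smul_eq_mul]

theorem pair_neg {n : ℕ} (u : Fin n → ℤ) (x : Fin n → ℝ) : pair (-u) x = -pair u x := by
  simp [pair]

theorem continuous_pair {n : ℕ} (u : Fin n → ℤ) : Continuous (pair u) := by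
  unfold pair; fun_prop

theorem toReal_injective {n : ℕ} : Function.Injective (toReal (n := n)) := by
  intro u w h
  funext i
  exact Int.cast_injective (congrFun h i)

/-! ### Critical points of exponential sums -/

/-- A finite sum of exponentials of linear forms has a critical point if no linear form is
one-sided on the frequencies. -/
theorem exists_sum_exp_smul_eq_zero {n : ℕ} {ι : Type*} (S : Finset ι) (b : ι → Fin n → ℝ)
    (c : ι → ℝ) (hc : ∀ u ∈ S, 0 < c u)
    (hb : ∀ ξ : Fin n → ℝ, (∃ u ∈ S, b u ⬝ᵥ ξ < 0) → ∃ u ∈ S, 0 < b u ⬝ᵥ ξ) :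
    ∃ ξ : Fin n → ℝ, ∑ u ∈ S, (c u * Real.exp (b u ⬝ᵥ ξ)) • b u = 0 := by
  classical
  let A : (Fin n → ℝ) →ₗ[ℝ] (S → ℝ) :=
    LinearMap.pi fun u => ∑ i, b u i • LinearMap.proj i
  have hA : ∀ ξ u, A ξ u = b u ⬝ᵥ ξ := by
    intro ξ u; simp [A, dotProduct]
  -- On the range of `A` the directions in which all the forms vanish are divided out, so the
  -- exponential sum can be proper there although it need not be on `ℝⁿ`.
  let R := LinearMap.range A
  let G : R → ℝ := fun y => ∑ u : S, c u * Real.exp (y.1 u)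
  have hev (u : S) : Continuous fun y : R => y.1 u :=
    (continuous_apply u).comp continuous_subtype_val
  have hGc : Continuous G :=
    continuous_finsetSum _ fun u _ => continuous_const.mul (Real.continuous_exp.comp (hev u))
  -- A positively homogeneous minorant of `G`, from `max(r, 0) ≤ e^r`. It is positive off the origin
  -- by `hb`, so compactness of the unit sphere gives a bound `δ‖y‖ ≤ p y` and hence coercivity of
  -- `G`.
  let p : R → ℝ := fun y => ∑ u : S, c u * max (y.1 u) 0
  have hpc : Continuous p :=
    continuous_finsetSum _ fun u _ => continuous_const.mul ((hev u).max continuous_const)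
  have hpG : ∀ y, p y ≤ G y := by
    intro y
    refine Finset.sum_le_sum fun u _ => mul_le_mul_of_nonneg_left ?_ (hc u u.2).le
    refine max_le ?_ (Real.exp_pos _).le
    linarith [Real.add_one_le_exp (y.1 u)]
  have hppos : ∀ y : R, y ≠ 0 → 0 < p y := by
    rintro ⟨_, ξ, rfl⟩ hy
    have h1 : ∃ u : S, 0 < A ξ u := by
      by_contra! hcon
      apply hy
      ext u
      change A ξ u = 0
      refine le_antisymm (hcon u) ?_
      by_contra! hneg
      rw [hA] at hneg
      obtain ⟨u', hu', h'⟩ := hb ξ ⟨u, u.2, hneg⟩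
      have := hcon ⟨u', hu'⟩
      rw [hA] at this
      exact absurd this (not_le.2 h')
    obtain ⟨u, hu⟩ := h1
    refine Finset.sum_pos' (fun w _ => mul_nonneg (hc w w.2).le (le_max_right _ _))
      ⟨u, Finset.mem_univ _, mul_pos (hc u u.2) (lt_max_of_lt_left hu)⟩
  have hphom : ∀ (r : ℝ) (y : R), 0 ≤ r → p (r • y) = r * p y := by
    intro r y hr
    simp only [p, Finset.mul_sum]
    refine Finset.sum_congr rfl fun u _ => ?_
    have : max ((r • y).1 u) 0 = r * max (y.1 u) 0 := by
      change max (r * y.1 u) 0 = _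
      rw [mul_max_of_nonneg _ _ hr, mul_zero]
    rw [this]; ring
  have hδ : ∃ δ > 0, ∀ y : R, δ * ‖y‖ ≤ p y := by
    -- The sphere is empty when `R = 0`; then any `δ` works.
    rcases (Metric.sphere (0 : R) 1).eq_empty_or_nonempty with he | hne
    · refine ⟨1, one_pos, fun y => ?_⟩
      have hy : y = 0 := by
        by_contra hy
        have : (‖y‖⁻¹ • y) ∈ Metric.sphere (0 : R) 1 := by
          simp [norm_smul, hy]
        rw [he] at this; exact this
      subst hy
      simp [p]
    · obtain ⟨y0, hy0, hmin⟩ := (isCompact_sphere (0 : R) 1).exists_isMinOn hne hpc.continuousOn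
      have hy0' : y0 ≠ 0 := by
        rintro rfl
        simp at hy0
      refine ⟨p y0, hppos y0 hy0', fun y => ?_⟩
      by_cases hy : y = 0
      · subst hy; simp [p]
      have h1 : p y0 ≤ p (‖y‖⁻¹ • y) := hmin (by simp [norm_smul, hy])
      rw [hphom _ _ (by positivity)] at h1
      have h2 : 0 < ‖y‖ := norm_pos_iff.2 hy
      rwa [inv_mul_eq_div, le_div_iff₀ h2] at h1
  obtain ⟨δ, hδ, hδp⟩ := hδ
  have hlim : Tendsto G (cocompact R) atTop :=
    tendsto_atTop_mono (fun y => (hδp y).trans (hpG y))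
      ((tendsto_norm_cocompact_atTop (E := R)).const_mul_atTop hδ)
  obtain ⟨⟨_, ξ, rfl⟩, hmin⟩ := hGc.exists_forall_le hlim
  refine ⟨ξ, ?_⟩
  funext i
  let e : Fin n → ℝ := Pi.single i 1
  have hd : HasDerivAt (fun t : ℝ => ∑ u ∈ S, c u * Real.exp (b u ⬝ᵥ ξ + t * b u i))
      (∑ u ∈ S, c u * (Real.exp (b u ⬝ᵥ ξ + 0 * b u i) * (1 * b u i))) 0 := by
    refine HasDerivAt.fun_sum fun u _ => ?_
    exact ((((hasDerivAt_id (0 : ℝ)).mul_const (b u i)).const_add (b u ⬝ᵥ ξ)).exp).const_mul (c u)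
  have hloc : IsLocalMin (fun t : ℝ => ∑ u ∈ S, c u * Real.exp (b u ⬝ᵥ ξ + t * b u i)) 0 := by
    refine Eventually.of_forall fun t => ?_
    have h1 := hmin ⟨A (ξ + t • e), _, rfl⟩
    simp only [G, hA] at h1
    have h2 : ∀ u : S, b u ⬝ᵥ (ξ + t • e) = b u ⬝ᵥ ξ + t * b u i := by
      intro u; simp [e, dotProduct_add]
    simp only [h2] at h1
    rw [Finset.sum_coe_sort S (fun u => c u * Real.exp (b u ⬝ᵥ ξ)),
      Finset.sum_coe_sort S (fun u => c u * Real.exp (b u ⬝ᵥ ξ + t * b u i))] at h1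
    simpa using h1
  have h0 := hloc.hasDerivAt_eq_zero hd
  rw [Finset.sum_apply, Pi.zero_apply, ← h0]
  refine Finset.sum_congr rfl fun u _ => ?_
  simp only [Pi.smul_apply, smul_eq_mul]
  rw [zero_mul, add_zero]; ring

namespace DelzantPolytope

variable {n d : ℕ} (P : DelzantPolytope n d)

/-! ### Faces, vertices and dual bases of the polytope -/

theorem ell_eq (k : Fin d) (x : Fin n → ℝ) : P.ell k x = toReal (P.v k) ⬝ᵥ x + P.lam k := rfl

theorem ell_toReal (k : Fin d) (u : Fin n → ℤ) : P.ell k (toReal u) = P.ellZ k u := by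
  simp [ell, ellZ, pair, toReal]

theorem ellZ_nonneg {u : Fin n → ℤ} (hu : u ∈ P.latticePts) (k : Fin d) : 0 ≤ P.ellZ k u := by
  have h := hu k
  change 0 ≤ P.ell k (toReal u) at h
  rw [ell_toReal] at h
  exact_mod_cast h

theorem ell_nonneg {x : Fin n → ℝ} (hx : x ∈ P.body) (k : Fin d) : 0 ≤ P.ell k x := hx k

theorem mem_body_iff {x : Fin n → ℝ} : x ∈ P.body ↔ ∀ k, 0 ≤ P.ell k x := Iff.rfl

theorem mem_latticeFinset {u : Fin n → ℤ} : u ∈ P.latticeFinset ↔ u ∈ P.latticePts := by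
  simp [latticeFinset]

theorem continuous_ell (k : Fin d) : Continuous (P.ell k) :=
  (continuous_pair _).add continuous_const

theorem ell_combo (k : Fin d) {a b : ℝ} (hab : a + b = 1) (x y : Fin n → ℝ) :
    P.ell k (a • x + b • y) = a * P.ell k x + b * P.ell k y := by
  simp only [ell, pair_add, pair_smul]
  linear_combination -(P.lam k : ℝ) * hab

theorem ell_add_smul (k : Fin d) (x w : Fin n → ℝ) (t : ℝ) :
    P.ell k (x + t • w) = P.ell k x + t * pair (P.v k) w := by
  simp only [ell, pair_add, pair_smul]; ring

theorem isClosed_body : IsClosed P.body := P.compact.isClosed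

theorem body_nonempty : P.body.Nonempty := by
  by_cases h : ∃ k : Fin d, True
  · obtain ⟨k, -⟩ := h
    obtain ⟨x, hx, -⟩ := P.facet k
    exact ⟨x, hx⟩
  · exact ⟨0, fun k => absurd ⟨k, trivial⟩ h⟩

/-- A linear form is dominated at a point of the polytope by its value at a vertex of the face
of that point. -/
theorem exists_vertex_ge {y : Fin n → ℝ} (hy : y ∈ P.body) (ζ : Fin n → ℝ) :
    ∃ x ∈ P.body.extremePoints ℝ, (∀ k, P.ell k y = 0 → P.ell k x = 0) ∧ ζ ⬝ᵥ y ≤ ζ ⬝ᵥ x := by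
  let F : Set (Fin n → ℝ) := {x | x ∈ P.body ∧ ∀ k, P.ell k y = 0 → P.ell k x = 0}
  have hζ : Continuous fun x : Fin n → ℝ => ζ ⬝ᵥ x := by unfold dotProduct; fun_prop
  have hFc : IsCompact F := by
    refine P.compact.of_isClosed_subset ?_ (fun x hx => hx.1)
    refine P.isClosed_body.inter ?_
    have : {x | ∀ k, P.ell k y = 0 → P.ell k x = 0} =
        ⋂ k, ⋂ _ : P.ell k y = 0, P.ell k ⁻¹' {0} := by
      ext; simp
    change IsClosed {x | ∀ k, P.ell k y = 0 → P.ell k x = 0}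
    rw [this]
    exact isClosed_iInter fun k => isClosed_iInter fun _ =>
      isClosed_singleton.preimage (P.continuous_ell k)
  have hyF : y ∈ F := ⟨hy, fun _ h => h⟩
  obtain ⟨x0, hx0, hmax⟩ := hFc.exists_isMaxOn ⟨y, hyF⟩ hζ.continuousOn
  -- The maximisers of `ζ` on the face `F` of `y` form a face of `F`. An extreme point of `S` exists
  -- by compactness, and it is extreme in `B` because a segment of `B` through a point of `S` lies
  -- first in `F`, then in `S`.
  let S : Set (Fin n → ℝ) := F ∩ {x | ζ ⬝ᵥ x0 ≤ ζ ⬝ᵥ x}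
  have hSc : IsCompact S := hFc.inter_right (isClosed_le continuous_const hζ)
  obtain ⟨x, hx⟩ := hSc.extremePoints_nonempty ⟨x0, hx0, le_refl (ζ ⬝ᵥ x0)⟩
  have hxS : x ∈ S := hx.1
  refine ⟨x, ?_, hxS.1.2, (hmax hyF).trans hxS.2⟩
  rw [mem_extremePoints]
  refine ⟨hxS.1.1, fun a ha b hb hab => ?_⟩
  obtain ⟨s, t, hs, ht, hst, hxe⟩ := id hab
  have hF : ∀ k, P.ell k y = 0 → P.ell k a = 0 ∧ P.ell k b = 0 := by
    intro k hk
    have h1 := hxS.1.2 k hk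
    rw [← hxe, P.ell_combo k hst] at h1
    have ha' := P.ell_nonneg ha k
    have hb' := P.ell_nonneg hb k
    have h2 := mul_nonneg hs.le ha'
    have h3 := mul_nonneg ht.le hb'
    constructor
    · have : s * P.ell k a = 0 := by linarith
      simpa [hs.ne'] using this
    · have : t * P.ell k b = 0 := by linarith
      simpa [ht.ne'] using this
  have haF : a ∈ F := ⟨ha, fun k hk => (hF k hk).1⟩
  have hbF : b ∈ F := ⟨hb, fun k hk => (hF k hk).2⟩
  have h1 : ζ ⬝ᵥ a ≤ ζ ⬝ᵥ x0 := hmax haF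
  have h2 : ζ ⬝ᵥ b ≤ ζ ⬝ᵥ x0 := hmax hbF
  have h3 : ζ ⬝ᵥ x0 ≤ s * ζ ⬝ᵥ a + t * ζ ⬝ᵥ b := by
    have := hxS.2
    rw [← hxe] at this
    simpa [dotProduct_add, dotProduct_smul] using this
  have haS : a ∈ S := ⟨haF, by
    change ζ ⬝ᵥ x0 ≤ ζ ⬝ᵥ a
    refine le_of_mul_le_mul_left ?_ hs
    linear_combination h3 + t * h2 + ζ ⬝ᵥ x0 * hst⟩
  have hbS : b ∈ S := ⟨hbF, by
    change ζ ⬝ᵥ x0 ≤ ζ ⬝ᵥ b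
    refine le_of_mul_le_mul_left ?_ ht
    linear_combination h3 + s * h1 + ζ ⬝ᵥ x0 * hst⟩
  exact (mem_extremePoints.1 hx).2 a haS b hbS hab

/-- The basis dual to the normals at a vertex, extended by zero to the other normals. -/
theorem exists_dualBasis {x : Fin n → ℝ} (hx : x ∈ P.body.extremePoints ℝ) :
    ∃ w : Fin d → Fin n → ℤ, (∀ k, P.ell k x ≠ 0 → w k = 0) ∧
      (∀ j k, P.ell j x = 0 → P.ell k x = 0 →
        ∑ i, P.v j i * w k i = if j = k then 1 else 0) ∧
      ∀ i i', ∑ k, w k i * P.v k i' = if i = i' then 1 else 0 := by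
  classical
  let b := Module.Basis.mk (P.smooth_indep x hx) (P.smooth_span x hx).ge
  have hb : ∀ k, b k = P.v k := fun k => Module.Basis.mk_apply _ _ k
  have hcoord : ∀ k (z : Fin n → ℤ), b.repr z k = ∑ i, z i * b.repr (Pi.single i 1) k := by
    intro k z
    conv_lhs => rw [pi_eq_sum_univ z]
    -- The dual vector `w k` is the `k`-th coordinate functional of the basis, written by its values
    -- on the standard vectors; the last clause of the statement is the expansion of a standard
    -- vector in the basis.
    simp only [map_sum, map_smul, Finsupp.coe_finsetSum, Finset.sum_apply, Finsupp.smul_apply,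
      smul_eq_mul]
    refine Finset.sum_congr rfl fun i _ => ?_
    congr 3
    funext j
    simp [Pi.single_apply, eq_comm]
  simp only [ell]
  refine ⟨fun k i => if h : pair (P.v k) x + (P.lam k : ℝ) = 0 then
    b.repr (Pi.single i 1) ⟨k, h⟩ else 0, fun k hk => ?_, fun j k hj hk => ?_, fun i i' => ?_⟩
  · funext i; simp [hk]
  · simp only [hk, dif_pos]
    rw [← hcoord, ← hb ⟨j, hj⟩, Module.Basis.repr_self, Finsupp.single_apply]
    simp
  · have h1 := congrFun (b.sum_repr (Pi.single i 1)) i'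
    rw [Finset.sum_apply] at h1
    simp only [hb, Pi.smul_apply, smul_eq_mul, Pi.single_apply] at h1
    have h2 : (if i = i' then (1 : ℤ) else 0) = if i' = i then 1 else 0 := by
      simp only [eq_comm]
    rw [h2, ← h1]
    symm
    refine Finset.sum_of_injOn Subtype.val Subtype.val_injective.injOn (by simp) ?_ ?_
    · intro k _ hk
      have hk' : pair (P.v k) x + (P.lam k : ℝ) ≠ 0 := fun h => hk ⟨⟨k, h⟩, by simp, rfl⟩
      simp [hk']
    · rintro ⟨k, hk⟩ _
      simp [hk]

theorem exists_vertex : ∃ x, x ∈ P.body.extremePoints ℝ := by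
  obtain ⟨y, hy⟩ := P.body_nonempty
  obtain ⟨x, hx, -⟩ := P.exists_vertex_ge hy 0
  exact ⟨x, hx⟩

/-- The normals generate the lattice. -/
theorem exists_generators : ∃ w : Fin d → Fin n → ℤ,
    ∀ i i', ∑ k, w k i * P.v k i' = if i = i' then 1 else 0 := by
  obtain ⟨x, hx⟩ := P.exists_vertex
  obtain ⟨w, -, -, h⟩ := P.exists_dualBasis hx
  exact ⟨w, h⟩

/-- The integral generators solve this over `ℝ` as well. It lifts points of `N_ℝ` to logarithms of
homogeneous coordinates. -/
theorem exists_sum_smul_eq (ξ : Fin n → ℝ) :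
    ∃ θ : Fin d → ℝ, ∀ i, ∑ k, (P.v k i : ℝ) * θ k = ξ i := by
  obtain ⟨w, hw⟩ := P.exists_generators
  refine ⟨fun k => ∑ i, (w k i : ℝ) * ξ i, fun i => ?_⟩
  have h : ∀ i', ∑ k, (w k i' : ℝ) * P.v k i = if i' = i then 1 else 0 := by
    intro i'; exact_mod_cast hw i' i
  simp only [Finset.mul_sum]
  rw [Finset.sum_comm]
  calc ∑ i', ∑ k, (P.v k i : ℝ) * (w k i' * ξ i')
      = ∑ i', (∑ k, (w k i' : ℝ) * P.v k i) * ξ i' := by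
        refine Finset.sum_congr rfl fun i' _ => ?_
        rw [Finset.sum_mul]
        exact Finset.sum_congr rfl fun k _ => by ring
    _ = ξ i := by simp [h]

/-- The vertices of the polytope are lattice points. -/
theorem exists_lattice_of_vertex {x : Fin n → ℝ} (hx : x ∈ P.body.extremePoints ℝ) :
    ∃ u ∈ P.latticePts, toReal u = x := by
  obtain ⟨w, h0, -, h2⟩ := P.exists_dualBasis hx
  have h : ∀ i i', ∑ k, (w k i : ℝ) * P.v k i' = if i = i' then 1 else 0 := by
    intro i i'; exact_mod_cast h2 i i'
  -- The active equations `⟨v_k, x⟩ = -λ_k` have a unimodular matrix, whose inverse is the dual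
  -- basis, so their solution is integral.
  have key : toReal (fun i => -∑ k, w k i * P.lam k) = x := by
    funext i
    have h3 : x i = ∑ k, (w k i : ℝ) * pair (P.v k) x := by
      simp only [pair, Finset.mul_sum]
      rw [Finset.sum_comm]
      simp only [← mul_assoc, ← Finset.sum_mul, h]
      simp
    rw [h3]
    simp only [toReal, Int.cast_neg, Int.cast_sum, Int.cast_mul, ← Finset.sum_neg_distrib]
    refine Finset.sum_congr rfl fun k _ => ?_
    by_cases hk : P.ell k x = 0
    · have : pair (P.v k) x = -P.lam k := by
        unfold ell at hk; linarith
      rw [this]; ring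
    · simp [h0 k hk]
  exact ⟨_, by change toReal _ ∈ P.body; rw [key]; exact hx.1, key⟩

theorem weight_pos_of_vertex {c : (Fin n → ℤ) → ℝ} (hc : P.IsEmbeddingWeight c)
    {u : Fin n → ℤ} (hu : toReal u ∈ P.body.extremePoints ℝ) : 0 < c u := by
  refine hc.2 _ hu u hu.1 ?_
  rw [Finset.sum_eq_zero]
  · exact zero_le_one
  · intro k hk
    have := (Finset.mem_filter.1 hk).2
    rw [ell_toReal] at this
    exact_mod_cast this

/-- A linear form is dominated at a point of the polytope by its value at a lattice point of
positive weight on the face of that point. -/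
theorem exists_weight_pos_ge {c : (Fin n → ℤ) → ℝ} (hc : P.IsEmbeddingWeight c)
    {y : Fin n → ℝ} (hy : y ∈ P.body) (ζ : Fin n → ℝ) :
    ∃ u ∈ P.latticePts, 0 < c u ∧ (∀ k, P.ell k y = 0 → P.ellZ k u = 0) ∧
      ζ ⬝ᵥ y ≤ ζ ⬝ᵥ toReal u := by
  obtain ⟨x, hx, h1, h2⟩ := P.exists_vertex_ge hy ζ
  obtain ⟨u, hu, rfl⟩ := P.exists_lattice_of_vertex hx
  refine ⟨u, hu, P.weight_pos_of_vertex hc hx, fun k hk => ?_, h2⟩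
  have := h1 k hk
  rw [ell_toReal] at this
  exact_mod_cast this

/-- Taking the linear form to be `v_k` itself yields a weighted point on the face of `y` where `ℓ_k`
is at least its positive value at `y`. -/
theorem exists_weight_pos_ellZ_pos {c : (Fin n → ℤ) → ℝ} (hc : P.IsEmbeddingWeight c)
    {y : Fin n → ℝ} (hy : y ∈ P.body) {k : Fin d} (hk : P.ell k y ≠ 0) :
    ∃ u ∈ P.latticePts, 0 < c u ∧ (∀ j, P.ell j y = 0 → P.ellZ j u = 0) ∧ 0 < P.ellZ k u := by
  obtain ⟨u, hu, h1, h2, h3⟩ := P.exists_weight_pos_ge hc hy (toReal (P.v k))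
  refine ⟨u, hu, h1, h2, ?_⟩
  have h4 : P.ell k y ≤ P.ell k (toReal u) := by
    rw [ell_eq, ell_eq]; linarith
  have h5 := lt_of_le_of_ne (P.ell_nonneg hy k) (Ne.symm hk)
  rw [ell_toReal] at h4
  exact_mod_cast h5.trans_le h4

/-- A set of normals whose facets have a common point is the set of all normals of a face. -/
theorem exists_mem_body_ell_eq_zero_iff {x : Fin n → ℝ} (hx : x ∈ P.body) (Z : Set (Fin d))
    (hZ : ∀ k ∈ Z, P.ell k x = 0) : ∃ y ∈ P.body, ∀ k, P.ell k y = 0 ↔ k ∈ Z := by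
  classical
  obtain ⟨x0, hx0, hF, -⟩ := P.exists_vertex_ge hx 0
  obtain ⟨w, -, hw, -⟩ := P.exists_dualBasis hx0
  -- Moving from a vertex along the sum of the dual vectors outside `Z` leaves exactly those facets.
  -- This uses that the active normals at a vertex are independent.
  let W : Fin n → ℝ := ∑ k with P.ell k x0 = 0 ∧ k ∉ Z, toReal (w k)
  have hvw : ∀ j k, P.ell j x0 = 0 → P.ell k x0 = 0 →
      pair (P.v j) (toReal (w k)) = if j = k then 1 else 0 := by
    intro j k hj hk
    have := hw j k hj hk
    unfold pair toReal
    exact_mod_cast this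
  have hW : ∀ j, P.ell j x0 = 0 → pair (P.v j) W = if j ∈ Z then 0 else 1 := by
    intro j hj
    have h1 : pair (P.v j) W =
        ∑ k with P.ell k x0 = 0 ∧ k ∉ Z, pair (P.v j) (toReal (w k)) := by
      simp only [W, pair_eq_dotProduct, dotProduct_sum]
    rw [h1, Finset.sum_congr rfl fun k hk => hvw j k hj (Finset.mem_filter.1 hk).2.1]
    simp [hj, ite_not]
  have hev : ∀ᶠ t : ℝ in 𝓝[>] 0, ∀ k, P.ell k x0 ≠ 0 → 0 < P.ell k (x0 + t • W) := by
    refine eventually_all.2 fun k => ?_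
    by_cases hk : P.ell k x0 = 0
    · simp [hk]
    have hcont : Continuous fun t : ℝ => P.ell k (x0 + t • W) :=
      (P.continuous_ell k).comp (by fun_prop)
    have h0 : 0 < P.ell k (x0 + (0 : ℝ) • W) := by
      simpa using lt_of_le_of_ne (P.ell_nonneg hx0.1 k) (Ne.symm hk)
    filter_upwards [nhdsWithin_le_nhds (hcont.continuousAt.eventually (lt_mem_nhds h0))]
      with t ht _ using ht
  obtain ⟨t, ht, htpos⟩ := (hev.and self_mem_nhdsWithin).exists
  have htpos : 0 < t := htpos
  have hact : ∀ k, P.ell k x0 = 0 → P.ell k (x0 + t • W) = if k ∈ Z then 0 else t := by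
    intro k hk
    rw [P.ell_add_smul, hk, hW k hk]
    split_ifs <;> simp
  refine ⟨x0 + t • W, fun k => ?_, fun k => ?_⟩
  · change 0 ≤ P.ell k (x0 + t • W)
    by_cases hk : P.ell k x0 = 0
    · rw [hact k hk]; split_ifs <;> simp [htpos.le]
    · exact (ht k hk).le
  · by_cases hk : P.ell k x0 = 0
    · rw [hact k hk]
      by_cases hkZ : k ∈ Z <;> simp [hkZ, htpos.ne']
    · exact ⟨fun h => absurd h (ht k hk).ne', fun h => absurd (hF k (hZ k h)) hk⟩

/-- A linear form that is constant on the weights of a face is a combination of the normals of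
that face. -/
theorem exists_sum_normals_eq {c : (Fin n → ℤ) → ℝ} (hc : P.IsEmbeddingWeight c)
    {y : Fin n → ℝ} (hy : y ∈ P.body) (ζ : Fin n → ℝ) (C : ℝ)
    (hζ : ∀ u ∈ P.latticePts, 0 < c u → (∀ k, P.ell k y = 0 → P.ellZ k u = 0) →
      ζ ⬝ᵥ toReal u = C) :
    ∃ b : Fin d → ℝ, (∀ k, P.ell k y ≠ 0 → b k = 0) ∧ ∀ i, ∑ k, b k * P.v k i = ζ i := by
  classical
  obtain ⟨x0, hx0, hF, -⟩ := P.exists_vertex_ge hy 0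
  obtain ⟨w, hw0, hw, hw2⟩ := P.exists_dualBasis hx0
  -- On the face of `y` both `ζ` and `-ζ` are bounded by their values at weighted lattice points of
  -- the face, so `ζ` is constant there.
  have hle : ∀ y' ∈ P.body, (∀ k, P.ell k y = 0 → P.ell k y' = 0) → ζ ⬝ᵥ y' = C := by
    intro y' hy' hF'
    obtain ⟨u, hu, hcu, hFu, h1⟩ := P.exists_weight_pos_ge hc hy' ζ
    obtain ⟨u', hu', hcu', hFu', h1'⟩ := P.exists_weight_pos_ge hc hy' (-ζ)
    rw [hζ u hu hcu fun k hk => hFu k (hF' k hk)] at h1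
    rw [neg_dotProduct, neg_dotProduct, hζ u' hu' hcu' fun k hk => hFu' k (hF' k hk)] at h1'
    linarith
  -- These are the coefficients of `ζ` in the basis of normals at a vertex of the face. If `k` is
  -- not active at `y`, then `w k` is tangent to the face (or zero), so the constancy of `ζ` kills
  -- the coefficient.
  refine ⟨fun k => ζ ⬝ᵥ toReal (w k), fun k hk => ?_, fun i => ?_⟩
  · have hperp : ∀ j, P.ell j y = 0 → pair (P.v j) (toReal (w k)) = 0 := by
      intro j hj
      by_cases hk0 : P.ell k x0 = 0
      · have h1 := hw j k (hF j hj) hk0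
        rw [if_neg (by rintro rfl; exact hk hj)] at h1
        unfold pair toReal
        exact_mod_cast h1
      · rw [hw0 k hk0]; simp [pair, toReal]
    have hev : ∀ᶠ t : ℝ in 𝓝[>] 0, ∀ j, P.ell j y ≠ 0 → 0 < P.ell j (y + t • toReal (w k)) := by
      refine eventually_all.2 fun j => ?_
      by_cases hj : P.ell j y = 0
      · simp [hj]
      have hcont : Continuous fun t : ℝ => P.ell j (y + t • toReal (w k)) :=
        (P.continuous_ell j).comp (by fun_prop)
      have h0 : 0 < P.ell j (y + (0 : ℝ) • toReal (w k)) := by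
        simpa using lt_of_le_of_ne (P.ell_nonneg hy j) (Ne.symm hj)
      filter_upwards [nhdsWithin_le_nhds (hcont.continuousAt.eventually (lt_mem_nhds h0))]
        with t ht _ using ht
    obtain ⟨t, ht, htpos⟩ := (hev.and self_mem_nhdsWithin).exists
    have htpos : 0 < t := htpos
    have hface : ∀ j, P.ell j y = 0 → P.ell j (y + t • toReal (w k)) = 0 := by
      intro j hj
      rw [P.ell_add_smul, hj, hperp j hj]; simp
    have h1 := hle _ (fun j => by
      change 0 ≤ P.ell j (y + t • toReal (w k))
      by_cases hj : P.ell j y = 0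
      · exact (hface j hj).ge
      · exact (ht j hj).le) hface
    rw [dotProduct_add, hle y hy fun _ h => h, dotProduct_smul, smul_eq_mul] at h1
    have : t * ζ ⬝ᵥ toReal (w k) = 0 := by linarith
    simpa [htpos.ne'] using this
  · have h : ∀ i' i, ∑ k, (w k i' : ℝ) * P.v k i = if i' = i then 1 else 0 := by
      intro i' i; exact_mod_cast hw2 i' i
    simp only [dotProduct, Finset.sum_mul, toReal]
    rw [Finset.sum_comm]
    simp only [mul_assoc, ← Finset.mul_sum, h]
    simp

/-- Points with prescribed face exist as moments: the critical point equation for the weights on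
the face of `x`. -/
theorem exists_balanced {c : (Fin n → ℤ) → ℝ} (hc : P.IsEmbeddingWeight c)
    {x : Fin n → ℝ} (hx : x ∈ P.body) (S : Finset (Fin n → ℤ))
    (hS : ∀ u, u ∈ S ↔ u ∈ P.latticePts ∧ ∀ k, P.ell k x = 0 → P.ellZ k u = 0) :
    ∃ ξ : Fin n → ℝ, ∑ u ∈ S, (c u * Real.exp (4 * Real.pi * pair u ξ)) • (toReal u - x) = 0 := by
  classical
  -- Zero weights are allowed in the data but contribute nothing; they are discarded because the
  -- critical point lemma needs strict positivity.
  have hcS : ∀ u ∈ S.filter (fun u => 0 < c u), 0 < c u := fun u hu => (Finset.mem_filter.1 hu).2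
  obtain ⟨ξ, hξ⟩ := exists_sum_exp_smul_eq_zero (S.filter fun u => 0 < c u)
    (fun u => toReal u - x) c hcS (by
      rintro ξ ⟨u, hu, hneg⟩
      obtain ⟨huS, hcu⟩ := Finset.mem_filter.1 hu
      obtain ⟨huL, huF⟩ := (hS u).1 huS
      -- move slightly beyond `x`, away from `u`
      have hev : ∀ᶠ t : ℝ in 𝓝[>] 0, ∀ k, P.ell k x ≠ 0 → 0 < P.ell k (x + t • (x - toReal u)) := by
        refine eventually_all.2 fun k => ?_
        by_cases hk : P.ell k x = 0
        · simp [hk]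
        have hcont : Continuous fun t : ℝ => P.ell k (x + t • (x - toReal u)) :=
          (P.continuous_ell k).comp (by fun_prop)
        have h0 : 0 < P.ell k (x + (0 : ℝ) • (x - toReal u)) := by
          simpa using lt_of_le_of_ne (P.ell_nonneg hx k) (Ne.symm hk)
        filter_upwards [nhdsWithin_le_nhds (hcont.continuousAt.eventually (lt_mem_nhds h0))]
          with t ht _ using ht
      obtain ⟨t, ht, htpos⟩ := (hev.and self_mem_nhdsWithin).exists
      have htpos : 0 < t := htpos
      have hell0 : ∀ k, P.ell k x = 0 → P.ell k (x + t • (x - toReal u)) = 0 := by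
        intro k hk
        have h1 : P.ell k (toReal u) = 0 := by rw [ell_toReal, huF k hk]; simp
        have h2 : x + t • (x - toReal u) = (1 + t) • x + (-t) • toReal u := by
          module
        rw [h2, P.ell_combo k (by ring), hk, h1]; simp
      have hy : x + t • (x - toReal u) ∈ P.body := by
        rw [mem_body_iff]
        intro k
        by_cases hk : P.ell k x = 0
        · exact (hell0 k hk).ge
        · exact (ht k hk).le
      obtain ⟨u', hu', hcu', hF', hge⟩ := P.exists_weight_pos_ge hc hy ξ
      refine ⟨u', Finset.mem_filter.2 ⟨(hS u').2 ⟨hu', fun k hk => hF' k (hell0 k hk)⟩, hcu'⟩, ?_⟩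
      rw [dotProduct_add, dotProduct_smul, smul_eq_mul, dotProduct_comm ξ (x - toReal u)] at hge
      have h3 : (toReal u - x) ⬝ᵥ ξ = -((x - toReal u) ⬝ᵥ ξ) := by
        rw [← neg_dotProduct, neg_sub]
      rw [h3] at hneg
      rw [sub_dotProduct, dotProduct_comm (toReal u'), dotProduct_comm x]
      nlinarith)
  refine ⟨(4 * Real.pi)⁻¹ • ξ, ?_⟩
  have hpi : 4 * Real.pi ≠ 0 := by positivity
  -- Replacing the frequency `u - x` by `u` costs only the common factor `e^{⟨x,ξ⟩}`, which does not
  -- affect a vanishing sum.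
  have e1 : ∀ u, 4 * Real.pi * pair u ((4 * Real.pi)⁻¹ • ξ) = (toReal u - x) ⬝ᵥ ξ + x ⬝ᵥ ξ := by
    intro u
    rw [pair_smul, ← mul_assoc, mul_inv_cancel₀ hpi, sub_dotProduct, pair_eq_dotProduct]; ring
  have e2 : ∀ u ∈ S, (c u * Real.exp (4 * Real.pi * pair u ((4 * Real.pi)⁻¹ • ξ))) •
      (toReal u - x) = Real.exp (x ⬝ᵥ ξ) • if 0 < c u then
        (c u * Real.exp ((toReal u - x) ⬝ᵥ ξ)) • (toReal u - x) else 0 := by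
    intro u hu
    rw [e1, Real.exp_add]
    split_ifs with h
    · rw [smul_smul]; congr 1; ring
    · have : c u = 0 := le_antisymm (not_lt.1 h) (hc.1 u ((hS u).1 hu).1)
      simp [this]
  rw [Finset.sum_congr rfl e2, ← Finset.smul_sum, ← Finset.sum_filter, hξ, smul_zero]

theorem sum_ellZ_mul {A : Type*} [CommRing A] (u : Fin n → ℤ) (θ : Fin d → A) :
    ∑ k, (P.ellZ k u : A) * θ k =
      ∑ i, (u i : A) * (∑ k, (P.v k i : A) * θ k) + ∑ k, (P.lam k : A) * θ k := by
  simp only [ellZ, Int.cast_add, Int.cast_sum, Int.cast_mul, add_mul, Finset.sum_add_distrib,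
    Finset.sum_mul, Finset.mul_sum]
  congr 1
  rw [Finset.sum_comm]
  exact Finset.sum_congr rfl fun i _ => Finset.sum_congr rfl fun k _ => by ring

/-! ### The moment map in homogeneous coordinates -/

theorem mono_ne_zero {u : Fin n → ℤ} {z : Fin d → ℂ} (h : ∀ k, z k = 0 → P.ellZ k u = 0) :
    P.mono u z ≠ 0 := by
  refine Finset.prod_ne_zero_iff.2 fun k _ => ?_
  by_cases hk : z k = 0
  · simp [h k hk]
  · exact zpow_ne_zero _ hk

theorem mono_eq_zero {u : Fin n → ℤ} {z : Fin d → ℂ} {k : Fin d} (hz : z k = 0)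
    (hk : P.ellZ k u ≠ 0) : P.mono u z = 0 :=
  Finset.prod_eq_zero (Finset.mem_univ k) (by rw [hz, zero_zpow _ hk])

/-- The facets with `z_k = 0` share a point of `B`, and its face has a weighted lattice point, whose
monomial does not vanish at `z`. -/
theorem hSum_pos {c : (Fin n → ℤ) → ℝ} (hc : P.IsEmbeddingWeight c) {z : Fin d → ℂ}
    (hz : z ∈ P.coxSet) : 0 < P.hSum c z := by
  obtain ⟨x, hx, hxz⟩ := hz
  obtain ⟨u, hu, hcu, hF, -⟩ := P.exists_weight_pos_ge hc hx 0
  have h1 : P.mono u z ≠ 0 := P.mono_ne_zero fun k hk => hF k (hxz k hk)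
  refine Finset.sum_pos' (fun u hu => mul_nonneg (hc.1 u (P.mem_latticeFinset.1 hu)) (sq_nonneg _))
    ⟨u, P.mem_latticeFinset.2 hu, ?_⟩
  have := norm_pos_iff.2 h1
  positivity

/-- An affine function commutes with weighted averages; the constant `λ_k` is averaged correctly
because the weights are normalised by `H`. -/
theorem ell_momentCox {c : (Fin n → ℤ) → ℝ} {z : Fin d → ℂ} (hz : P.hSum c z ≠ 0) (k : Fin d) :
    P.ell k (P.momentCox c z) =
      (∑ u ∈ P.latticeFinset, c u * ‖P.mono u z‖ ^ 2 * (P.ellZ k u : ℝ)) / P.hSum c z := by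
  rw [eq_div_iff hz]
  simp only [ell, pair, momentCox, add_mul, Finset.sum_mul, mul_assoc, div_mul_cancel₀ _ hz]
  simp only [Finset.mul_sum]
  rw [Finset.sum_comm, hSum, Finset.mul_sum, ← Finset.sum_add_distrib]
  refine Finset.sum_congr rfl fun u _ => ?_
  simp only [ellZ, Int.cast_add, Int.cast_sum, Int.cast_mul, mul_add, Finset.mul_sum]
  congr 1
  · exact Finset.sum_congr rfl fun i _ => by ring
  · ring

theorem momentCox_mem_body {c : (Fin n → ℤ) → ℝ} (hc : P.IsEmbeddingWeight c) {z : Fin d → ℂ}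
    (hz : z ∈ P.coxSet) : P.momentCox c z ∈ P.body := by
  intro k
  change 0 ≤ P.ell k (P.momentCox c z)
  rw [P.ell_momentCox (P.hSum_pos hc hz).ne']
  refine div_nonneg (Finset.sum_nonneg fun u hu => ?_) (P.hSum_pos hc hz).le
  have hu' := P.mem_latticeFinset.1 hu
  have h1 := hc.1 u hu'
  have h2 : (0 : ℝ) ≤ P.ellZ k u := by exact_mod_cast P.ellZ_nonneg hu' k
  positivity

/-- The face of the moment of a point is given by the vanishing homogeneous coordinates. -/
theorem ell_momentCox_eq_zero_iff {c : (Fin n → ℤ) → ℝ} (hc : P.IsEmbeddingWeight c)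
    {z : Fin d → ℂ} (hz : z ∈ P.coxSet) (k : Fin d) :
    P.ell k (P.momentCox c z) = 0 ↔ z k = 0 := by
  have hH := P.hSum_pos hc hz
  rw [P.ell_momentCox hH.ne', div_eq_zero_iff, or_iff_left hH.ne']
  have hnn : ∀ u ∈ P.latticeFinset, 0 ≤ c u * ‖P.mono u z‖ ^ 2 * (P.ellZ k u : ℝ) := by
    intro u hu
    have hu' := P.mem_latticeFinset.1 hu
    have h1 := hc.1 u hu'
    have h2 : (0 : ℝ) ≤ P.ellZ k u := by exact_mod_cast P.ellZ_nonneg hu' k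
    positivity
  constructor
  · intro h0
    by_contra hk
    obtain ⟨x, hx, hxz⟩ := hz
    -- The point `x` witnessing `z ∈ U` may lie on further facets, possibly on facet `k`. It is
    -- replaced by a point whose facets are exactly those with `z_j = 0`; its face then carries a
    -- nonvanishing monomial with positive `ℓ_k`.
    obtain ⟨y, hy, hyz⟩ := P.exists_mem_body_ell_eq_zero_iff hx {k | z k = 0} hxz
    obtain ⟨u, hu, hcu, hF, hku⟩ := P.exists_weight_pos_ellZ_pos hc hy (fun h => hk ((hyz k).1 h))
    have h1 : P.mono u z ≠ 0 := P.mono_ne_zero fun j hj => hF j ((hyz j).2 hj)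
    have h2 := (Finset.sum_eq_zero_iff_of_nonneg hnn).1 h0 u (P.mem_latticeFinset.2 hu)
    have h3 : (P.ellZ k u : ℝ) ≠ 0 := by exact_mod_cast hku.ne'
    exact mul_ne_zero (mul_ne_zero hcu.ne' (pow_ne_zero _ (norm_ne_zero_iff.2 h1))) h3 h2
  · intro hk
    refine Finset.sum_eq_zero fun u _ => ?_
    by_cases h : P.ellZ k u = 0
    · simp [h]
    · simp [P.mono_eq_zero hk h]

theorem momentCox_eq_of_sum {c : (Fin n → ℤ) → ℝ} {z : Fin d → ℂ} (hz : P.hSum c z ≠ 0)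
    {x : Fin n → ℝ}
    (h : ∑ u ∈ P.latticeFinset, (c u * ‖P.mono u z‖ ^ 2) • (toReal u - x) = 0) :
    P.momentCox c z = x := by
  funext i
  have h1 := congrFun h i
  simp only [Finset.sum_apply, Pi.smul_apply, Pi.sub_apply, smul_eq_mul, mul_sub,
    Finset.sum_sub_distrib, Pi.zero_apply, ← Finset.sum_mul] at h1
  rw [momentCox, div_eq_iff hz, hSum, mul_comm (x i)]
  simp only [toReal] at h1
  linarith

/-- The first factor does not depend on `u`, so it cancels in the moment. Coordinates with exponent
zero are unconstrained, so the formula also serves points on the toric divisors. -/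
theorem norm_mono_sq_ofReal_exp (u : Fin n → ℤ) (z : Fin d → ℂ) (θ : Fin d → ℝ)
    (h : ∀ k, P.ellZ k u ≠ 0 → ‖z k‖ = Real.exp (2 * Real.pi * θ k)) :
    ‖P.mono u z‖ ^ 2 = Real.exp (4 * Real.pi * ∑ k, (P.lam k : ℝ) * θ k) *
      Real.exp (4 * Real.pi * pair u fun i => ∑ k, (P.v k i : ℝ) * θ k) := by
  have h1 : ‖P.mono u z‖ = Real.exp (2 * Real.pi * ∑ k, (P.ellZ k u : ℝ) * θ k) := by
    rw [mono, norm_prod, Finset.mul_sum, Real.exp_sum]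
    refine Finset.prod_congr rfl fun k _ => ?_
    by_cases hk : P.ellZ k u = 0
    · simp [hk]
    · rw [norm_zpow, h k hk, ← Real.rpow_intCast, ← Real.exp_mul]
      congr 1; ring
  rw [h1, ← Real.exp_nat_mul, ← Real.exp_add, P.sum_ellZ_mul]
  congr 1
  simp only [pair]
  push_cast
  ring

-- Setting the coordinates of the active facets to zero kills all monomials off the face of `x`. The
-- other coordinates are exponentials of a lift of the balanced `ξ`, for which the remaining average
-- is `x`.
open Classical in
theorem exists_momentCox_eq {c : (Fin n → ℤ) → ℝ} (hc : P.IsEmbeddingWeight c)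
    {x : Fin n → ℝ} (hx : x ∈ P.body) : ∃ z ∈ P.coxSet, P.momentCox c z = x := by
  let S := P.latticeFinset.filter fun u => ∀ k, P.ell k x = 0 → P.ellZ k u = 0
  obtain ⟨ξ, hξ⟩ := P.exists_balanced hc hx S fun u => by
    simp [S, mem_latticeFinset]
  obtain ⟨θ, hθ⟩ := P.exists_sum_smul_eq ξ
  let z : Fin d → ℂ := fun k => if P.ell k x = 0 then 0 else (Real.exp (2 * Real.pi * θ k) : ℝ)
  have hz0 : ∀ k, z k = 0 → P.ell k x = 0 := by
    intro k hk
    by_contra h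
    simp only [z, h, if_false] at hk
    exact (Real.exp_pos _).ne' (Complex.ofReal_eq_zero.1 hk)
  have hz : z ∈ P.coxSet := ⟨x, hx, hz0⟩
  refine ⟨z, hz, P.momentCox_eq_of_sum (P.hSum_pos hc hz).ne' ?_⟩
  have key : ∀ u ∈ P.latticeFinset, (c u * ‖P.mono u z‖ ^ 2) • (toReal u - x) =
      Real.exp (4 * Real.pi * ∑ k, (P.lam k : ℝ) * θ k) •
        if ∀ k, P.ell k x = 0 → P.ellZ k u = 0 then
          (c u * Real.exp (4 * Real.pi * pair u ξ)) • (toReal u - x) else 0 := by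
    intro u _
    split_ifs with hF
    · rw [P.norm_mono_sq_ofReal_exp u z θ, smul_smul]
      · simp only [hθ]
        congr 1; ring
      · intro k hk
        have : P.ell k x ≠ 0 := fun h => hk (hF k h)
        simp only [z, this, if_false]
        rw [Complex.norm_real, Real.norm_of_nonneg (Real.exp_pos _).le]
    · push Not at hF
      obtain ⟨k, hk, hku⟩ := hF
      rw [P.mono_eq_zero (by simp [z, hk]) hku]; simp
  rw [Finset.sum_congr rfl key, ← Finset.smul_sum, ← Finset.sum_filter, hξ, smul_zero]

theorem range_moment {c : (Fin n → ℤ) → ℝ} (hc : P.IsEmbeddingWeight c) :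
    Set.range (P.moment c) = P.body := by
  ext x
  constructor
  · rintro ⟨q, rfl⟩
    obtain ⟨z, rfl⟩ := Quotient.exists_rep q
    exact P.momentCox_mem_body hc z.2
  · intro hx
    obtain ⟨z, hz, rfl⟩ := P.exists_momentCox_eq hc hx
    exact ⟨P.proj ⟨z, hz⟩, rfl⟩

/-! ### The Kähler potential -/

/-- The partition function `e^{4πφ}`. -/
noncomputable def expSum (c : (Fin n → ℤ) → ℝ) (ξ : Fin n → ℝ) : ℝ :=
  ∑ u ∈ P.latticeFinset, c u * Real.exp (4 * Real.pi * pair u ξ)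

theorem expSum_pos {c : (Fin n → ℤ) → ℝ} (hc : P.IsEmbeddingWeight c) (ξ : Fin n → ℝ) :
    0 < P.expSum c ξ := by
  obtain ⟨y, hy⟩ := P.body_nonempty
  obtain ⟨u, hu, hcu, -, -⟩ := P.exists_weight_pos_ge hc hy 0
  exact Finset.sum_pos' (fun u hu => mul_nonneg (hc.1 u (P.mem_latticeFinset.1 hu))
    (Real.exp_pos _).le) ⟨u, P.mem_latticeFinset.2 hu, mul_pos hcu (Real.exp_pos _)⟩

theorem phi_eq (c : (Fin n → ℤ) → ℝ) (ξ : Fin n → ℝ) :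
    P.phi c ξ = 1 / (4 * Real.pi) * Real.log (P.expSum c ξ) := rfl

theorem exp_phi {c : (Fin n → ℤ) → ℝ} (hc : P.IsEmbeddingWeight c) (ξ : Fin n → ℝ) :
    Real.exp (4 * Real.pi * P.phi c ξ) = P.expSum c ξ := by
  rw [phi_eq, ← mul_assoc, mul_one_div_cancel (by positivity), one_mul,
    Real.exp_log (P.expSum_pos hc ξ)]

theorem contDiff_pair (u : Fin n → ℤ) {m : WithTop ℕ∞} : ContDiff ℝ m (pair u) := by
  unfold pair; fun_prop

theorem contDiff_expSum (c : (Fin n → ℤ) → ℝ) {m : WithTop ℕ∞} : ContDiff ℝ m (P.expSum c) := by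
  refine ContDiff.sum fun u _ => contDiff_const.mul ?_
  exact (contDiff_const.mul (contDiff_pair u)).exp

theorem contDiff_phi {c : (Fin n → ℤ) → ℝ} (hc : P.IsEmbeddingWeight c) {m : WithTop ℕ∞} :
    ContDiff ℝ m (P.phi c) :=
  contDiff_const.mul ((P.contDiff_expSum c).log fun ξ => (P.expSum_pos hc ξ).ne')

theorem differentiable_phi {c : (Fin n → ℤ) → ℝ} (hc : P.IsEmbeddingWeight c) :
    Differentiable ℝ (P.phi c) := (P.contDiff_phi hc (m := 1)).differentiable (by simp)

theorem fderiv_phi_apply {c : (Fin n → ℤ) → ℝ} (hc : P.IsEmbeddingWeight c)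
    (ξ a : Fin n → ℝ) : fderiv ℝ (P.phi c) ξ a =
      (∑ u ∈ P.latticeFinset, c u * Real.exp (4 * Real.pi * pair u ξ) * pair u a) /
        P.expSum c ξ := by
  have hline : HasDerivAt (fun t : ℝ => ξ + t • a) a 0 := by
    simpa using ((hasDerivAt_id (0 : ℝ)).smul_const a).const_add ξ
  have h1 : HasDerivAt (fun t : ℝ => P.phi c (ξ + t • a)) (fderiv ℝ (P.phi c) ξ a) 0 := by
    have h2 : HasFDerivAt (P.phi c) (fderiv ℝ (P.phi c) ξ) (ξ + (0 : ℝ) • a) := by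
      simpa using (P.differentiable_phi hc ξ).hasFDerivAt
    exact h2.comp_hasDerivAt 0 hline
  have h2 : HasDerivAt (fun t : ℝ => P.expSum c (ξ + t • a))
      (∑ u ∈ P.latticeFinset, c u * (Real.exp (4 * Real.pi * (pair u ξ + 0 * pair u a)) *
        (4 * Real.pi * (1 * pair u a)))) 0 := by
    have : (fun t : ℝ => P.expSum c (ξ + t • a)) = fun t : ℝ => ∑ u ∈ P.latticeFinset,
        c u * Real.exp (4 * Real.pi * (pair u ξ + t * pair u a)) := by
      funext t; simp only [expSum, pair_add, pair_smul]
    rw [this]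
    refine HasDerivAt.fun_sum fun u _ => ?_
    exact (((((hasDerivAt_id (0 : ℝ)).mul_const (pair u a)).const_add (pair u ξ)).const_mul
      (4 * Real.pi)).exp).const_mul (c u)
  have h0 : P.expSum c (ξ + (0 : ℝ) • a) ≠ 0 := (P.expSum_pos hc _).ne'
  have h3 := (h2.log h0).const_mul (1 / (4 * Real.pi))
  rw [h1.unique h3]
  have hpi := Real.pi_ne_zero
  simp only [zero_smul, add_zero, zero_mul, one_mul]
  rw [← mul_div_assoc, Finset.mul_sum]
  congr 1
  refine Finset.sum_congr rfl fun u _ => ?_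
  field_simp

/-- The prefactor `1/(4π)` cancels the `4π` of the exponents, so `dφ` is an average of lattice
points with weights `c_u e^{4π⟨u,ξ⟩}`, as in the moment map. -/
theorem dphi_apply {c : (Fin n → ℤ) → ℝ} (hc : P.IsEmbeddingWeight c) (ξ : Fin n → ℝ)
    (i : Fin n) : P.dphi c ξ i =
      (∑ u ∈ P.latticeFinset, c u * Real.exp (4 * Real.pi * pair u ξ) * (u i : ℝ)) /
        P.expSum c ξ := by
  rw [dphi, P.fderiv_phi_apply hc]
  simp [pair, Pi.single_apply]

theorem fderiv_phi_eq_sum {c : (Fin n → ℤ) → ℝ} (ξ a : Fin n → ℝ) :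
    fderiv ℝ (P.phi c) ξ a = ∑ i, P.dphi c ξ i * a i := by
  conv_lhs => rw [pi_eq_sum_univ' a]
  rw [map_sum]
  refine Finset.sum_congr rfl fun i _ => ?_
  rw [map_smul, smul_eq_mul, mul_comm, dphi]

theorem norm_expPt (θ : Fin d → ℂ) (k : Fin d) :
    ‖(P.expPt θ).1 k‖ = Real.exp (2 * Real.pi * (θ k).re) := by
  simp only [expPt, Complex.norm_exp]
  congr 1
  simp

theorem norm_mono_expPt_sq (u : Fin n → ℤ) (θ : Fin d → ℂ) :
    ‖P.mono u (P.expPt θ).1‖ ^ 2 = Real.exp (4 * Real.pi * ∑ k, (P.lam k : ℝ) * (θ k).re) *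
      Real.exp (4 * Real.pi * pair u (P.coords θ).1) :=
  P.norm_mono_sq_ofReal_exp u _ (fun k => (θ k).re) fun k _ => P.norm_expPt θ k

theorem hSum_expPt (c : (Fin n → ℤ) → ℝ) (θ : Fin d → ℂ) :
    P.hSum c (P.expPt θ).1 = Real.exp (4 * Real.pi * ∑ k, (P.lam k : ℝ) * (θ k).re) *
      P.expSum c (P.coords θ).1 := by
  simp only [hSum, P.norm_mono_expPt_sq, expSum, Finset.mul_sum]
  exact Finset.sum_congr rfl fun u _ => by ring

theorem moment_expPt {c : (Fin n → ℤ) → ℝ} (hc : P.IsEmbeddingWeight c) (θ : Fin d → ℂ) :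
    P.moment c (P.proj (P.expPt θ)) = P.dphi c (P.coords θ).1 := by
  funext i
  change P.momentCox c (P.expPt θ).1 i = _
  rw [P.dphi_apply hc, momentCox, P.hSum_expPt]
  simp only [P.norm_mono_expPt_sq]
  have hE := (Real.exp_pos (4 * Real.pi * ∑ k, (P.lam k : ℝ) * (θ k).re)).ne'
  generalize Real.exp (4 * Real.pi * ∑ k, (P.lam k : ℝ) * (θ k).re) = E at hE ⊢
  rw [← mul_div_mul_left _ (P.expSum c _) hE, Finset.mul_sum]
  congr 1
  exact Finset.sum_congr rfl fun u _ => by ring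

theorem exists_coords_eq (p : (Fin n → ℝ) × (Fin n → ℝ)) : ∃ θ, P.coords θ = p := by
  obtain ⟨a, ha⟩ := P.exists_sum_smul_eq p.1
  obtain ⟨b, hb⟩ := P.exists_sum_smul_eq (-p.2)
  refine ⟨fun k => ⟨a k, b k⟩, ?_⟩
  ext i
  · exact ha i
  · simp [coords, hb i]

/-! ### Interior points and limits of `dφ` -/

theorem ell_dphi_pos {c : (Fin n → ℤ) → ℝ} (hc : P.IsEmbeddingWeight c) (ξ : Fin n → ℝ)
    (k : Fin d) : 0 < P.ell k (P.dphi c ξ) := by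
  obtain ⟨θ, hθ⟩ := P.exists_coords_eq (ξ, 0)
  have h : P.dphi c ξ = P.momentCox c (P.expPt θ).1 := by
    rw [show ξ = (P.coords θ).1 by rw [hθ]]
    exact (P.moment_expPt hc θ).symm
  rw [h]
  refine lt_of_le_of_ne (P.ell_nonneg (P.momentCox_mem_body hc (P.expPt θ).2) k) fun h0 => ?_
  exact Complex.exp_ne_zero _ ((P.ell_momentCox_eq_zero_iff hc (P.expPt θ).2 k).1 h0.symm)

theorem dphi_mem_body {c : (Fin n → ℤ) → ℝ} (hc : P.IsEmbeddingWeight c) (ξ : Fin n → ℝ) :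
    P.dphi c ξ ∈ P.body := fun k => (P.ell_dphi_pos hc ξ k).le

/-- Facet `k` meets `B`, hence contains a vertex, where `v_k` belongs to a lattice basis. -/
theorem normal_ne_zero (k : Fin d) : P.v k ≠ 0 := by
  intro hv
  obtain ⟨x, hx, hk⟩ := P.facet k
  obtain ⟨x0, hx0, hF, -⟩ := P.exists_vertex_ge hx 0
  obtain ⟨w, -, hw, -⟩ := P.exists_dualBasis hx0
  have := hw k k (hF k hk) (hF k hk)
  simp [hv] at this

theorem mem_interior_iff {x : Fin n → ℝ} : x ∈ interior P.body ↔ ∀ k, 0 < P.ell k x := by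
  constructor
  · intro hx k
    refine lt_of_le_of_ne (P.ell_nonneg (interior_subset hx) k) fun h0 => ?_
    -- A small step along `-v_k` stays in `B` but makes `ℓ_k` negative.
    have hcont : Continuous fun t : ℝ => x + t • -toReal (P.v k) := by fun_prop
    have hev : ∀ᶠ t : ℝ in 𝓝[>] 0, x + t • -toReal (P.v k) ∈ P.body := by
      refine nhdsWithin_le_nhds (hcont.continuousAt.eventually ?_)
      simpa using mem_interior_iff_mem_nhds.1 hx
    obtain ⟨t, ht, htpos⟩ := (hev.and self_mem_nhdsWithin).exists
    have htpos : 0 < t := htpos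
    have h1 := P.ell_nonneg ht k
    rw [P.ell_add_smul, ← h0, pair_eq_dotProduct, dotProduct_neg] at h1
    have h2 : 0 < toReal (P.v k) ⬝ᵥ toReal (P.v k) := by
      refine lt_of_le_of_ne (Finset.sum_nonneg fun i _ => mul_self_nonneg _) fun h => ?_
      have h3 := dotProduct_self_eq_zero.1 h.symm
      exact P.normal_ne_zero k (toReal_injective (h3.trans (by funext i; simp [toReal])))
    nlinarith
  · intro h
    have ho : IsOpen {x | ∀ k, 0 < P.ell k x} := by
      have : {x | ∀ k, 0 < P.ell k x} = ⋂ k, P.ell k ⁻¹' Ioi 0 := by ext; simp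
      rw [this]
      exact isOpen_iInter_of_finite fun k => isOpen_Ioi.preimage (P.continuous_ell k)
    exact interior_maximal (fun y hy k => (hy k).le) ho h

open Classical in
theorem exists_dphi_eq {c : (Fin n → ℤ) → ℝ} (hc : P.IsEmbeddingWeight c)
    {x : Fin n → ℝ} (hx : x ∈ interior P.body) : ∃ ξ, P.dphi c ξ = x := by
  have hpos := P.mem_interior_iff.1 hx
  obtain ⟨ξ, hξ⟩ := P.exists_balanced hc (interior_subset hx) P.latticeFinset fun u => by
    rw [mem_latticeFinset]
    exact ⟨fun h => ⟨h, fun k hk => absurd hk (hpos k).ne'⟩, fun h => h.1⟩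
  refine ⟨ξ, funext fun i => ?_⟩
  have h1 := congrFun hξ i
  simp only [Finset.sum_apply, Pi.smul_apply, Pi.sub_apply, smul_eq_mul, mul_sub,
    Finset.sum_sub_distrib, Pi.zero_apply, ← Finset.sum_mul] at h1
  rw [P.dphi_apply hc, div_eq_iff (P.expSum_pos hc ξ).ne', expSum, mul_comm (x i)]
  simp only [toReal] at h1
  linarith

open Classical in
/-- Along a suitable straight ray `dφ` converges to a given point of the polytope. -/
theorem exists_ray {c : (Fin n → ℤ) → ℝ} (hc : P.IsEmbeddingWeight c)
    {x : Fin n → ℝ} (hx : x ∈ P.body) : ∃ r : NNReal → (Fin n → ℝ), Continuous r ∧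
      Tendsto (fun t => P.dphi c (r t)) atTop (𝓝 x) := by
  let S := P.latticeFinset.filter fun u => ∀ k, P.ell k x = 0 → P.ellZ k u = 0
  obtain ⟨ξ, hξ⟩ := P.exists_balanced hc hx S fun u => by
    simp [S, mem_latticeFinset]
  -- Along `-W` the term of `u` decays like `e^{-4πN(u)t}`, up to the common factor `e^{4πtΛ}`. As
  -- `N(u) ≥ 0` vanishes exactly on the face of `x`, only the balanced sum over that face survives
  -- in the limit.
  let W : Fin n → ℝ := ∑ k with P.ell k x = 0, toReal (P.v k)
  let N : (Fin n → ℤ) → ℤ := fun u => ∑ k with P.ell k x = 0, P.ellZ k u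
  let Λ : ℝ := ∑ k with P.ell k x = 0, (P.lam k : ℝ)
  have hW : ∀ u, pair u W = N u - Λ := by
    intro u
    simp only [W, N, Λ, pair_eq_dotProduct, dotProduct_sum, Int.cast_sum,
      ← Finset.sum_sub_distrib]
    refine Finset.sum_congr rfl fun k _ => ?_
    rw [← ell_toReal, ell_eq, dotProduct_comm]; ring
  have hN : ∀ u ∈ P.latticeFinset,
      0 ≤ N u ∧ (N u = 0 ↔ ∀ k, P.ell k x = 0 → P.ellZ k u = 0) := by
    intro u hu
    have h1 := P.ellZ_nonneg (P.mem_latticeFinset.1 hu)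
    refine ⟨Finset.sum_nonneg fun k _ => h1 k, ?_⟩
    rw [Finset.sum_eq_zero_iff_of_nonneg fun k _ => h1 k]
    simp
  let a : (Fin n → ℤ) → ℝ := fun u => c u * Real.exp (4 * Real.pi * pair u ξ)
  let E : (Fin n → ℤ) → NNReal → ℝ := fun u t => Real.exp (-(4 * Real.pi * N u * t))
  let δ : (Fin n → ℤ) → ℝ := fun u => if ∀ k, P.ell k x = 0 → P.ellZ k u = 0 then 1 else 0
  have hE : ∀ u ∈ P.latticeFinset, Tendsto (E u) atTop (𝓝 (δ u)) := by
    intro u hu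
    by_cases h0 : N u = 0
    · have : δ u = 1 := if_pos ((hN u hu).2.1 h0)
      simp [this, E, h0]
    · have : δ u = 0 := if_neg fun h => h0 ((hN u hu).2.2 h)
      rw [this]
      have hpos : (0 : ℝ) < N u := by
        exact_mod_cast lt_of_le_of_ne (hN u hu).1 (Ne.symm h0)
      refine Real.tendsto_exp_neg_atTop_nhds_zero.comp ?_
      exact (NNReal.tendsto_coe_atTop.2 tendsto_id).const_mul_atTop (by positivity)
  have hsum : ∀ b : (Fin n → ℤ) → ℝ,
      Tendsto (fun t => ∑ u ∈ P.latticeFinset, a u * E u t * b u) atTop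
        (𝓝 (∑ u ∈ P.latticeFinset, a u * δ u * b u)) := fun b =>
    tendsto_finsetSum _ fun u hu => ((hE u hu).const_mul _).mul_const _
  have hδ : ∀ b : (Fin n → ℤ) → ℝ,
      ∑ u ∈ P.latticeFinset, a u * δ u * b u = ∑ u ∈ S, a u * b u := by
    intro b
    rw [Finset.sum_filter]
    refine Finset.sum_congr rfl fun u _ => ?_
    simp only [δ]
    split_ifs <;> simp
  have hSpos : 0 < ∑ u ∈ S, a u * 1 := by
    obtain ⟨u, hu, hcu, hF, -⟩ := P.exists_weight_pos_ge hc hx 0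
    refine Finset.sum_pos' (fun u hu => ?_) ⟨u, ?_, ?_⟩
    · have := hc.1 u (P.mem_latticeFinset.1 (Finset.mem_filter.1 hu).1)
      simp only [a]; positivity
    · simp [S, mem_latticeFinset, hu]; exact hF
    · simp only [a]; positivity
  refine ⟨fun t => ξ - (t : ℝ) • W, by fun_prop, tendsto_pi_nhds.2 fun i => ?_⟩
  have hlim := (hsum fun u => u i).div (hsum fun _ => 1) (by rw [hδ]; exact hSpos.ne')
  have hx' : (∑ u ∈ P.latticeFinset, a u * δ u * u i) /
      (∑ u ∈ P.latticeFinset, a u * δ u * 1) = x i := by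
    rw [hδ fun u => u i, hδ, div_eq_iff hSpos.ne']
    have h1 := congrFun hξ i
    simp only [Finset.sum_apply, Pi.smul_apply, Pi.sub_apply, smul_eq_mul, mul_sub,
      Finset.sum_sub_distrib, Pi.zero_apply, ← Finset.sum_mul, toReal] at h1
    simp only [mul_one, a]
    linarith
  rw [hx'] at hlim
  refine hlim.congr fun t => ?_
  rw [P.dphi_apply hc]
  have key : ∀ u, c u * Real.exp (4 * Real.pi * pair u (ξ - (t : ℝ) • W)) =
      Real.exp (4 * Real.pi * (t * Λ)) * (a u * E u t) := by
    intro u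
    have : pair u (ξ - (t : ℝ) • W) = pair u ξ - t * (N u - Λ) := by
      rw [sub_eq_add_neg, ← neg_smul, pair_add, pair_smul, hW]; ring
    simp only [this, a, E]
    rw [mul_assoc (c u), mul_left_comm (Real.exp _), ← Real.exp_add, ← Real.exp_add]
    congr 2; ring
  simp only [expSum, key, mul_assoc (Real.exp (4 * Real.pi * (t * Λ))), ← Finset.mul_sum, mul_one]
  exact (mul_div_mul_left _ _ (Real.exp_pos _).ne').symm

end DelzantPolytope
end ToricSYZ

/-! ### Curvature of the SYZ connection -/

namespace ToricSYZ

/-- The SYZ transform of the graph of an exact form is prequantum. -/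
theorem prequantum_of_contDiff {n : ℕ} {g : (Fin n → ℝ) → ℝ} (hg : ContDiff ℝ 2 g)
    (p a b : (Fin n → ℝ) × (Fin n → ℝ)) :
    Complex.I / (2 * Real.pi) * syzCurvature g p a b = (kahlerForm g p a b : ℝ) := by
  have h1 : Differentiable ℝ (fderiv ℝ g) :=
    (hg.fderiv_right (m := 1) (by norm_num)).differentiable (by simp)
  have key : ∀ (e : Fin n → ℝ) (a : (Fin n → ℝ) × (Fin n → ℝ)),
      fderiv ℝ (fun q : (Fin n → ℝ) × (Fin n → ℝ) =>
        2 * Real.pi * Complex.I * ((fderiv ℝ g q.1 e : ℝ) : ℂ)) p a =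
      2 * Real.pi * Complex.I * ((fderiv ℝ (fderiv ℝ g) p.1 a.1 e : ℝ) : ℂ) := by
    intro e a
    have h2 : HasFDerivAt (fun q : (Fin n → ℝ) × (Fin n → ℝ) => fderiv ℝ g q.1)
        ((fderiv ℝ (fderiv ℝ g) p.1).comp (ContinuousLinearMap.fst ℝ _ _)) p :=
      (h1 p.1).hasFDerivAt.comp p hasFDerivAt_fst
    have h3 := (Complex.ofRealCLM.hasFDerivAt.comp p
      (h2.clm_apply (hasFDerivAt_const e p))).const_mul (2 * Real.pi * Complex.I)
    have h4 : HasFDerivAt (fun q : (Fin n → ℝ) × (Fin n → ℝ) =>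
        2 * Real.pi * Complex.I * ((fderiv ℝ g q.1 e : ℝ) : ℂ)) _ p := h3
    rw [h4.fderiv]
    simp
  -- Differentiating the connection form gives the Hessian with its arguments in the other order;
  -- its symmetry and `i/(2π) · 2πi = -1` turn this into the Kähler form.
  have hsymm : ∀ x y, fderiv ℝ (fderiv ℝ g) p.1 x y = fderiv ℝ (fderiv ℝ g) p.1 y x := by
    intro x y
    exact (hg.contDiffAt.isSymmSndFDerivAt (by simp)) x y
  rw [syzCurvature, key, key, kahlerForm, hsymm a.2, hsymm b.2]
  have hpi : (Real.pi : ℂ) ≠ 0 := by exact_mod_cast Real.pi_ne_zero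
  field_simp
  push_cast
  linear_combination ((fderiv ℝ (fderiv ℝ g) p.1 a.1 b.2 : ℂ) -
    (fderiv ℝ (fderiv ℝ g) p.1 b.1 a.2 : ℂ)) * Complex.I_sq

namespace DelzantPolytope

variable {n d : ℕ} (P : DelzantPolytope n d)

/-! ### Derivatives of the monomials and of `log H` -/

/-- For `u ∈ B` the exponents are nonnegative, so the monomial is a polynomial, regular also where
coordinates vanish. -/
theorem mono_eq_prod_pow {u : Fin n → ℤ} (hu : u ∈ P.latticePts) (z : Fin d → ℂ) :
    P.mono u z = ∏ k, z k ^ (P.ellZ k u).toNat := by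
  refine Finset.prod_congr rfl fun k _ => ?_
  conv_lhs => rw [← Int.toNat_of_nonneg (P.ellZ_nonneg hu k), zpow_natCast]

theorem differentiable_mono {u : Fin n → ℤ} (hu : u ∈ P.latticePts) :
    Differentiable ℂ (P.mono u) := by
  rw [funext (P.mono_eq_prod_pow hu)]
  fun_prop

theorem contDiff_mono {u : Fin n → ℤ} (hu : u ∈ P.latticePts) {m : WithTop ℕ∞} :
    ContDiff ℝ m (P.mono u) := by
  rw [funext (P.mono_eq_prod_pow hu)]
  fun_prop

/-- The logarithmic derivative of a monomial. -/
theorem hasDerivAt_mono {𝕜 : Type*} [NontriviallyNormedField 𝕜] [NormedAlgebra 𝕜 ℂ]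
    {u : Fin n → ℤ} {γ : 𝕜 → Fin d → ℂ} {γ' : Fin d → ℂ} {t : 𝕜}
    (hγ : ∀ k, P.ellZ k u ≠ 0 → HasDerivAt (fun t => γ t k) (γ' k) t) (h0 : P.mono u (γ t) ≠ 0) :
    HasDerivAt (fun t => P.mono u (γ t))
      (P.mono u (γ t) * ∑ k, (P.ellZ k u : ℂ) * (γ' k / γ t k)) t := by
  have hfac : ∀ k, HasDerivAt (fun t => γ t k ^ P.ellZ k u)
      (γ t k ^ P.ellZ k u * ((P.ellZ k u : ℂ) * (γ' k / γ t k))) t := by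
    intro k
    by_cases hk : P.ellZ k u = 0
    · simpa [hk] using hasDerivAt_const t (1 : ℂ)
    have hz : γ t k ≠ 0 := fun h => h0 (P.mono_eq_zero h hk)
    have h1 := (hasDerivAt_zpow (P.ellZ k u) (γ t k) (Or.inl hz)).comp_of_eq t (hγ k hk) rfl
    refine h1.congr_deriv ?_
    rw [zpow_sub_one₀ hz]; ring
  have := HasDerivAt.fun_finsetProd (u := Finset.univ) fun k _ => hfac k
  refine this.congr_deriv ?_
  rw [Finset.mul_sum]
  refine Finset.sum_congr rfl fun k _ => ?_
  rw [smul_eq_mul, ← mul_assoc, Finset.prod_erase_mul _ _ (Finset.mem_univ k)]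
  rfl

theorem fderiv_mono_apply {u : Fin n → ℤ} (hu : u ∈ P.latticePts) {z : Fin d → ℂ}
    (h0 : P.mono u z ≠ 0) (η : Fin d → ℂ) :
    fderiv ℝ (P.mono u) z η = P.mono u z * ∑ k, (P.ellZ k u : ℂ) * (η k / z k) := by
  have hline : HasDerivAt (fun t : ℝ => z + t • η) η 0 := by
    simpa using ((hasDerivAt_id (0 : ℝ)).smul_const η).const_add z
  have h1 : HasFDerivAt (P.mono u) (fderiv ℝ (P.mono u) z) (z + (0 : ℝ) • η) := by
    simpa using ((P.contDiff_mono hu (m := 1)).differentiable (by simp) z).hasFDerivAt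
  have h2 := h1.comp_hasDerivAt (0 : ℝ) hline
  have h3 := P.hasDerivAt_mono (u := u) (γ := fun t : ℝ => z + t • η) (γ' := η) (t := 0)
    (fun k _ => hasDerivAt_pi.1 hline k) (by simpa using h0)
  simpa using h2.unique h3

theorem contDiff_hSum (c : (Fin n → ℤ) → ℝ) {m : WithTop ℕ∞} : ContDiff ℝ m (P.hSum c) :=
  ContDiff.sum fun _ hu => contDiff_const.mul
    ((P.contDiff_mono (P.mem_latticeFinset.1 hu)).norm_sq ℝ)

/-- Each `|s_u|²` has logarithmic derivative `2 Re ∑ ℓ_k(u) η_k / z_k`; averaging the `ℓ_k(u)` gives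
`ℓ_k` of the moment. Where `z_k = 0` the quotient has the default value `0`, which is harmless: a
nonvanishing monomial then has `ℓ_k(u) = 0`. -/
theorem fderiv_hSum_apply {c : (Fin n → ℤ) → ℝ} {z : Fin d → ℂ} (hz : P.hSum c z ≠ 0)
    (η : Fin d → ℂ) : fderiv ℝ (P.hSum c) z η =
      P.hSum c z * (2 * (∑ k, (P.ell k (P.momentCox c z) : ℂ) * (η k / z k)).re) := by
  have h1 : HasFDerivAt (P.hSum c) (∑ u ∈ P.latticeFinset, c u • (2 •
      (innerSL ℝ (P.mono u z)).comp (fderiv ℝ (P.mono u) z))) z := by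
    refine HasFDerivAt.fun_sum fun u hu => ?_
    exact ((((P.contDiff_mono (P.mem_latticeFinset.1 hu) (m := 1)).differentiable
      (by simp) z).hasFDerivAt).norm_sq).const_mul (c u)
  have h2 : ∀ u ∈ P.latticeFinset, c u * (2 * (inner ℝ (P.mono u z)
      (fderiv ℝ (P.mono u) z η))) = 2 * ∑ k, c u * ‖P.mono u z‖ ^ 2 * (P.ellZ k u) *
        (η k / z k).re := by
    intro u hu
    by_cases h0 : P.mono u z = 0
    · simp [h0]
    rw [P.fderiv_mono_apply (P.mem_latticeFinset.1 hu) h0, Complex.inner, mul_right_comm,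
      Complex.mul_conj, Complex.re_ofReal_mul, Complex.normSq_eq_norm_sq,
      Complex.re_sum, Finset.mul_sum, Finset.mul_sum, Finset.mul_sum, Finset.mul_sum]
    refine Finset.sum_congr rfl fun k _ => ?_
    rw [← Complex.ofReal_intCast, Complex.re_ofReal_mul]
    ring
  rw [h1.fderiv]
  simp only [sum_apply, smul_apply, ContinuousLinearMap.comp_apply, innerSL_apply_apply,
    smul_eq_mul, nsmul_eq_mul, Nat.cast_ofNat]
  rw [Finset.sum_congr rfl h2, ← Finset.mul_sum, Finset.sum_comm, mul_left_comm, Complex.re_sum]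
  rw [Finset.mul_sum (a := P.hSum c z)]
  congr 1
  refine Finset.sum_congr rfl fun k _ => ?_
  rw [Complex.re_ofReal_mul, P.ell_momentCox hz, ← mul_assoc, mul_div_cancel₀ _ hz, Finset.sum_mul]

theorem fderiv_log_hSum_apply {c : (Fin n → ℤ) → ℝ} (hc : P.IsEmbeddingWeight c)
    {z : Fin d → ℂ} (hz : z ∈ P.coxSet) (η : Fin d → ℂ) :
    fderiv ℝ (fun w => Real.log (P.hSum c w)) z η =
      2 * (∑ k, (P.ell k (P.momentCox c z) : ℂ) * (η k / z k)).re := by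
  have hH := (P.hSum_pos hc hz).ne'
  rw [fderiv.log ((P.contDiff_hSum c (m := 1)).differentiable (by simp) z) hH, smul_apply,
    P.fderiv_hSum_apply hH, smul_eq_mul, inv_mul_cancel_left₀ hH]

/-- The form `∂ log H` in terms of the moment map. -/
theorem delLogH_eq {c : (Fin n → ℤ) → ℝ} (hc : P.IsEmbeddingWeight c)
    {z : Fin d → ℂ} (hz : z ∈ P.coxSet) (η : Fin d → ℂ) :
    P.delLogH c z η = ∑ k, (P.ell k (P.momentCox c z) : ℂ) * (η k / z k) := by
  have h1 : ∑ k, (P.ell k (P.momentCox c z) : ℂ) * ((Complex.I • η) k / z k) =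
      Complex.I * ∑ k, (P.ell k (P.momentCox c z) : ℂ) * (η k / z k) := by
    rw [Finset.mul_sum]
    refine Finset.sum_congr rfl fun k _ => ?_
    rw [Pi.smul_apply, smul_eq_mul]; ring
  rw [delLogH, P.fderiv_log_hSum_apply hc hz, P.fderiv_log_hSum_apply hc hz, h1]
  generalize ∑ k, (P.ell k (P.momentCox c z) : ℂ) * (η k / z k) = L
  -- With `L` complex linear in `η`, the `(1,0)` part of `2 Re L` is `(2 Re L - i · 2 Re(iL)) / 2 =
  -- L`.
  apply Complex.ext <;> simp

/-! ### The connection over the dense torus -/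

/-- A linear section of the coordinates on the dense torus, with integral coefficients. -/
theorem exists_coords_section : ∃ w : Fin d → Fin n → ℤ,
    (∀ i i', ∑ k, w k i * P.v k i' = if i = i' then 1 else 0) ∧
    ∀ p : (Fin n → ℝ) × (Fin n → ℝ),
      P.coords (fun k => ∑ i, (w k i : ℂ) * (p.1 i - Complex.I * p.2 i)) = p := by
  obtain ⟨w, hw⟩ := P.exists_generators
  refine ⟨w, hw, fun p => ?_⟩
  have h : ∀ i' i, ∑ k, (w k i' : ℝ) * P.v k i = if i' = i then 1 else 0 := by
    intro i' i; exact_mod_cast hw i' i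
  have hre : ∀ k, (∑ i, (w k i : ℂ) * (p.1 i - Complex.I * p.2 i)).re =
      ∑ i, (w k i : ℝ) * p.1 i := by
    intro k; simp [Complex.re_sum]
  have him : ∀ k, (∑ i, (w k i : ℂ) * (p.1 i - Complex.I * p.2 i)).im =
      -∑ i, (w k i : ℝ) * p.2 i := by
    intro k; simp [Complex.im_sum]
  have key : ∀ (q : Fin n → ℝ) (i : Fin n),
      ∑ k, (P.v k i : ℝ) * ∑ i', (w k i' : ℝ) * q i' = q i := by
    intro q i
    simp only [Finset.mul_sum]
    rw [Finset.sum_comm]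
    calc ∑ i', ∑ k, (P.v k i : ℝ) * (w k i' * q i')
        = ∑ i', (∑ k, (w k i' : ℝ) * P.v k i) * q i' := by
          refine Finset.sum_congr rfl fun i' _ => ?_
          rw [Finset.sum_mul]
          exact Finset.sum_congr rfl fun k _ => by ring
      _ = q i := by simp [h]
  ext i
  · simp only [coords, hre, key]
  · simp only [coords, him, mul_neg, Finset.sum_neg_distrib, neg_neg, key]

theorem coords_add_smul (θ η : Fin d → ℂ) (t : ℝ) :
    P.coords (θ + t • η) = P.coords θ + t • P.coords η := by
  ext i
  · simp only [coords, Pi.add_apply, Pi.smul_apply, Complex.add_re, Complex.real_smul,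
      Complex.re_ofReal_mul, Prod.fst_add, Prod.smul_fst, smul_eq_mul, Finset.mul_sum,
      ← Finset.sum_add_distrib]
    exact Finset.sum_congr rfl fun k _ => by ring
  · simp only [coords, Pi.add_apply, Pi.smul_apply, Complex.add_im, Complex.real_smul,
      Complex.im_ofReal_mul, Prod.snd_add, Prod.smul_snd, smul_eq_mul, mul_neg, Finset.mul_sum,
      ← neg_add, ← Finset.sum_add_distrib]
    congr 1
    exact Finset.sum_congr rfl fun k _ => by ring

theorem frame_ne_zero (c : (Fin n → ℤ) → ℝ) (θ : Fin d → ℂ) : P.frame c θ ≠ 0 :=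
  mul_ne_zero (by exact_mod_cast (Real.exp_pos _).ne') (Complex.exp_ne_zero _)

theorem hasDerivAt_expPt (θ η : Fin d → ℂ) :
    HasDerivAt (fun t : ℝ => (P.expPt (θ + t • η)).1)
      (fun k => 2 * Real.pi * η k * Complex.exp (2 * Real.pi * θ k)) 0 := by
  refine hasDerivAt_pi.2 fun k => ?_
  have h1 : HasDerivAt (fun t : ℝ => 2 * Real.pi * (θ k + t * η k)) (2 * Real.pi * (1 * η k)) 0 :=
    (((Complex.ofRealCLM.hasDerivAt (x := (0 : ℝ))).mul_const (η k)).const_add (θ k)).const_mul _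
  have h2 := h1.cexp
  refine (h2.congr_deriv ?_)
  simp; ring

theorem extend_apply (s : P.coxSet → ℂ) (z : P.coxSet) : P.extend s z.1 = s z := by
  simp [extend]

/-- The frame contributes `2π(dφ(a_ξ) + ⟨λ,η⟩)`, and `∂ log H` is `2π(dφ(a_ξ) - i dφ(a_y̌) +
⟨λ,η⟩)`. The difference `2πi dφ(a_y̌)` is the SYZ connection form. -/
theorem nabla_expPt {c : (Fin n → ℤ) → ℝ} (hc : P.IsEmbeddingWeight c) {s : P.coxSet → ℂ}
    (hs : P.IsSmooth s) {σ : (Fin n → ℝ) × (Fin n → ℝ) → ℂ} (hσ : P.RestrictsTo c s σ)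
    (θ η : Fin d → ℂ) :
    P.nabla c s (P.expPt θ) (fun k => 2 * Real.pi * η k * Complex.exp (2 * Real.pi * θ k)) =
      syzNabla (P.phi c) σ (P.coords θ) (P.coords η) * P.frame c θ := by
  have hφ := P.differentiable_phi hc
  -- No regularity of `σ` is assumed. It follows from that of `s`: a linear section `R` of the
  -- coordinates expresses `σ` as `s` divided by the nonvanishing frame.
  have hσd : Differentiable ℝ σ := by
    obtain ⟨w, -, hw⟩ := P.exists_coords_section
    let R : (Fin n → ℝ) × (Fin n → ℝ) → Fin d → ℂ :=
      fun p k => ∑ i, (w k i : ℂ) * (p.1 i - Complex.I * p.2 i)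
    have hof : Differentiable ℝ (fun x : ℝ => (x : ℂ)) := Complex.ofRealCLM.differentiable
    have hRd : Differentiable ℝ R := by
      refine differentiable_pi.2 fun k => Differentiable.fun_sum fun i _ => ?_
      refine (Differentiable.sub (hof.comp ?_)
        ((hof.comp ?_).const_mul _)).const_mul _
      · fun_prop
      · fun_prop
    have hexp : Differentiable ℝ fun p => (P.expPt (R p)).1 := by
      refine differentiable_pi.2 fun k => ?_
      exact ((differentiable_pi.1 hRd k).const_mul _).cexp
    have hfr : Differentiable ℝ fun p => P.frame c (R p) := by
      unfold frame
      simp only [R, hw]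
      refine Differentiable.mul (hof.comp
        (((hφ.comp differentiable_fst).const_mul _).exp)) ?_
      refine (Differentiable.const_mul ?_ _).cexp
      exact Differentiable.fun_sum fun k _ => (differentiable_pi.1 hRd k).const_mul _
    have heq : σ = fun p => P.extend s (P.expPt (R p)).1 * (P.frame c (R p))⁻¹ := by
      funext p
      rw [extend_apply, hσ (R p), hw p, mul_inv_cancel_right₀ (P.frame_ne_zero c _)]
    rw [heq]
    intro p
    refine DifferentiableAt.mul ?_ ((hfr p).inv (P.frame_ne_zero c _))
    exact (P.extend_differentiableAt hs (P.expPt (R p))).comp p (hexp p)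
  have hline : HasDerivAt (fun t : ℝ => P.coords θ + t • P.coords η) (P.coords η) 0 := by
    simpa using ((hasDerivAt_id (0 : ℝ)).smul_const (P.coords η)).const_add (P.coords θ)
  have hL : HasDerivAt (fun t : ℝ => s (P.expPt (θ + t • η)))
      (fderiv ℝ (P.extend s) (P.expPt θ).1
        (fun k => 2 * Real.pi * η k * Complex.exp (2 * Real.pi * θ k))) 0 := by
    have h1 : HasFDerivAt (P.extend s) (fderiv ℝ (P.extend s) (P.expPt θ).1)
        (P.expPt (θ + (0 : ℝ) • η)).1 := by
      simpa using (P.extend_differentiableAt hs (P.expPt θ)).hasFDerivAt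
    have h2 := h1.comp_hasDerivAt (0 : ℝ) (P.hasDerivAt_expPt θ η)
    simpa only [Function.comp_def, extend_apply] using h2
  have hS : HasDerivAt (fun t : ℝ => σ (P.coords θ + t • P.coords η))
      (fderiv ℝ σ (P.coords θ) (P.coords η)) 0 := by
    have h1 : HasFDerivAt σ (fderiv ℝ σ (P.coords θ)) (P.coords θ + (0 : ℝ) • P.coords η) := by
      simpa using (hσd (P.coords θ)).hasFDerivAt
    exact h1.comp_hasDerivAt 0 hline
  have hF : HasDerivAt (fun t : ℝ => P.frame c (θ + t • η))
      (P.frame c θ * (2 * Real.pi * (fderiv ℝ (P.phi c) (P.coords θ).1 (P.coords η).1 : ℝ) +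
        2 * Real.pi * ∑ k, (P.lam k : ℂ) * η k)) 0 := by
    have h1 : HasDerivAt (fun t : ℝ => P.phi c (P.coords θ + t • P.coords η).1)
        (fderiv ℝ (P.phi c) (P.coords θ).1 (P.coords η).1) 0 := by
      have h2 : HasFDerivAt (P.phi c) (fderiv ℝ (P.phi c) (P.coords θ).1)
          (P.coords θ + (0 : ℝ) • P.coords η).1 := by
        simpa using (hφ (P.coords θ).1).hasFDerivAt
      exact h2.comp_hasDerivAt 0 ((hasFDerivAt_fst).comp_hasDerivAt (0 : ℝ) hline)
    have h3 := ((h1.const_mul (2 * Real.pi)).exp).ofReal_comp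
    have h4 : HasDerivAt (fun t : ℝ => Complex.exp (2 * Real.pi *
        ∑ k, (P.lam k : ℂ) * (θ k + t * η k)))
        (Complex.exp (2 * Real.pi * ∑ k, (P.lam k : ℂ) * (θ k + (0 : ℝ) * η k)) *
          (2 * Real.pi * ∑ k, (P.lam k : ℂ) * (1 * η k))) 0 := by
      refine (HasDerivAt.const_mul _ (HasDerivAt.fun_sum fun k _ => ?_)).cexp
      exact (((Complex.ofRealCLM.hasDerivAt (x := (0 : ℝ))).mul_const (η k)).const_add
        (θ k)).const_mul _
    have h5 := h3.mul h4
    simp only [← coords_add_smul] at h5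
    refine HasDerivAt.congr_deriv (h5 : HasDerivAt (fun t : ℝ => P.frame c (θ + t • η)) _ 0) ?_
    simp only [frame, zero_smul, add_zero, Complex.ofReal_zero, zero_mul, one_mul]
    push_cast
    ring
  have hR := hS.mul hF
  have heq : (fun t : ℝ => s (P.expPt (θ + t • η))) =
      fun t : ℝ => σ (P.coords θ + t • P.coords η) * P.frame c (θ + t • η) := by
    funext t
    rw [hσ, coords_add_smul]
  rw [heq] at hL
  have h6 := hL.unique hR
  have hmom : P.momentCox c (P.expPt θ).1 = P.dphi c (P.coords θ).1 := P.moment_expPt hc θ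
  have hdel : P.delLogH c (P.expPt θ).1
      (fun k => 2 * Real.pi * η k * Complex.exp (2 * Real.pi * θ k)) =
      2 * Real.pi * ((fderiv ℝ (P.phi c) (P.coords θ).1 (P.coords η).1 : ℝ) -
        Complex.I * (fderiv ℝ (P.phi c) (P.coords θ).1 (P.coords η).2 : ℝ) +
        ∑ k, (P.lam k : ℂ) * η k) := by
    rw [P.delLogH_eq hc (P.expPt θ).2, hmom]
    set x := P.dphi c (P.coords θ).1 with hx
    have h7 : ∀ k, (P.ell k x : ℂ) * (2 * Real.pi * η k * Complex.exp (2 * Real.pi * θ k) /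
        (P.expPt θ).1 k) = 2 * Real.pi * ((P.ell k x : ℂ) * η k) := by
      intro k
      have : (P.expPt θ).1 k = Complex.exp (2 * Real.pi * θ k) := rfl
      rw [this, mul_div_cancel_right₀ _ (Complex.exp_ne_zero _)]; ring
    simp only [h7, ← Finset.mul_sum]
    congr 1
    rw [P.fderiv_phi_eq_sum, P.fderiv_phi_eq_sum, ← hx]
    -- The logarithmic torus coordinates satisfy `∑ v_k η_k = a_ξ - i a_y̌`, which fixes the sign of
    -- the imaginary term.
    have h8 : ∀ i, ((P.coords η).1 i : ℂ) - Complex.I * (P.coords η).2 i =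
        ∑ k, (P.v k i : ℂ) * η k := by
      intro i
      have h9 : ∀ k, (P.v k i : ℂ) * η k = (P.v k i : ℂ) * (η k).re +
          Complex.I * ((P.v k i : ℂ) * (η k).im) := by
        intro k
        conv_lhs => rw [← Complex.re_add_im (η k)]
        ring
      simp only [coords, h9, Finset.sum_add_distrib, ← Finset.mul_sum]
      push_cast
      ring
    simp only [ell, pair, Complex.ofReal_add, Complex.ofReal_sum, Complex.ofReal_mul,
      Complex.ofReal_intCast, add_mul, Finset.sum_add_distrib, Finset.mul_sum]
    congr 1
    rw [← Finset.sum_sub_distrib]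
    simp only [Finset.sum_mul]
    rw [Finset.sum_comm]
    refine Finset.sum_congr rfl fun i _ => ?_
    have h10 := congrArg (fun y => (x i : ℂ) * y) (h8 i)
    simp only [Finset.mul_sum] at h10
    rw [show (x i : ℂ) * (P.coords η).1 i - Complex.I * (x i * (P.coords η).2 i) =
      x i * ((P.coords η).1 i - Complex.I * (P.coords η).2 i) by ring, h10]
    exact Finset.sum_congr rfl fun k _ => by ring
  simp only [zero_smul, add_zero] at h6
  rw [nabla, h6, hdel, hσ θ, syzNabla]
  ring

theorem fibre_nonempty {c : (Fin n → ℤ) → ℝ} (hc : P.IsEmbeddingWeight c) {x : Fin n → ℝ}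
    (hx : x ∈ P.body) : ∃ z : P.coxSet, P.momentCox c z.1 = x := by
  obtain ⟨z, hz, h⟩ := P.exists_momentCox_eq hc hx
  exact ⟨⟨z, hz⟩, h⟩

/-! ### The parallel sections over the Bohr-Sommerfeld fibres -/

theorem fibreSection_of_mem {c : (Fin n → ℤ) → ℝ} {u : Fin n → ℤ} {z : P.coxSet}
    (h : P.momentCox c z.1 = toReal u) : P.fibreSection c u z =
      P.mono u z.1 / (‖P.mono u z.1‖ : ℂ) * (Real.sqrt (P.hSum c z.1) : ℂ) := if_pos h

theorem fibreSection_of_notMem {c : (Fin n → ℤ) → ℝ} {u : Fin n → ℤ} {z : P.coxSet}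
    (h : P.momentCox c z.1 ≠ toReal u) : P.fibreSection c u z = 0 := if_neg h

theorem mono_ne_zero_of_moment {c : (Fin n → ℤ) → ℝ} (hc : P.IsEmbeddingWeight c)
    {u : Fin n → ℤ} {z : Fin d → ℂ} (hz : z ∈ P.coxSet) (h : P.momentCox c z = toReal u) :
    P.mono u z ≠ 0 := by
  refine P.mono_ne_zero fun k hk => ?_
  have := (P.ell_momentCox_eq_zero_iff hc hz k).2 hk
  rw [h, ell_toReal] at this
  exact_mod_cast this

theorem fibreSection_ne_zero {c : (Fin n → ℤ) → ℝ} (hc : P.IsEmbeddingWeight c)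
    {u : Fin n → ℤ} {z : P.coxSet} (h : P.momentCox c z.1 = toReal u) :
    P.fibreSection c u z ≠ 0 := by
  rw [P.fibreSection_of_mem h]
  have h1 := P.mono_ne_zero_of_moment hc z.2 h
  have h2 : ((‖P.mono u z.1‖ : ℝ) : ℂ) ≠ 0 := Complex.ofReal_ne_zero.2 (norm_ne_zero_iff.2 h1)
  have h3 : ((Real.sqrt (P.hSum c z.1) : ℝ) : ℂ) ≠ 0 :=
    Complex.ofReal_ne_zero.2 (Real.sqrt_pos.2 (P.hSum_pos hc z.2)).ne'
  exact mul_ne_zero (div_ne_zero h1 h2) h3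

theorem hSum_smul (c : (Fin n → ℤ) → ℝ) {t : Fin d → ℂˣ} (ht : t ∈ P.coxGroup)
    {z w : Fin d → ℂ} (h : ∀ k, w k = (t k : ℂ) * z k) :
    P.hSum c w = ‖P.chi t‖ ^ 2 * P.hSum c z := by
  simp only [hSum, P.mono_smul ht _ h, norm_mul, mul_pow, Finset.mul_sum]
  exact Finset.sum_congr rfl fun u _ => by ring

theorem fibreSection_mem_sections (c : (Fin n → ℤ) → ℝ) (u : Fin n → ℤ) :
    P.fibreSection c u ∈ P.Sections := by
  intro t ht z w h
  have hm := P.momentCox_smul c ht h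
  by_cases hz : P.momentCox c z.1 = toReal u
  · have h0 : ((‖P.chi t‖ : ℝ) : ℂ) ≠ 0 :=
      Complex.ofReal_ne_zero.2 (norm_ne_zero_iff.2 (P.chi_ne_zero t))
    rw [P.fibreSection_of_mem hz, P.fibreSection_of_mem (hm.trans hz), P.mono_smul ht u h,
      P.hSum_smul c ht h, Real.sqrt_mul (sq_nonneg _), Real.sqrt_sq (norm_nonneg _), norm_mul]
    push_cast
    field_simp
  · rw [P.fibreSection_of_notMem hz, P.fibreSection_of_notMem (hm ▸ hz), mul_zero]

/-- Over the fibre of `u` the form `∂ log H` is `d log s_u`, so `s_u` is parallel, and `√H / |s_u|`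
is constant along curves in the fibre. Over other fibres the section is zero. -/
theorem fibreSection_isParallelOn {c : (Fin n → ℤ) → ℝ} (hc : P.IsEmbeddingWeight c)
    (u : Fin n → ℤ) (x : Fin n → ℝ) : P.IsParallelOn c (P.fibre c x) (P.fibreSection c u) := by
  intro γ hγ hx t
  have hx : ∀ t, P.momentCox c (γ t).1 = x := hx
  by_cases hxu : x = toReal u
  · subst hxu
    set γ' := deriv (fun t => (γ t).1) t
    have hd : HasDerivAt (fun t => (γ t).1) γ' t := (hγ.differentiable (by simp) t).hasDerivAt
    set A : ℂ := ∑ k, (P.ellZ k u : ℂ) * (γ' k / (γ t).1 k)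
    have hdel : P.delLogH c (γ t).1 γ' = A := by
      rw [P.delLogH_eq hc (γ t).2, hx t]
      simp only [ell_toReal, Complex.ofReal_intCast, A]
    have hm0 : ∀ t, P.mono u (γ t).1 ≠ 0 := fun t => P.mono_ne_zero_of_moment hc (γ t).2 (hx t)
    have hf := P.hasDerivAt_mono (γ := fun t => (γ t).1) (t := t)
      (fun k _ => hasDerivAt_pi.1 hd k) (hm0 t)
    have hg0 : ‖P.mono u (γ t).1‖ ^ 2 ≠ 0 := pow_ne_zero _ (norm_ne_zero_iff.2 (hm0 t))
    have hg : HasDerivAt (fun t => ‖P.mono u (γ t).1‖ ^ 2)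
        (‖P.mono u (γ t).1‖ ^ 2 * (2 * A.re)) t := by
      refine hf.norm_sq.congr_deriv ?_
      rw [Complex.inner, mul_right_comm, Complex.mul_conj, Complex.re_ofReal_mul,
        Complex.normSq_eq_norm_sq]
      ring
    have hH0 : P.hSum c (γ t).1 ≠ 0 := (P.hSum_pos hc (γ t).2).ne'
    have hH : HasDerivAt (fun t => P.hSum c (γ t).1) (P.hSum c (γ t).1 * (2 * A.re)) t := by
      have h1 := ((P.contDiff_hSum c (m := 1)).differentiable (by simp) (γ t).1).hasFDerivAt
      refine (h1.comp_hasDerivAt t hd).congr_deriv ?_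
      rw [P.fderiv_hSum_apply hH0, hx t]
      simp only [ell_toReal, Complex.ofReal_intCast, A]
    have hr : HasDerivAt (fun t => Real.sqrt (P.hSum c (γ t).1 / ‖P.mono u (γ t).1‖ ^ 2)) 0 t := by
      have h1 := (hH.div hg hg0).sqrt (div_ne_zero hH0 hg0)
      refine h1.congr_deriv ?_
      rw [show P.hSum c (γ t).1 * (2 * A.re) * ‖P.mono u (γ t).1‖ ^ 2 -
        P.hSum c (γ t).1 * (‖P.mono u (γ t).1‖ ^ 2 * (2 * A.re)) = 0 by ring]
      simp
    have hs : ∀ t, P.fibreSection c u (γ t) = P.mono u (γ t).1 *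
        (Real.sqrt (P.hSum c (γ t).1 / ‖P.mono u (γ t).1‖ ^ 2) : ℂ) := by
      intro t
      rw [P.fibreSection_of_mem (hx t), Real.sqrt_div' _ (sq_nonneg _),
        Real.sqrt_sq (norm_nonneg _)]
      push_cast
      ring
    have h2 := hf.mul hr.ofReal_comp
    rw [hdel, hs t, show (fun t => P.fibreSection c u (γ t)) = _ from funext hs]
    refine h2.congr_deriv ?_
    simp only [Complex.ofReal_zero, mul_zero, add_zero]
    ring
  · have h0 : ∀ t, P.fibreSection c u (γ t) = 0 := fun t =>
      P.fibreSection_of_notMem (by rw [hx t]; exact hxu)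
    rw [funext h0, h0 t, mul_zero]
    exact hasDerivAt_const t 0

/-! ### Parallel transport along the fibres -/

/-- Rotation of the homogeneous coordinates. -/
noncomputable def rotate (α : Fin d → ℝ) (z : P.coxSet) : P.coxSet :=
  ⟨fun k => Complex.exp (Complex.I * α k) * z.1 k, by
    obtain ⟨x, hx, h⟩ := z.2
    exact ⟨x, hx, fun k hk => h k (by simpa [Complex.exp_ne_zero] using hk)⟩⟩

theorem norm_mono_rotate (u : Fin n → ℤ) (α : Fin d → ℝ) (z : P.coxSet) :
    ‖P.mono u (P.rotate α z).1‖ = ‖P.mono u z.1‖ := by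
  simp only [mono, rotate, norm_prod, norm_zpow, norm_mul, mul_comm Complex.I,
    Complex.norm_exp_ofReal_mul_I, one_mul]

theorem momentCox_rotate (c : (Fin n → ℤ) → ℝ) (α : Fin d → ℝ) (z : P.coxSet) :
    P.momentCox c (P.rotate α z).1 = P.momentCox c z.1 := by
  funext i
  simp only [momentCox, hSum, norm_mono_rotate]

/-- The path `e^{itα} z` stays in the fibre, where the parallel equation is a linear ODE with
constant coefficient `i ∑ ℓ_k(x) α_k`. -/
theorem IsParallelOn.rotate_eq {P : DelzantPolytope n d} {c : (Fin n → ℤ) → ℝ}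
    (hc : P.IsEmbeddingWeight c) {x : Fin n → ℝ} {s : P.coxSet → ℂ}
    (hs : P.IsParallelOn c (P.fibre c x) s) {z : P.coxSet} (hz : P.momentCox c z.1 = x)
    (α : Fin d → ℝ) :
    s (P.rotate α z) = Complex.exp (Complex.I * ∑ k, (P.ell k x : ℂ) * α k) * s z := by
  let γ : ℝ → P.coxSet := fun t => P.rotate (t • α) z
  set L : ℂ := ∑ k, (P.ell k x : ℂ) * α k
  have hγd : ∀ t k, HasDerivAt (fun t => (γ t).1 k) (Complex.I * α k * (γ t).1 k) t := by
    intro t k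
    have h1 : HasDerivAt (fun t : ℝ => Complex.I * (((t • α) k : ℝ) : ℂ))
        (Complex.I * ((1 * α k : ℝ) : ℂ)) t :=
      (((hasDerivAt_id t).mul_const (α k)).ofReal_comp).const_mul Complex.I
    refine (h1.cexp.mul_const (z.1 k)).congr_deriv ?_
    simp only [γ, rotate]
    push_cast
    ring
  have hγc : ContDiff ℝ ((⊤ : ℕ∞) : WithTop ℕ∞) fun t => (γ t).1 := by
    refine contDiff_pi.2 fun k => ContDiff.mul (ContDiff.cexp ?_) contDiff_const
    exact contDiff_const.mul (Complex.ofRealCLM.contDiff.comp (contDiff_id.smul contDiff_const))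
  have hγx : ∀ t, P.momentCox c (γ t).1 = x := fun t => (P.momentCox_rotate c _ z).trans hz
  have hpar : ∀ t, HasDerivAt (fun t => s (γ t)) (Complex.I * L * s (γ t)) t := by
    intro t
    refine (hs γ hγc hγx t).congr_deriv ?_
    rw [(hasDerivAt_pi.2 (hγd t)).deriv, P.delLogH_eq hc (γ t).2, hγx t, Finset.mul_sum]
    congr 1
    refine Finset.sum_congr rfl fun k _ => ?_
    -- At a vanishing coordinate the quotient is the default `0` instead of `iα_k`, but its
    -- coefficient `ℓ_k(x)` is zero.
    by_cases hk : (γ t).1 k = 0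
    · have := (P.ell_momentCox_eq_zero_iff hc (γ t).2 k).2 hk
      rw [hγx t] at this
      simp [this]
    · rw [mul_div_cancel_right₀ _ hk]; ring
  have hconst : ∀ t, HasDerivAt (fun t : ℝ => Complex.exp (-(Complex.I * L * t)) * s (γ t)) 0 t := by
    intro t
    have h1 : HasDerivAt (fun t : ℝ => -(Complex.I * L * (t : ℂ))) (-(Complex.I * L * 1)) t :=
      ((Complex.ofRealCLM.hasDerivAt (x := t)).const_mul _).neg
    refine (h1.cexp.mul (hpar t)).congr_deriv ?_
    ring
  have h01 := is_const_of_deriv_eq_zero (fun t => (hconst t).differentiableAt)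
    (fun t => (hconst t).deriv) 1 0
  have hγ1 : γ 1 = P.rotate α z := by simp [γ]
  have hγ0 : γ 0 = z := by ext k; simp [γ, rotate]
  simp only [hγ1, hγ0, Complex.ofReal_one, Complex.ofReal_zero, mul_one, mul_zero, neg_zero,
    Complex.exp_zero, one_mul] at h01
  rw [← h01, ← mul_assoc, ← Complex.exp_add, add_neg_cancel, Complex.exp_zero, one_mul]

/-- A fibre with a nonzero parallel section lies over a lattice point. -/
theorem exists_lattice_of_parallel {c : (Fin n → ℤ) → ℝ} (hc : P.IsEmbeddingWeight c)
    {s : P.coxSet → ℂ} {z : P.coxSet}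
    (hs : P.IsParallelOn c (P.fibre c (P.momentCox c z.1)) s) (h0 : s z ≠ 0) :
    ∃ u ∈ P.latticePts, toReal u = P.momentCox c z.1 := by
  set x := P.momentCox c z.1 with hx
  obtain ⟨w, hw⟩ := P.exists_generators
  have key : ∀ i, ∃ m : ℤ, (m : ℝ) = x i := by
    intro i
    -- Rotation by the angles `2π w_{k,i}` is the identity, so `∑ ℓ_k(x) w_{k,i}` must be an
    -- integer; since `∑ w_{k,i} v_k = e_i`, it is `x_i` plus an integer.
    have h1 := hs.rotate_eq hc hx.symm fun k => 2 * Real.pi * w k i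
    have h2 : P.rotate (fun k => 2 * Real.pi * w k i) z = z := by
      ext k
      simp only [rotate]
      have : Complex.I * ((2 * Real.pi * w k i : ℝ) : ℂ) = w k i * (2 * Real.pi * Complex.I) := by
        push_cast; ring
      rw [this, Complex.exp_int_mul_two_pi_mul_I, one_mul]
    rw [h2] at h1
    have h3 := (mul_eq_right₀ h0).1 h1.symm
    obtain ⟨m, hm⟩ := Complex.exp_eq_one_iff.1 h3
    have h4 : Complex.I * ∑ k, (P.ell k x : ℂ) * ((2 * Real.pi * w k i : ℝ) : ℂ) =
        (∑ k, P.ell k x * w k i : ℝ) * (2 * Real.pi * Complex.I) := by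
      push_cast
      rw [Finset.mul_sum, Finset.sum_mul]
      exact Finset.sum_congr rfl fun k _ => by ring
    rw [h4] at hm
    have h5 := mul_right_cancel₀ Complex.two_pi_I_ne_zero hm
    have h6 : ∑ k, P.ell k x * w k i = m := by exact_mod_cast h5
    have h7 : ∑ k, P.ell k x * w k i = x i + ∑ k, (P.lam k : ℝ) * w k i := by
      have h : ∀ i', ∑ k, (w k i : ℝ) * P.v k i' = if i = i' then 1 else 0 := by
        intro i'; exact_mod_cast hw i i'
      simp only [ell, add_mul, Finset.sum_add_distrib, pair, Finset.sum_mul]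
      congr 1
      rw [Finset.sum_comm]
      calc ∑ i', ∑ k, (P.v k i' : ℝ) * x i' * w k i
          = ∑ i', (∑ k, (w k i : ℝ) * P.v k i') * x i' := by
            refine Finset.sum_congr rfl fun i' _ => ?_
            rw [Finset.sum_mul]
            exact Finset.sum_congr rfl fun k _ => by ring
        _ = x i := by simp [h]
    refine ⟨m - ∑ k, P.lam k * w k i, ?_⟩
    push_cast
    linarith
  choose u hu using key
  have hux : toReal u = x := funext hu
  exact ⟨u, by change toReal u ∈ P.body; rw [hux]; exact P.momentCox_mem_body hc z.2, hux⟩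

/-- The fibres of the moment map are orbits of the compact torus. -/
theorem exists_rotate_of_momentCox_eq {c : (Fin n → ℤ) → ℝ} (hc : P.IsEmbeddingWeight c)
    {z w : P.coxSet} (h : P.momentCox c z.1 = P.momentCox c w.1) :
    ∃ t ∈ P.coxGroup, ∃ α : Fin d → ℝ,
      ∀ k, w.1 k = Complex.exp (Complex.I * α k) * ((t k : ℂ) * z.1 k) := by
  classical
  set x := P.momentCox c z.1 with hx
  have hz0 : ∀ k, P.ell k x = 0 ↔ z.1 k = 0 := P.ell_momentCox_eq_zero_iff hc z.2
  have hw0 : ∀ k, P.ell k x = 0 ↔ w.1 k = 0 := by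
    rw [h]; exact P.ell_momentCox_eq_zero_iff hc w.2
  -- `τ` is the logarithmic ratio of the moduli and `ζ` its image in `N_ℝ`. The aim is to show that
  -- `ζ` is a combination of the active normals, so that `τ` lies in the Lie algebra of `G` up to
  -- coordinates that vanish.
  let τ : Fin d → ℝ := fun k =>
    if P.ell k x = 0 then 0 else Real.log (‖w.1 k‖ / ‖z.1 k‖) / (2 * Real.pi)
  let ζ : Fin n → ℝ := fun i => ∑ k, (P.v k i : ℝ) * τ k
  have hpi : 2 * Real.pi ≠ 0 := by positivity
  have hτ : ∀ k, P.ell k x ≠ 0 → ‖w.1 k‖ = Real.exp (2 * Real.pi * τ k) * ‖z.1 k‖ := by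
    intro k hk
    have hz : 0 < ‖z.1 k‖ := norm_pos_iff.2 fun h => hk ((hz0 k).2 h)
    have hw : 0 < ‖w.1 k‖ := norm_pos_iff.2 fun h => hk ((hw0 k).2 h)
    simp only [τ, hk, if_false]
    rw [mul_div_cancel₀ _ hpi, Real.exp_log (div_pos hw hz), div_mul_cancel₀ _ hz.ne']
  let q : (Fin n → ℤ) → ℝ := fun u => c u * ‖P.mono u z.1‖ ^ 2
  let κ : ℝ := Real.exp (4 * Real.pi * ∑ k, (P.lam k : ℝ) * τ k)
  have hmono : ∀ u, ‖P.mono u w.1‖ ^ 2 =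
      κ * Real.exp (4 * Real.pi * pair u ζ) * ‖P.mono u z.1‖ ^ 2 := by
    intro u
    by_cases hF : ∀ k, P.ell k x = 0 → P.ellZ k u = 0
    · have h1 : ‖P.mono u w.1‖ = ‖P.mono u fun k => (Real.exp (2 * Real.pi * τ k) : ℂ)‖ *
          ‖P.mono u z.1‖ := by
        simp only [mono, norm_prod, norm_zpow, ← Finset.prod_mul_distrib, ← mul_zpow]
        refine Finset.prod_congr rfl fun k _ => ?_
        by_cases hk : P.ell k x = 0
        · simp [hF k hk]
        · rw [Complex.norm_real, Real.norm_of_nonneg (Real.exp_pos _).le, hτ k hk]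
      rw [h1, mul_pow, P.norm_mono_sq_ofReal_exp u _ τ]
      intro k _
      rw [Complex.norm_real, Real.norm_of_nonneg (Real.exp_pos _).le]
    · push Not at hF
      obtain ⟨k, hk, hku⟩ := hF
      rw [P.mono_eq_zero ((hz0 k).1 hk) hku, P.mono_eq_zero ((hw0 k).1 hk) hku]
      simp
  have hbal : ∀ y : P.coxSet, P.momentCox c y.1 = x →
      ∑ u ∈ P.latticeFinset, c u * ‖P.mono u y.1‖ ^ 2 * (ζ ⬝ᵥ toReal u - ζ ⬝ᵥ x) = 0 := by
    intro y hy
    have h1 : ∀ i, ∑ u ∈ P.latticeFinset, c u * ‖P.mono u y.1‖ ^ 2 * (u i : ℝ) =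
        x i * P.hSum c y.1 := fun i => by
      rw [← hy, momentCox, div_mul_cancel₀ _ (P.hSum_pos hc y.2).ne']
    simp only [mul_sub, Finset.sum_sub_distrib, ← Finset.sum_mul]
    change _ - P.hSum c y.1 * _ = 0
    simp only [dotProduct, toReal, Finset.mul_sum]
    rw [Finset.sum_comm, ← Finset.sum_sub_distrib]
    refine Finset.sum_eq_zero fun i _ => ?_
    have h2 := congrArg (fun r => ζ i * r) (h1 i)
    simp only [Finset.mul_sum] at h2
    rw [sub_eq_zero]
    calc _ = ∑ u ∈ P.latticeFinset, ζ i * (c u * ‖P.mono u y.1‖ ^ 2 * (u i : ℝ)) :=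
          Finset.sum_congr rfl fun u _ => by ring
      _ = _ := by rw [h2]; ring
  have hz1 := hbal z hx.symm
  have hw1 := hbal w h.symm
  have hκ : 0 < κ := Real.exp_pos _
  have hpair : ∀ u, pair u ζ = ζ ⬝ᵥ toReal u := fun u => dotProduct_comm _ _
  have hw2 : ∑ u ∈ P.latticeFinset, q u * Real.exp (4 * Real.pi * ζ ⬝ᵥ toReal u) *
      (ζ ⬝ᵥ toReal u - ζ ⬝ᵥ x) = 0 := by
    have h1 : κ * ∑ u ∈ P.latticeFinset, q u * Real.exp (4 * Real.pi * ζ ⬝ᵥ toReal u) *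
      (ζ ⬝ᵥ toReal u - ζ ⬝ᵥ x) = 0 := by
      rw [← hw1, Finset.mul_sum]
      refine Finset.sum_congr rfl fun u _ => ?_
      rw [hmono, hpair]
      simp only [q]
      ring
    exact (mul_eq_zero.1 h1).resolve_left hκ.ne'
  -- The two moment equations, subtracted after scaling the first by `e^{4π⟨ζ,x⟩}`. As `exp` is
  -- increasing every term is nonnegative, so all vanish: `ζ` equals `⟨ζ,x⟩` at each lattice point
  -- of positive weight whose monomial is nonzero.
  have hzero : ∑ u ∈ P.latticeFinset, q u * ((Real.exp (4 * Real.pi * ζ ⬝ᵥ toReal u) -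
      Real.exp (4 * Real.pi * ζ ⬝ᵥ x)) * (ζ ⬝ᵥ toReal u - ζ ⬝ᵥ x)) = 0 := by
    have h1 := congrArg (fun r => Real.exp (4 * Real.pi * ζ ⬝ᵥ x) * r) hz1
    simp only [Finset.mul_sum, mul_zero] at h1
    rw [← sub_zero (0 : ℝ)]
    nth_rewrite 1 [← hw2]
    rw [← h1, ← Finset.sum_sub_distrib]
    exact Finset.sum_congr rfl fun u _ => by simp only [q]; ring
  have hterm : ∀ a b : ℝ, 0 ≤ (Real.exp (4 * Real.pi * a) - Real.exp (4 * Real.pi * b)) * (a - b) ∧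
      ((Real.exp (4 * Real.pi * a) - Real.exp (4 * Real.pi * b)) * (a - b) = 0 → a = b) := by
    have hp : 0 < 4 * Real.pi := by positivity
    intro a b
    rcases lt_trichotomy a b with hab | rfl | hab
    · have := Real.exp_lt_exp.2 (mul_lt_mul_of_pos_left hab hp)
      have h1 := mul_pos_of_neg_of_neg (sub_neg.2 this) (sub_neg.2 hab)
      exact ⟨h1.le, fun h => absurd h h1.ne'⟩
    · simp
    · have := Real.exp_lt_exp.2 (mul_lt_mul_of_pos_left hab hp)
      have h1 := mul_pos (sub_pos.2 this) (sub_pos.2 hab)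
      exact ⟨h1.le, fun h => absurd h h1.ne'⟩
  have hq : ∀ u ∈ P.latticeFinset, 0 ≤ q u := fun u hu =>
    mul_nonneg (hc.1 u (P.mem_latticeFinset.1 hu)) (sq_nonneg _)
  have hζ := (Finset.sum_eq_zero_iff_of_nonneg
    fun u hu => mul_nonneg (hq u hu) (hterm _ _).1).1 hzero
  obtain ⟨b, hb0, hb⟩ := P.exists_sum_normals_eq hc (P.momentCox_mem_body hc z.2) ζ (ζ ⬝ᵥ x)
    fun u hu hcu hF => by
      have h1 : P.mono u z.1 ≠ 0 := P.mono_ne_zero fun k hk => hF k ((hz0 k).2 hk)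
      have h2 : q u ≠ 0 := mul_ne_zero hcu.ne' (pow_ne_zero _ (norm_ne_zero_iff.2 h1))
      exact (hterm _ _).2 ((mul_eq_zero.1 (hζ u (P.mem_latticeFinset.2 hu))).resolve_left h2)
  -- The correction `b` is supported on coordinates that vanish at both points: it puts the scaling
  -- in `G` without changing its effect. Only arguments are left for the rotation.
  refine ⟨fun k => Units.mk0 (Complex.exp (2 * Real.pi * (τ k - b k : ℝ))) (Complex.exp_ne_zero _),
    fun i => ?_, fun k => Complex.arg (w.1 k) - Complex.arg (z.1 k), fun k => ?_⟩
  · ext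
    simp only [Units.coe_prod, Units.val_zpow_eq_zpow_val, Units.val_mk0, Units.val_one,
      ← Complex.exp_int_mul]
    rw [← Complex.exp_sum]
    have h1 : ∑ k, (P.v k i : ℝ) * (τ k - b k) = 0 := by
      simp only [mul_sub, Finset.sum_sub_distrib]
      rw [sub_eq_zero]
      change ζ i = _
      rw [← hb i]
      exact Finset.sum_congr rfl fun k _ => mul_comm _ _
    have h2 : ∑ k, (P.v k i : ℂ) * (2 * Real.pi * (τ k - b k : ℝ)) =
        2 * Real.pi * ((∑ k, (P.v k i : ℝ) * (τ k - b k) : ℝ) : ℂ) := by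
      push_cast
      rw [Finset.mul_sum]
      exact Finset.sum_congr rfl fun k _ => by ring
    rw [h2, h1]; simp
  · by_cases hk : P.ell k x = 0
    · rw [(hz0 k).1 hk, (hw0 k).1 hk]; simp
    · have hexp : Complex.exp (2 * Real.pi * (τ k - b k : ℝ)) =
          (Real.exp (2 * Real.pi * τ k) : ℝ) := by
        rw [hb0 k hk]; push_cast; simp
      have hn := hτ k hk
      rw [Units.val_mk0, hexp]
      conv_lhs => rw [← Complex.norm_mul_exp_arg_mul_I (w.1 k), hn]
      have hzp := Complex.norm_mul_exp_arg_mul_I (z.1 k)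
      push_cast
      have h3 : Complex.exp (Complex.I * ((w.1 k).arg - (z.1 k).arg)) *
          Complex.exp ((z.1 k).arg * Complex.I) = Complex.exp ((w.1 k).arg * Complex.I) := by
        rw [← Complex.exp_add]; congr 1; ring
      linear_combination -(Complex.exp (2 * Real.pi * τ k) * ‖z.1 k‖) * h3 +
        Complex.exp (Complex.I * ((w.1 k).arg - (z.1 k).arg)) *
          Complex.exp (2 * Real.pi * τ k) * hzp

/-- Parallel sections over a fibre are proportional. -/
theorem parallel_proportional {c : (Fin n → ℤ) → ℝ} (hc : P.IsEmbeddingWeight c)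
    {x : Fin n → ℝ} {s s' : P.coxSet → ℂ} (hs : s ∈ P.Sections) (hs' : s' ∈ P.Sections)
    (hp : P.IsParallelOn c (P.fibre c x) s) (hp' : P.IsParallelOn c (P.fibre c x) s')
    {z w : P.coxSet} (hz : P.momentCox c z.1 = x) (hw : P.momentCox c w.1 = x) :
    s w * s' z = s z * s' w := by
  obtain ⟨t, ht, α, h⟩ := P.exists_rotate_of_momentCox_eq hc (hz.trans hw.symm)
  let y : P.coxSet := ⟨fun k => (t k : ℂ) * z.1 k, by
    obtain ⟨x, hx, h⟩ := z.2
    exact ⟨x, hx, fun k hk => h k (by simpa using hk)⟩⟩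
  have hy : P.momentCox c y.1 = x := (P.momentCox_smul c ht fun _ => rfl).trans hz
  have hwy : w = P.rotate α y := Subtype.ext (funext h)
  rw [hwy, hp.rotate_eq hc hy, hp'.rotate_eq hc hy, hs t ht z y fun _ => rfl,
    hs' t ht z y fun _ => rfl]
  ring

/-! ### Bohr-Sommerfeld fibres and real polarized sections -/

theorem isBohrSommerfeld_fibre {c : (Fin n → ℤ) → ℝ} (hc : P.IsEmbeddingWeight c)
    (u : Fin n → ℤ) : P.IsBohrSommerfeld c (P.fibre c (toReal u)) :=
  ⟨P.fibreSection c u, P.fibreSection_mem_sections c u,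
    fun _ hz => P.fibreSection_ne_zero hc hz, P.fibreSection_isParallelOn hc u _⟩

/-- The Bohr-Sommerfeld fibres are the fibres over the lattice points. -/
theorem exists_equiv_BSFibres {c : (Fin n → ℤ) → ℝ} (hc : P.IsEmbeddingWeight c) :
    ∃ e : P.BSFibres c ≃ P.latticePts, ∀ F : P.BSFibres c,
      (F : Set P.Space) = P.fibre c (toReal (e F).1) := by
  let g : P.latticePts → P.BSFibres c := fun u =>
    ⟨P.fibre c (toReal u.1), toReal u.1, u.2, rfl, P.isBohrSommerfeld_fibre hc u.1⟩
  have hg : Function.Bijective g := by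
    constructor
    · intro u u' h
      obtain ⟨z, hz⟩ := P.fibre_nonempty hc u.2
      have h1 : P.proj z ∈ P.fibre c (toReal u'.1) := by
        have h2 : P.fibre c (toReal u.1) = P.fibre c (toReal u'.1) := congrArg Subtype.val h
        rw [← h2]; exact hz
      exact Subtype.ext (toReal_injective (hz.symm.trans h1))
    · rintro ⟨_, x, hx, rfl, s, -, hs0, hs⟩
      obtain ⟨z, rfl⟩ := P.fibre_nonempty hc hx
      obtain ⟨u, hu, hux⟩ := P.exists_lattice_of_parallel hc hs (hs0 z rfl)
      exact ⟨⟨u, hu⟩, Subtype.ext (by simp only [g, hux])⟩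
  refine ⟨(Equiv.ofBijective g hg).symm, fun F => ?_⟩
  conv_lhs => rw [← (Equiv.ofBijective g hg).apply_symm_apply F]
  rfl

theorem fibreSection_mem_realPolarized {c : (Fin n → ℤ) → ℝ} (hc : P.IsEmbeddingWeight c)
    (u : Fin n → ℤ) : P.fibreSection c u ∈ P.RealPolarized c :=
  ⟨P.fibreSection_mem_sections c u, fun x _ => P.fibreSection_isParallelOn hc u x⟩

/-- A parallel section vanishes off the fibres over lattice points and is a multiple of the unit
section on each of these. No transversal regularity is imposed, so the multiples are arbitrary; one
chosen point per fibre reads them off. -/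
theorem exists_basis_realPolarized {c : (Fin n → ℤ) → ℝ} (hc : P.IsEmbeddingWeight c) :
    ∃ b : Module.Basis P.latticePts ℂ (P.RealPolarized c),
      ∀ u, (b u : P.coxSet → ℂ) = P.fibreSection c u.1 := by
  classical
  have : Fintype P.latticePts := P.latticePts_finite.fintype
  let f : P.latticePts → P.RealPolarized c := fun u =>
    ⟨P.fibreSection c u.1, P.fibreSection_mem_realPolarized hc u.1⟩
  choose pt hpt using fun u : P.latticePts => P.fibre_nonempty hc u.2
  have hsum : ∀ (a : P.latticePts → ℂ) (z : P.coxSet),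
      ((∑ u, a u • f u : P.RealPolarized c) : P.coxSet → ℂ) z =
        ∑ u, a u * P.fibreSection c u.1 z := by
    intro a z
    simp [f, Finset.sum_apply]
  have hone : ∀ (a : P.latticePts → ℂ) (u : P.latticePts) (z : P.coxSet),
      P.momentCox c z.1 = toReal u.1 →
        ∑ u, a u * P.fibreSection c u.1 z = a u * P.fibreSection c u.1 z := by
    intro a u z hz
    refine Finset.sum_eq_single u (fun u' _ hne => ?_) fun h => absurd (Finset.mem_univ u) h
    rw [P.fibreSection_of_notMem, mul_zero]
    rw [hz]
    exact fun h => hne (Subtype.ext (toReal_injective h.symm))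
  have hli : LinearIndependent ℂ f := by
    rw [Fintype.linearIndependent_iff]
    intro a ha u
    have h1 := hsum a (pt u)
    rw [ha, hone a u _ (hpt u)] at h1
    exact (mul_eq_zero.1 h1.symm).resolve_right (P.fibreSection_ne_zero hc (hpt u))
  have hsp : ⊤ ≤ Submodule.span ℂ (Set.range f) := by
    rintro ⟨s, hs⟩ -
    have h1 : (⟨s, hs⟩ : P.RealPolarized c) =
        ∑ u, (s (pt u) / P.fibreSection c u.1 (pt u)) • f u := by
      refine Subtype.ext (funext fun z => ?_)
      rw [hsum]
      by_cases hz : ∃ u ∈ P.latticePts, toReal u = P.momentCox c z.1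
      · obtain ⟨u, hu, hux⟩ := hz
        rw [hone _ ⟨u, hu⟩ z hux.symm, div_mul_eq_mul_div,
          eq_div_iff (P.fibreSection_ne_zero hc (hpt ⟨u, hu⟩))]
        exact P.parallel_proportional hc hs.1 (P.fibreSection_mem_sections c u)
          (hs.2 (toReal u) hu) (P.fibreSection_isParallelOn hc u _) (hpt ⟨u, hu⟩) hux.symm
      · have h0 : s z = 0 := by
          by_contra h0
          exact hz (P.exists_lattice_of_parallel hc
            (hs.2 _ (P.momentCox_mem_body hc z.2)) h0)
        change s z = _
        rw [h0]
        symm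
        refine Finset.sum_eq_zero fun u _ => ?_
        rw [P.fibreSection_of_notMem fun h => hz ⟨u.1, u.2, h.symm⟩, mul_zero]
    rw [h1]
    exact Submodule.sum_mem _ fun u _ => Submodule.smul_mem _ _ (Submodule.subset_span ⟨u, rfl⟩)
  exact ⟨Module.Basis.mk hli hsp, fun u => by rw [Module.Basis.mk_apply]⟩

/-! ### Intersection points at infinity and lattice points -/

/-- The intersection points at infinity are the lattice points of the polytope. -/
theorem exists_equiv_intersection {c : (Fin n → ℤ) → ℝ} (hc : P.IsEmbeddingWeight c) :
    ∃ e : P.IntersectionAtInfinity c ≃ P.latticePts, ∀ r : P.IntegralRay c,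
      Tendsto (fun t => P.dphi c (r.1 t)) atTop
        (𝓝 (toReal (e (Quotient.mk (P.integralEquiv c) r)).1)) := by
  have hex : ∀ r : P.IntegralRay c, ∃ u : P.latticePts,
      Tendsto (fun t => P.dphi c (r.1 t)) atTop (𝓝 (toReal u.1)) := by
    rintro ⟨r, hr, u, hu⟩
    refine ⟨⟨u, ?_⟩, hu⟩
    -- `dφ` has values in the closed set `B`, so an integral limit is automatically a lattice point
    -- of `B`.
    exact P.isClosed_body.mem_of_tendsto hu (Eventually.of_forall fun t => P.dphi_mem_body hc _)
  choose lim hlim using hex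
  let g : P.IntersectionAtInfinity c → P.latticePts :=
    Quotient.lift lim (by
      rintro a b ⟨x, ha, hb⟩
      exact Subtype.ext (toReal_injective ((tendsto_nhds_unique (hlim a) ha).trans
        (tendsto_nhds_unique (hlim b) hb).symm)))
  have hg : Function.Bijective g := by
    constructor
    · intro p q
      induction p using Quotient.inductionOn
      induction q using Quotient.inductionOn
      rename_i a b
      intro h
      have h : lim a = lim b := h
      refine Quotient.sound ⟨toReal (lim a).1, hlim a, ?_⟩
      rw [h]; exact hlim b
    · intro u
      obtain ⟨r, hr, hu⟩ := P.exists_ray hc u.2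
      refine ⟨Quotient.mk _ ⟨r, hr, u.1, hu⟩, Subtype.ext (toReal_injective ?_)⟩
      exact tendsto_nhds_unique (hlim ⟨r, hr, u.1, hu⟩) hu
  exact ⟨Equiv.ofBijective g hg, hlim⟩

theorem mem_interior_iff_intersection {c : (Fin n → ℤ) → ℝ} (hc : P.IsEmbeddingWeight c)
    (u : Fin n → ℤ) : toReal u ∈ interior P.body ↔
      ∃ x ∈ zeroSection n ∩ P.lagrangian c, P.dphi c x.1 = toReal u := by
  constructor
  · intro h
    obtain ⟨ξ, hξ⟩ := P.exists_dphi_eq hc h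
    refine ⟨(ξ, 0), ⟨rfl, ?_⟩, hξ⟩
    funext i
    change (0 : UnitAddCircle) = ((P.dphi c ξ i : ℝ) : UnitAddCircle)
    rw [hξ, eq_comm, AddCircle.coe_eq_zero_iff]
    exact ⟨u i, by simp [toReal]⟩
  · rintro ⟨x, -, hx⟩
    rw [← hx, P.mem_interior_iff]
    exact P.ell_dphi_pos hc x.1

/-! ### The kernel of the Witten differential -/

/-- A vertex maximising `⟨·,ξ⟩` dominates `u` and has positive weight. It depends on `ξ`, so all
inverse weights are summed to get a uniform constant; a zero weight adds `0⁻¹ = 0`. -/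
theorem exp_pair_le_mul_expSum {c : (Fin n → ℤ) → ℝ} (hc : P.IsEmbeddingWeight c)
    {u : Fin n → ℤ} (hu : u ∈ P.latticePts) (ξ : Fin n → ℝ) :
    Real.exp (4 * Real.pi * pair u ξ) ≤ (∑ w ∈ P.latticeFinset, (c w)⁻¹) * P.expSum c ξ := by
  obtain ⟨w, hw, hcw, -, hle⟩ := P.exists_weight_pos_ge hc hu ξ
  have hw' := P.mem_latticeFinset.2 hw
  have h0 : ∀ w ∈ P.latticeFinset, 0 ≤ c w := fun w hw => hc.1 w (P.mem_latticeFinset.1 hw)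
  rw [dotProduct_comm, dotProduct_comm ξ] at hle
  calc Real.exp (4 * Real.pi * pair u ξ) ≤ Real.exp (4 * Real.pi * pair w ξ) :=
        Real.exp_le_exp.2 (mul_le_mul_of_nonneg_left hle (by positivity))
    _ = (c w)⁻¹ * (c w * Real.exp (4 * Real.pi * pair w ξ)) := by
        rw [inv_mul_cancel_left₀ hcw.ne']
    _ ≤ _ := by
        refine mul_le_mul ?_ ?_ (by positivity)
          (Finset.sum_nonneg fun w hw => inv_nonneg.2 (h0 w hw))
        · exact Finset.single_le_sum (f := fun w => (c w)⁻¹)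
            (fun w hw => inv_nonneg.2 (h0 w hw)) hw'
        · exact Finset.single_le_sum (f := fun w => c w * Real.exp (4 * Real.pi * pair w ξ))
            (fun w hw => mul_nonneg (h0 w hw) (Real.exp_pos _).le) hw'

theorem sq_exp_eq {c : (Fin n → ℤ) → ℝ} (hc : P.IsEmbeddingWeight c) (ξ : Fin n → ℝ) (r : ℝ) :
    (Real.exp (-(2 * Real.pi * P.phi c ξ)) * Real.exp (2 * Real.pi * r)) ^ 2 =
      Real.exp (4 * Real.pi * r) / P.expSum c ξ := by
  rw [eq_div_iff (P.expSum_pos hc ξ).ne', ← P.exp_phi hc, ← Real.exp_add, ← Real.exp_nat_mul,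
    ← Real.exp_add]
  congr 1
  push_cast
  ring

theorem wittenFun_self (c : (Fin n → ℤ) → ℝ) (u : Fin n → ℤ) (ξ : Fin n → ℝ) :
    P.wittenFun c u ξ (-u) = ((Real.exp (-(2 * Real.pi * P.phi c ξ)) *
      Real.exp (2 * Real.pi * pair u ξ) : ℝ) : ℂ) := if_pos rfl

theorem wittenFun_of_ne (c : (Fin n → ℤ) → ℝ) {u m : Fin n → ℤ} (h : m ≠ -u) (ξ : Fin n → ℝ) :
    P.wittenFun c u ξ m = 0 := if_neg h

theorem fderiv_wittenFun_apply {c : (Fin n → ℤ) → ℝ} (hc : P.IsEmbeddingWeight c)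
    (u : Fin n → ℤ) (ξ a : Fin n → ℝ) :
    fderiv ℝ (fun ξ => P.wittenFun c u ξ (-u)) ξ a =
      2 * Real.pi * ((pair u a - fderiv ℝ (P.phi c) ξ a : ℝ) : ℂ) * P.wittenFun c u ξ (-u) := by
  have hline : HasDerivAt (fun t : ℝ => ξ + t • a) a 0 := by
    simpa using ((hasDerivAt_id (0 : ℝ)).smul_const a).const_add ξ
  have hsm : Differentiable ℝ (fun ξ => P.wittenFun c u ξ (-u)) := by
    simp only [wittenFun_self]
    refine Complex.ofRealCLM.differentiable.comp (Differentiable.mul ?_ ?_)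
    · exact ((P.differentiable_phi hc).const_mul _).neg.exp
    · exact (((contDiff_pair u (m := 1)).differentiable (by simp)).const_mul _).exp
  have h1 : HasFDerivAt (fun ξ => P.wittenFun c u ξ (-u))
      (fderiv ℝ (fun ξ => P.wittenFun c u ξ (-u)) ξ) (ξ + (0 : ℝ) • a) := by
    simpa using (hsm ξ).hasFDerivAt
  have h2 := h1.comp_hasDerivAt (0 : ℝ) hline
  have h3 : HasDerivAt (fun t : ℝ => P.phi c (ξ + t • a)) (fderiv ℝ (P.phi c) ξ a) 0 := by
    have h4 : HasFDerivAt (P.phi c) (fderiv ℝ (P.phi c) ξ) (ξ + (0 : ℝ) • a) := by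
      simpa using (P.differentiable_phi hc ξ).hasFDerivAt
    exact h4.comp_hasDerivAt 0 hline
  have h5 : HasDerivAt (fun t : ℝ => pair u (ξ + t • a)) (1 * pair u a) 0 := by
    simp only [pair_add, pair_smul]
    exact ((hasDerivAt_id (0 : ℝ)).mul_const _).const_add _
  have h6 := ((h3.const_mul (2 * Real.pi)).neg.exp.mul
    (h5.const_mul (2 * Real.pi)).exp).ofReal_comp
  have h7 := h2.unique (h6.congr_of_eventuallyEq (Eventually.of_forall fun t =>
    P.wittenFun_self c u (ξ + t • a)))
  rw [h7, wittenFun_self]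
  simp only [zero_smul, add_zero, Pi.neg_apply]
  push_cast
  ring

/-- Decay in `m` is trivial, as only one component is nonzero. Membership of `u` in `B` is needed
for boundedness. -/
theorem wittenFun_mem {c : (Fin n → ℤ) → ℝ} (hc : P.IsEmbeddingWeight c)
    {u : Fin n → ℤ} (hu : u ∈ P.latticePts) : P.wittenFun c u ∈ P.WittenKernel c := by
  have hne : ∀ m, m ≠ -u → (fun ξ => P.wittenFun c u ξ m) = fun _ => 0 := fun m hm =>
    funext fun ξ => P.wittenFun_of_ne c hm ξ
  refine ⟨fun m => ?_, fun K _ k l ε hε => ?_, ?_, fun m ξ a => ?_⟩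
  · by_cases hm : m = -u
    · subst hm
      simp only [wittenFun_self]
      refine Complex.ofRealCLM.contDiff.comp (ContDiff.mul ?_ ?_)
      · exact (contDiff_const.mul (P.contDiff_phi hc)).neg.exp
      · exact (contDiff_const.mul (contDiff_pair u)).exp
    · rw [hne m hm]; exact contDiff_const
  · filter_upwards [(Set.finite_singleton (-u)).compl_mem_cofinite] with m hm ξ _
    rw [hne m hm, iteratedFDeriv_fun_zero]
    simpa using hε.le
  · refine ⟨Real.sqrt (∑ w ∈ P.latticeFinset, (c w)⁻¹), fun ξ m => ?_⟩
    by_cases hm : m = -u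
    · subst hm
      rw [wittenFun_self, Complex.norm_real, Real.norm_of_nonneg (by positivity)]
      refine Real.le_sqrt_of_sq_le ?_
      rw [P.sq_exp_eq hc, div_le_iff₀ (P.expSum_pos hc ξ)]
      exact P.exp_pair_le_mul_expSum hc hu ξ
    · rw [P.wittenFun_of_ne c hm, norm_zero]; exact Real.sqrt_nonneg _
  · by_cases hm : m = -u
    · subst hm
      rw [P.fderiv_wittenFun_apply hc, pair_neg]
      push_cast
      ring
    · rw [P.wittenFun_of_ne c hm, hne m hm]
      simp

/-- On one component both functions solve the same first order linear equation, so their ratio has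
zero derivative along every line and is constant. -/
theorem wittenKernel_eq {c : (Fin n → ℤ) → ℝ} (hc : P.IsEmbeddingWeight c)
    {f : (Fin n → ℝ) → (Fin n → ℤ) → ℂ} (hf : f ∈ P.WittenKernel c) (m : Fin n → ℤ) :
    ∃ a : ℂ, ∀ ξ, f ξ m = a * P.wittenFun c (-m) ξ m := by
  obtain ⟨h1, -, -, h4⟩ := hf
  have hw0 : ∀ ξ, P.wittenFun c (-m) ξ m ≠ 0 := by
    intro ξ
    have := P.wittenFun_self c (-m) ξ
    rw [neg_neg] at this
    rw [this]
    exact_mod_cast (mul_pos (Real.exp_pos _) (Real.exp_pos _)).ne'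
  have hd : ∀ ξ a, HasDerivAt (fun t : ℝ => f (ξ + t • a) m / P.wittenFun c (-m) (ξ + t • a) m)
      0 0 := by
    intro ξ a
    have hline : HasDerivAt (fun t : ℝ => ξ + t • a) a 0 := by
      simpa using ((hasDerivAt_id (0 : ℝ)).smul_const a).const_add ξ
    have hF : HasDerivAt (fun t : ℝ => f (ξ + t • a) m) (fderiv ℝ (fun ξ => f ξ m) ξ a) 0 := by
      have : HasFDerivAt (fun ξ => f ξ m) (fderiv ℝ (fun ξ => f ξ m) ξ) (ξ + (0 : ℝ) • a) := by
        simpa using ((h1 m).differentiable (by simp) ξ).hasFDerivAt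
      exact this.comp_hasDerivAt 0 hline
    have hW : HasDerivAt (fun t : ℝ => P.wittenFun c (-m) (ξ + t • a) m)
        (fderiv ℝ (fun ξ => P.wittenFun c (-m) ξ m) ξ a) 0 := by
      have hdiff : DifferentiableAt ℝ (fun ξ => P.wittenFun c (-m) ξ m) ξ := by
        have hs : (fun ξ => P.wittenFun c (-m) ξ m) = fun ξ =>
            ((Real.exp (-(2 * Real.pi * P.phi c ξ)) *
              Real.exp (2 * Real.pi * pair (-m) ξ) : ℝ) : ℂ) := by
          funext ξ
          have := P.wittenFun_self c (-m) ξ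
          rwa [neg_neg] at this
        rw [hs]
        have hsm : ContDiff ℝ 1 fun ξ => Real.exp (-(2 * Real.pi * P.phi c ξ)) *
              Real.exp (2 * Real.pi * pair (-m) ξ) :=
          (contDiff_const.mul (P.contDiff_phi hc)).neg.exp.mul
            (contDiff_const.mul (contDiff_pair (-m))).exp
        exact (Complex.ofRealCLM.differentiable _).comp ξ (hsm.differentiable (by simp) ξ)
      have : HasFDerivAt (fun ξ => P.wittenFun c (-m) ξ m)
          (fderiv ℝ (fun ξ => P.wittenFun c (-m) ξ m) ξ) (ξ + (0 : ℝ) • a) := by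
        simpa using hdiff.hasFDerivAt
      exact this.comp_hasDerivAt 0 hline
    have hw := P.fderiv_wittenFun_apply hc (-m) ξ a
    rw [neg_neg] at hw
    refine (hF.div hW (hw0 _)).congr_deriv ?_
    have h5 : fderiv ℝ (fun ξ => f ξ m) ξ a =
        -(2 * Real.pi * ((fderiv ℝ (P.phi c) ξ a + pair m a : ℝ) : ℂ) * f ξ m) :=
      eq_neg_of_add_eq_zero_left (h4 m ξ a)
    rw [h5, hw, div_eq_zero_iff]
    left
    simp only [zero_smul, add_zero, pair_neg]
    push_cast
    ring
  refine ⟨f 0 m / P.wittenFun c (-m) 0 m, fun ξ => ?_⟩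
  have hd' : ∀ t : ℝ, HasDerivAt
      (fun t : ℝ => f (t • ξ) m / P.wittenFun c (-m) (t • ξ) m) 0 t := by
    intro t
    have h := hd (t • ξ) ξ
    have h2 : HasDerivAt (fun r : ℝ => r - t) 1 t := (hasDerivAt_id t).sub_const t
    have h3 := HasDerivAt.scomp_of_eq t h h2 (sub_self t).symm
    simpa [Function.comp_def, ← add_smul] using h3
  have h01 := is_const_of_deriv_eq_zero (fun t => (hd' t).differentiableAt)
    (fun t => (hd' t).deriv) 1 0
  simp only [one_smul, zero_smul] at h01
  rw [← h01, div_mul_cancel₀ _ (hw0 ξ)]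

/-- Bounded solutions exist only on the components of lattice points of the polytope. -/
theorem neg_mem_latticePts_of_ne_zero {c : (Fin n → ℤ) → ℝ} (hc : P.IsEmbeddingWeight c)
    {f : (Fin n → ℝ) → (Fin n → ℤ) → ℂ} (hf : f ∈ P.WittenKernel c) {m : Fin n → ℤ}
    {ξ₀ : Fin n → ℝ} (h0 : f ξ₀ m ≠ 0) : -m ∈ P.latticePts := by
  obtain ⟨a, ha⟩ := P.wittenKernel_eq hc hf m
  obtain ⟨-, -, ⟨C, hC⟩, -⟩ := hf
  have ha0 : a ≠ 0 := by
    rintro rfl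
    exact h0 (by rw [ha, zero_mul])
  intro k
  change 0 ≤ P.ell k (toReal (-m))
  rw [ell_toReal]
  by_contra hneg
  have hneg : P.ellZ k (-m) ≤ -1 := by
    have h1 : P.ellZ k (-m) < 0 := by exact_mod_cast not_le.1 hneg
    omega
  have hnegR : (P.ellZ k (-m) : ℝ) ≤ -1 := by exact_mod_cast hneg
  have hpair : ∀ u : Fin n → ℤ, pair u (toReal (P.v k)) = P.ellZ k u - P.lam k := by
    intro u
    rw [← ell_toReal, ell_eq, dotProduct_comm, pair_eq_dotProduct]; ring
  have hpi := Real.pi_pos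
  set D := ∑ u ∈ P.latticeFinset, c u with hD
  have hDpos : 0 < D := by
    have := P.expSum_pos hc 0
    simpa [expSum, pair] using this
  -- Along `-s v_k` every lattice point of `B` satisfies `⟨u, -s v_k⟩ ≤ sλ_k`, whereas `-m` gains
  -- the extra exponent `-sℓ_k(-m) ≥ s`. So `|f|²` would grow at least like `e^{4πs}`; the linear
  -- lower bound `s` already suffices to contradict boundedness.
  have hup : ∀ s : ℝ, 0 ≤ s → P.expSum c ((-s) • toReal (P.v k)) ≤
      D * Real.exp (4 * Real.pi * (s * P.lam k)) := by
    intro s hs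
    rw [expSum, hD, Finset.sum_mul]
    refine Finset.sum_le_sum fun u hu => ?_
    have hu' := P.mem_latticeFinset.1 hu
    refine mul_le_mul_of_nonneg_left (Real.exp_le_exp.2 ?_) (hc.1 u hu')
    refine mul_le_mul_of_nonneg_left ?_ (by positivity)
    rw [pair_smul, hpair]
    have h1 : (0 : ℝ) ≤ P.ellZ k u := by exact_mod_cast P.ellZ_nonneg hu' k
    nlinarith [mul_nonneg hs h1]
  have hlow : ∀ s : ℝ, 0 ≤ s → ‖a‖ ^ 2 * s ≤ C ^ 2 * D := by
    intro s hs
    set ξ := (-s) • toReal (P.v k) with hξ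
    have h1 := hC ξ m
    have h2 := P.wittenFun_self c (-m) ξ
    rw [neg_neg] at h2
    rw [ha, h2, norm_mul, Complex.norm_real, Real.norm_of_nonneg (by positivity)] at h1
    have h3 := pow_le_pow_left₀ (by positivity) h1 2
    rw [mul_pow, P.sq_exp_eq hc, hξ, pair_smul, hpair, ← hξ, mul_div_assoc',
      div_le_iff₀ (P.expSum_pos hc ξ)] at h3
    have h4 := h3.trans (mul_le_mul_of_nonneg_left (hup s hs) (sq_nonneg C))
    have h5 : Real.exp (4 * Real.pi * (-s * (P.ellZ k (-m) - P.lam k))) =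
        Real.exp (4 * Real.pi * (-s * P.ellZ k (-m))) *
          Real.exp (4 * Real.pi * (s * P.lam k)) := by
      rw [← Real.exp_add]; congr 1; ring
    rw [h5, ← mul_assoc, ← mul_assoc (C ^ 2)] at h4
    have h6 := le_of_mul_le_mul_right h4 (Real.exp_pos _)
    refine le_trans (mul_le_mul_of_nonneg_left ?_ (sq_nonneg _)) h6
    have h7 := Real.add_one_le_exp (4 * Real.pi * (-s * P.ellZ k (-m)))
    have h8 : s ≤ 4 * Real.pi * (-s * P.ellZ k (-m)) := by
      have h9 : s ≤ -s * P.ellZ k (-m) := by nlinarith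
      have h10 : (1 : ℝ) ≤ 4 * Real.pi := by linarith [Real.pi_gt_three]
      nlinarith
    linarith
  have hapos : 0 < ‖a‖ ^ 2 := by positivity
  -- Just beyond the largest `s` that the bound `‖a‖² s ≤ C² D` permits.
  have h1 := hlow (C ^ 2 * D / ‖a‖ ^ 2 + 1) (by positivity)
  rw [mul_add, mul_div_cancel₀ _ hapos.ne', mul_one] at h1
  linarith

theorem exists_basis_wittenKernel {c : (Fin n → ℤ) → ℝ} (hc : P.IsEmbeddingWeight c) :
    ∃ b : Module.Basis P.latticePts ℂ (P.WittenKernel c),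
      ∀ u, (b u : (Fin n → ℝ) → (Fin n → ℤ) → ℂ) = P.wittenFun c u.1 := by
  classical
  have : Fintype P.latticePts := P.latticePts_finite.fintype
  let f : P.latticePts → P.WittenKernel c := fun u =>
    ⟨P.wittenFun c u.1, P.wittenFun_mem hc u.2⟩
  have hsum : ∀ (a : P.latticePts → ℂ) (ξ : Fin n → ℝ) (m : Fin n → ℤ),
      ((∑ u, a u • f u : P.WittenKernel c) : (Fin n → ℝ) → (Fin n → ℤ) → ℂ) ξ m =
        ∑ u, a u * P.wittenFun c u.1 ξ m := by
    intro a ξ m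
    simp [f, Finset.sum_apply]
  have hone : ∀ (a : P.latticePts → ℂ) (u : P.latticePts) (ξ : Fin n → ℝ),
      ∑ w, a w * P.wittenFun c w.1 ξ (-u.1) = a u * P.wittenFun c u.1 ξ (-u.1) := by
    intro a u ξ
    refine Finset.sum_eq_single u (fun w _ hne => ?_) fun h => absurd (Finset.mem_univ u) h
    rw [P.wittenFun_of_ne c, mul_zero]
    exact fun h => hne (Subtype.ext (neg_injective h).symm)
  have hne : ∀ (u : Fin n → ℤ) ξ, P.wittenFun c u ξ (-u) ≠ 0 := by
    intro u ξ
    rw [wittenFun_self]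
    exact_mod_cast (mul_pos (Real.exp_pos _) (Real.exp_pos _)).ne'
  have hli : LinearIndependent ℂ f := by
    rw [Fintype.linearIndependent_iff]
    intro a ha u
    have h1 := hsum a 0 (-u.1)
    rw [ha, hone] at h1
    exact (mul_eq_zero.1 h1.symm).resolve_right (hne _ _)
  have hsp : ⊤ ≤ Submodule.span ℂ (Set.range f) := by
    rintro ⟨g, hg⟩ -
    choose a ha using P.wittenKernel_eq hc hg
    have h1 : (⟨g, hg⟩ : P.WittenKernel c) = ∑ u, a (-u.1) • f u := by
      refine Subtype.ext (funext fun ξ => funext fun m => ?_)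
      rw [hsum]
      by_cases hm : -m ∈ P.latticePts
      · have h2 := hone (fun u => a (-u.1)) ⟨-m, hm⟩ ξ
        simp only [neg_neg] at h2
        rw [h2, ← ha m ξ]
      · have h0 : g ξ m = 0 := by
          by_contra h0
          exact hm (P.neg_mem_latticePts_of_ne_zero hc hg h0)
        change g ξ m = _
        rw [h0]
        symm
        refine Finset.sum_eq_zero fun u _ => ?_
        rw [P.wittenFun_of_ne c, mul_zero]
        rintro rfl
        exact hm (by rw [neg_neg]; exact u.2)
    rw [h1]
    exact Submodule.sum_mem _ fun u _ => Submodule.smul_mem _ _ (Submodule.subset_span ⟨u, rfl⟩)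
  exact ⟨Module.Basis.mk hli hsp, fun u => by rw [Module.Basis.mk_apply]⟩

/-- Only components `m = -u` with `u ∈ B ∩ M` can be nonzero, so no convergence question arises. -/
theorem syzTransform_eq_sum {c : (Fin n → ℤ) → ℝ} (hc : P.IsEmbeddingWeight c)
    {f : (Fin n → ℝ) → (Fin n → ℤ) → ℂ} (hf : f ∈ P.WittenKernel c)
    (p : (Fin n → ℝ) × (Fin n → ℝ)) : syzTransform f p = ∑ u ∈ P.latticeFinset,
      f p.1 (-u) * Complex.exp (2 * Real.pi * Complex.I * (pair (-u) p.2 : ℝ)) := by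
  classical
  rw [← Finset.sum_image (s := P.latticeFinset) (g := fun u => -u) (f := fun m =>
    f p.1 m * Complex.exp (2 * Real.pi * Complex.I * (pair m p.2 : ℝ)))
    (fun a _ b _ h => neg_injective h)]
  refine tsum_eq_sum fun m hm => ?_
  rw [show f p.1 m = 0 from ?_, zero_mul]
  by_contra h0
  refine hm (Finset.mem_image.2 ⟨-m, P.mem_latticeFinset.2 ?_, neg_neg m⟩)
  exact P.neg_mem_latticePts_of_ne_zero hc hf h0

end DelzantPolytope
end ToricSYZ

/-! ### Fourier coefficients on the torus -/

namespace ToricSYZ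

open MeasureTheory in
/-- A continuous function on a compact group whose averages along a family of translations vanish
has integral zero. -/
theorem integral_eq_zero_of_translate_averages {X : Type*} [AddCommGroup X] [TopologicalSpace X]
    [CompactSpace X] [IsTopologicalAddGroup X] [MeasurableSpace X] [BorelSpace X]
    [SecondCountableTopology X] (μ : Measure X) [IsFiniteMeasure μ] [μ.IsAddRightInvariant]
    {G : X → ℂ} (hG : Continuous G) {τ : ℝ → X} (hτ : Continuous τ)
    (h : ∀ y, ∫ t in (0 : ℝ)..2 * Real.pi, G (y + τ t) = 0) : ∫ y, G y ∂μ = 0 := by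
  have hcont : Continuous (Function.uncurry fun (t : ℝ) (y : X) => G (y + τ t)) := by
    unfold Function.uncurry; fun_prop
  obtain ⟨C, hC⟩ : ∃ C, ∀ y, ‖G y‖ ≤ C := by
    obtain ⟨C, hC⟩ := (isCompact_range hG).isBounded.exists_norm_le
    exact ⟨C, fun y => hC _ ⟨y, rfl⟩⟩
  have : IsFiniteMeasure ((volume : Measure ℝ).restrict (Set.uIoc 0 (2 * Real.pi))) :=
    ⟨by rw [Measure.restrict_apply_univ]; simp [Set.uIoc]⟩
  have hint : Integrable (Function.uncurry fun (t : ℝ) (y : X) => G (y + τ t))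
      ((volume.restrict (Set.uIoc 0 (2 * Real.pi))).prod μ) :=
    Integrable.of_bound hcont.aestronglyMeasurable C (Eventually.of_forall fun p => hC _)
  -- Fubini and translation invariance evaluate the double integral as `2π ∫ G`, while the inner
  -- averages are zero.
  have h1 := intervalIntegral_integral_swap hint
  simp only [h, integral_zero, integral_add_right_eq_self (μ := μ) G] at h1
  rw [intervalIntegral.integral_const, sub_zero] at h1
  exact (smul_eq_zero.1 h1).resolve_left (by positivity)

theorem mFourier_add_apply {n : ℕ} (p : Fin n → ℤ) (x y : UnitAddTorus (Fin n)) :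
    UnitAddTorus.mFourier p (x + y) = UnitAddTorus.mFourier p x * UnitAddTorus.mFourier p y := by
  simp only [UnitAddTorus.mFourier, ContinuousMap.coe_mk, ← Finset.prod_mul_distrib]
  refine Finset.prod_congr rfl fun i _ => ?_
  simp only [fourier_apply, Pi.add_apply, zsmul_add, AddCircle.toCircle_add, Circle.coe_mul]

theorem mFourier_coe {n : ℕ} (p : Fin n → ℤ) (r : Fin n → ℝ) :
    UnitAddTorus.mFourier p (fun i => (r i : UnitAddCircle)) =
      Complex.exp (2 * Real.pi * Complex.I * ∑ i, (p i : ℂ) * r i) := by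
  simp only [UnitAddTorus.mFourier, ContinuousMap.coe_mk, fourier_coe_apply, Finset.mul_sum,
    Complex.exp_sum]
  refine Finset.prod_congr rfl fun i _ => ?_
  congr 1
  push_cast
  ring

theorem mFourier_ne_zero {n : ℕ} (p : Fin n → ℤ) (x : UnitAddTorus (Fin n)) :
    UnitAddTorus.mFourier p x ≠ 0 := by
  intro h
  have h1 := UnitAddTorus.mFourier_add (n := -p) (m := p) (x := x)
  rw [add_neg_cancel, UnitAddTorus.mFourier_zero, h, zero_mul] at h1
  exact one_ne_zero h1

open MeasureTheory in
/-- The Fourier coefficients of a continuous function on the torus vanish if the averages of the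
corresponding modes along a family of translations vanish. -/
theorem mFourierCoeff_eq_zero {n : ℕ} (F : C(UnitAddTorus (Fin n), ℂ)) (m : Fin n → ℤ)
    {τ : ℝ → UnitAddTorus (Fin n)} (hτ : Continuous τ)
    (h : ∀ y, ∫ t in (0 : ℝ)..2 * Real.pi,
      UnitAddTorus.mFourier (-m) (y + τ t) * F (y + τ t) = 0) :
    UnitAddTorus.mFourierCoeff F m = 0 := by
  change ∫ y, UnitAddTorus.mFourier (-m) y • F y
    ∂(Measure.pi fun _ : Fin n => (AddCircle.haarAddCircle : Measure UnitAddCircle)) = 0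
  exact integral_eq_zero_of_translate_averages _
    (by simp only [smul_eq_mul]; fun_prop) hτ h

namespace DelzantPolytope

variable {n d : ℕ} (P : DelzantPolytope n d)

/-! ### Holomorphic sections -/

theorem delLogH_smul_I (c : (Fin n → ℤ) → ℝ) (z η : Fin d → ℂ) :
    P.delLogH c z (Complex.I • η) = Complex.I * P.delLogH c z η := by
  have h : Complex.I • Complex.I • η = -η := by
    rw [smul_smul, Complex.I_mul_I, neg_one_smul]
  simp only [delLogH, h, map_neg]
  push_cast
  linear_combination (-1 / 2 : ℂ) * ((fderiv ℝ (fun w => Real.log (P.hSum c w)) z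
    (Complex.I • η) : ℝ) : ℂ) * Complex.I_sq * (-1)

/-- Since `∂ log H` is complex linear it drops out of `∇_η + i∇_{iη}`, leaving the Cauchy–Riemann
equations. -/
theorem mem_complexPolarized_iff (c : (Fin n → ℤ) → ℝ) {s : P.coxSet → ℂ} :
    s ∈ P.ComplexPolarized c ↔ P.IsSmooth s ∧ ∀ (z : P.coxSet) (η : Fin d → ℂ),
      fderiv ℝ (P.extend s) z.1 (Complex.I • η) =
        Complex.I * fderiv ℝ (P.extend s) z.1 η := by
  refine and_congr_right fun _ => forall_congr' fun z => forall_congr' fun η => ?_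
  simp only [nabla, delLogH_smul_I]
  constructor
  · intro h
    linear_combination (-Complex.I) * h + (fderiv ℝ (P.extend s) z.1 (Complex.I • η) -
      Complex.I * P.delLogH c z.1 η * s z) * Complex.I_sq
  · intro h
    rw [h]
    linear_combination (fderiv ℝ (P.extend s) z.1 η - P.delLogH c z.1 η * s z) * Complex.I_sq

theorem differentiableAt_extend {c : (Fin n → ℤ) → ℝ} {s : P.coxSet → ℂ}
    (hs : s ∈ P.ComplexPolarized c) {z : Fin d → ℂ} (hz : z ∈ P.coxSet) :
    DifferentiableAt ℂ (P.extend s) z := by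
  obtain ⟨hsm, hI⟩ := (P.mem_complexPolarized_iff c).1 hs
  have hd := P.extend_differentiableAt hsm ⟨z, hz⟩
  let L := fderiv ℝ (P.extend s) z
  have hL : ∀ (r : ℂ) (η : Fin d → ℂ), L (r • η) = r • L η := by
    intro r η
    have h1 : r • η = r.re • η + r.im • (Complex.I • η) := by
      conv_lhs => rw [← Complex.re_add_im r, add_smul, mul_smul, Complex.coe_smul, Complex.coe_smul]
    rw [h1, map_add, map_smul, map_smul, hI ⟨z, hz⟩ η, smul_eq_mul]
    conv_rhs => rw [← Complex.re_add_im r]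
    simp only [Complex.real_smul]
    ring
  refine (differentiableAt_iff_restrictScalars ℝ hd).2
    ⟨{ toFun := L, map_add' := map_add L, map_smul' := hL, cont := L.cont }, ?_⟩
  ext η
  rfl

theorem mono_mem_complexPolarized (c : (Fin n → ℤ) → ℝ) {u : Fin n → ℤ}
    (hu : u ∈ P.latticePts) : (fun z : P.coxSet => P.mono u z.1) ∈ P.ComplexPolarized c := by
  have heq : ∀ z ∈ P.coxSet, P.extend (fun z : P.coxSet => P.mono u z.1) z = P.mono u z :=
    fun z hz => P.extend_apply (fun z : P.coxSet => P.mono u z.1) ⟨z, hz⟩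
  refine (P.mem_complexPolarized_iff c).2 ⟨⟨fun t ht z w h => P.mono_smul ht u h, ?_⟩,
    fun z η => ?_⟩
  · exact (P.contDiff_mono hu).contDiffOn.congr heq
  · have h1 : P.extend (fun z : P.coxSet => P.mono u z.1) =ᶠ[𝓝 z.1] P.mono u :=
      Filter.eventually_of_mem (P.coxSet_isOpen.mem_nhds z.2) heq
    rw [h1.fderiv_eq, (P.differentiable_mono hu z.1).fderiv_restrictScalars ℝ]
    simp

/-- Equivariance of sections along one-parameter families in the group `G`. -/
theorem section_exp_smul {s : P.coxSet → ℂ} (hs : s ∈ P.Sections) {a : Fin d → ℂ}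
    (ha : ∀ i, ∑ k, (P.v k i : ℂ) * a k = 0) {z w : P.coxSet}
    (h : ∀ k, w.1 k = Complex.exp (a k) * z.1 k) :
    s w = Complex.exp (∑ k, (P.lam k : ℂ) * a k) * s z := by
  let t : Fin d → ℂˣ := fun k => Units.mk0 (Complex.exp (a k)) (Complex.exp_ne_zero _)
  have ht : t ∈ P.coxGroup := by
    intro i
    ext
    simp only [Units.coe_prod, Units.val_zpow_eq_zpow_val, Units.val_mk0, Units.val_one, t,
      ← Complex.exp_int_mul]
    rw [← Complex.exp_sum, ha i, Complex.exp_zero]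
  have hχ : P.chi t = Complex.exp (∑ k, (P.lam k : ℂ) * a k) := by
    simp only [chi, Units.coe_prod, Units.val_zpow_eq_zpow_val, Units.val_mk0, t,
      ← Complex.exp_int_mul]
    rw [← Complex.exp_sum]
  rw [hs t ht z w h, hχ]

/-- A holomorphic section that vanishes on the compact torus vanishes. -/
theorem eq_zero_of_eq_zero_on_compact_torus {c : (Fin n → ℤ) → ℝ} {s : P.coxSet → ℂ}
    (hs : s ∈ P.ComplexPolarized c)
    (h0 : ∀ b : Fin d → ℝ, s (P.expPt fun k => Complex.I * b k) = 0) : s = 0 := by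
  have h1 : ∀ θ, s (P.expPt θ) = 0 := by
    intro θ
    -- A complex line through `θ` (at `ζ = 1`) that lies over the compact torus for all imaginary
    -- `ζ`; the identity theorem carries the zeros there to `θ`.
    let line : ℂ → Fin d → ℂ := fun ζ k => ζ * (θ k).re + Complex.I * (θ k).im
    let g : ℂ → ℂ := fun ζ => P.extend s (P.expPt (line ζ)).1
    have hg : Differentiable ℂ g := by
      intro ζ
      have h2 : DifferentiableAt ℂ (fun ζ => (P.expPt (line ζ)).1) ζ := by
        refine differentiableAt_pi.2 fun k => ?_
        simp only [expPt, line]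
        fun_prop
      exact (P.differentiableAt_extend hs (P.expPt (line ζ)).2).comp ζ h2
    have hgI : ∀ t : ℝ, g (Complex.I * t) = 0 := by
      intro t
      have : line (Complex.I * t) = fun k => Complex.I * ((t * (θ k).re + (θ k).im : ℝ) : ℂ) := by
        funext k; simp only [line]; push_cast; ring
      simp only [g, extend_apply, this, h0]
    have hfreq : ∃ᶠ z in 𝓝[≠] (0 : ℂ), g z = 0 := by
      have ht : Tendsto (fun t : ℝ => Complex.I * (t : ℂ)) (𝓝[≠] 0) (𝓝[≠] 0) := by
        refine tendsto_nhdsWithin_iff.2 ⟨?_, ?_⟩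
        · have hc : Continuous fun t : ℝ => Complex.I * (t : ℂ) := by fun_prop
          have := hc.tendsto 0
          simp only [Complex.ofReal_zero, mul_zero] at this
          exact this.mono_left nhdsWithin_le_nhds
        · filter_upwards [self_mem_nhdsWithin] with t ht
          simpa using ht
      exact ht.frequently (Eventually.of_forall hgI).frequently
    have hg0 := AnalyticOnNhd.eqOn_zero_of_preconnected_of_frequently_eq_zero
      (U := Set.univ) (fun z _ => hg.analyticAt z) isPreconnected_univ (Set.mem_univ 0) hfreq
    have h3 := hg0 (Set.mem_univ 1)
    have h4 : line 1 = θ := by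
      funext k
      simp only [line, one_mul]
      rw [mul_comm Complex.I]
      exact Complex.re_add_im _
    simpa only [g, h4, extend_apply, Pi.zero_apply] using h3
  have h2 : ∀ z : P.coxSet, (∀ k, z.1 k ≠ 0) → s z = 0 := by
    intro z hz
    have hpi : (2 * Real.pi : ℂ) ≠ 0 := by
      have := Real.pi_ne_zero
      simp [this]
    have h3 : z = P.expPt fun k => Complex.log (z.1 k) / (2 * Real.pi) := by
      ext k
      simp only [expPt]
      rw [mul_div_cancel₀ _ hpi, Complex.exp_log (hz k)]
    rw [h3, h1]
  funext z
  -- Adding a small nonzero `t` to all coordinates makes them nonzero, so points on the toric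
  -- divisors follow by continuity.
  have hcont : ContinuousAt (fun t : ℝ => P.extend s (z.1 + fun _ => (t : ℂ))) 0 := by
    have h3 : ContinuousAt (P.extend s) (z.1 + fun _ => ((0 : ℝ) : ℂ)) := by
      have : z.1 + (fun _ => ((0 : ℝ) : ℂ)) = z.1 := by funext k; simp
      rw [this]
      exact (P.differentiableAt_extend hs z.2).continuousAt
    have h4 : Continuous fun t : ℝ => z.1 + fun _ : Fin d => (t : ℂ) := by fun_prop
    exact ContinuousAt.comp (f := fun t : ℝ => z.1 + fun _ : Fin d => (t : ℂ)) h3 h4.continuousAt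
  have hev : ∀ᶠ t : ℝ in 𝓝[≠] 0, P.extend s (z.1 + fun _ => (t : ℂ)) = 0 := by
    have h3 : ∀ᶠ t : ℝ in 𝓝[≠] 0, ∀ k, z.1 k + (t : ℂ) ≠ 0 := by
      refine eventually_all.2 fun k => ?_
      by_cases hk : z.1 k = 0
      · filter_upwards [self_mem_nhdsWithin] with t ht
        simpa [hk] using ht
      · have hc : Continuous fun t : ℝ => z.1 k + (t : ℂ) := by fun_prop
        have : ∀ᶠ t : ℝ in 𝓝 0, z.1 k + (t : ℂ) ≠ 0 :=
          hc.continuousAt.eventually_ne (by simpa using hk)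
        exact nhdsWithin_le_nhds this
    filter_upwards [h3] with t ht
    by_cases hU : (z.1 + fun _ => (t : ℂ)) ∈ P.coxSet
    · have := P.extend_apply s ⟨_, hU⟩
      rw [this]
      exact h2 _ ht
    · simp [extend, hU]
  have hlim := tendsto_nhds_unique (hcont.tendsto.mono_left nhdsWithin_le_nhds)
    (tendsto_const_nhds.congr' (hev.mono fun t ht => ht.symm))
  have h5 : z.1 + (fun _ => ((0 : ℝ) : ℂ)) = z.1 := by funext k; simp
  rw [h5, extend_apply] at hlim
  exact hlim

/-! ### Fourier modes of holomorphic sections -/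

/-- The point of `U` with coordinates the characters `-w k` of the compact torus. -/
noncomputable def torusPt (w : Fin d → Fin n → ℤ) (y : UnitAddTorus (Fin n)) : P.coxSet :=
  ⟨fun k => UnitAddTorus.mFourier (-w k) y, by
    obtain ⟨x, hx⟩ := P.body_nonempty
    exact ⟨x, hx, fun k hk => absurd hk (mFourier_ne_zero _ _)⟩⟩

theorem continuous_torusPt (w : Fin d → Fin n → ℤ) : Continuous (P.torusPt w) :=
  Continuous.subtype_mk (continuous_pi fun k => (UnitAddTorus.mFourier (-w k)).continuous) _

/-- A single coordinate may vanish because every facet meets `B`. This lets a loop around a toric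
divisor be filled by a disc in `U`. -/
theorem update_mem_coxSet {z : Fin d → ℂ} (hz : ∀ k, z k ≠ 0) (k : Fin d) (ζ : ℂ) :
    Function.update z k ζ ∈ P.coxSet := by
  obtain ⟨x, hx, hk⟩ := P.facet k
  refine ⟨x, hx, fun j hj => ?_⟩
  by_cases hjk : j = k
  · subst hjk; exact hk
  · rw [Function.update_of_ne hjk] at hj
    exact absurd hj (hz j)

/-- The coefficient of a holomorphic section on the compact torus in a holomorphic frame. -/
theorem exists_torus_function {c : (Fin n → ℤ) → ℝ} {s : P.coxSet → ℂ}
    (hs : s ∈ P.ComplexPolarized c) (w : Fin d → Fin n → ℤ) :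
    ∃ F : C(UnitAddTorus (Fin n), ℂ), ∀ y,
      F y = UnitAddTorus.mFourier (∑ k, P.lam k • w k) y * s (P.torusPt w y) := by
  refine ⟨⟨fun y => UnitAddTorus.mFourier (∑ k, P.lam k • w k) y * s (P.torusPt w y), ?_⟩,
    fun y => rfl⟩
  have hsc : Continuous s := by
    refine continuous_iff_continuousAt.2 fun z => ?_
    have h1 : ContinuousAt (fun z : P.coxSet => P.extend s z.1) z :=
      ContinuousAt.comp (f := fun z : P.coxSet => z.1)
        (P.differentiableAt_extend hs z.2).continuousAt continuous_subtype_val.continuousAt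
    simpa only [extend_apply] using h1
  exact (UnitAddTorus.mFourier _).continuous.mul (hsc.comp (P.continuous_torusPt w))

/-- The negative Fourier modes transversal to a toric divisor vanish. -/
theorem mFourierCoeff_section_eq_zero {c : (Fin n → ℤ) → ℝ} {s : P.coxSet → ℂ}
    (hs : s ∈ P.ComplexPolarized c) {w : Fin d → Fin n → ℤ}
    (hw : ∀ i i', ∑ k, w k i * P.v k i' = if i = i' then 1 else 0)
    {F : C(UnitAddTorus (Fin n), ℂ)}
    (hF : ∀ y, F y = UnitAddTorus.mFourier (∑ k, P.lam k • w k) y * s (P.torusPt w y))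
    {u : Fin n → ℤ} {k : Fin d} (hk : P.ellZ k u < 0) :
    UnitAddTorus.mFourierCoeff F (-u) = 0 := by
  obtain ⟨q, hq0, hq⟩ : ∃ q : ℕ, q ≠ 0 ∧ (q : ℤ) = -P.ellZ k u :=
    ⟨(-P.ellZ k u).toNat, by omega, Int.toNat_of_nonneg (by omega)⟩
  -- The one-parameter subgroup of `v_k`, parametrised by `[0, 2π]` and oriented so that it winds
  -- positively around `z_k = 0`.
  let τ : ℝ → UnitAddTorus (Fin n) := fun t i =>
    ((-(t / (2 * Real.pi)) * P.v k i : ℝ) : UnitAddCircle)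
  have hτ : Continuous τ := by
    refine continuous_pi fun i => ?_
    exact (AddCircle.continuous_mk' 1).comp (by fun_prop)
  have hpi : (Real.pi : ℂ) ≠ 0 := by exact_mod_cast Real.pi_ne_zero
  have hphase : ∀ (p : Fin n → ℤ) (t : ℝ), UnitAddTorus.mFourier p (τ t) =
      Complex.exp (-(Complex.I * t * ∑ i, (p i : ℂ) * P.v k i)) := by
    intro p t
    rw [mFourier_coe]
    congr 1
    push_cast
    rw [Finset.mul_sum, Finset.mul_sum, ← Finset.sum_neg_distrib]
    refine Finset.sum_congr rfl fun i _ => ?_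
    field_simp
  refine mFourierCoeff_eq_zero F (-u) hτ fun y => ?_
  rw [neg_neg]
  set z := P.torusPt w y with hz
  have hz0 : ∀ j, z.1 j ≠ 0 := fun j => mFourier_ne_zero _ _
  -- Up to a factor independent of `t`, the integrand is `h` on the unit circle. `h` is entire, and
  -- `h(0) = 0` because `q = -ℓ_k(u) > 0`, so its circle average is zero.
  let h : ℂ → ℂ := fun ζ => ζ ^ q * P.extend s (Function.update z.1 k (ζ * z.1 k))
  have hh : Differentiable ℂ h := by
    intro ζ
    refine (differentiableAt_id.pow q).mul ?_
    have h1 : DifferentiableAt ℂ (fun ζ : ℂ => Function.update z.1 k (ζ * z.1 k)) ζ := by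
      refine differentiableAt_pi.2 fun j => ?_
      by_cases hj : j = k
      · subst hj; simp only [Function.update_self]; fun_prop
      · simp only [Function.update_of_ne hj]; fun_prop
    exact DifferentiableAt.comp (f := fun ζ : ℂ => Function.update z.1 k (ζ * z.1 k)) ζ
      (P.differentiableAt_extend hs (P.update_mem_coxSet hz0 k _)) h1
  have hmean : ∫ t in (0 : ℝ)..2 * Real.pi, h (circleMap 0 1 t) = 0 := by
    have h1 := (hh.diffContOnCl (s := Metric.ball 0 |1|)).circleAverage
    rw [Real.circleAverage_def] at h1
    have h2 : h 0 = 0 := by simp [h, hq0]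
    rw [h2, smul_eq_zero] at h1
    exact h1.resolve_left (by positivity)
  have hwR : ∀ i i', ∑ j, (w j i : ℂ) * P.v j i' = if i = i' then 1 else 0 := by
    intro i i'; exact_mod_cast hw i i'
  have key : ∀ t : ℝ, UnitAddTorus.mFourier u (y + τ t) * F (y + τ t) =
      UnitAddTorus.mFourier u y * UnitAddTorus.mFourier (∑ k, P.lam k • w k) y *
        h (circleMap 0 1 t) := by
    intro t
    let z' : P.coxSet := ⟨Function.update z.1 k (circleMap 0 1 t * z.1 k),
      P.update_mem_coxSet hz0 k _⟩
    -- Translation by `τ t` rotates all coordinates. Modulo `G` it equals rotation of the `k`-th one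
    -- alone, and `a` is the difference in the Lie algebra of `G`.
    let a : Fin d → ℂ := fun j =>
      Complex.I * t * ((∑ i, (w j i : ℂ) * P.v k i) - if j = k then 1 else 0)
    have ha : ∀ i, ∑ j, (P.v j i : ℂ) * a j = 0 := by
      intro i
      have h1 : ∑ j, (P.v j i : ℂ) * ∑ i', (w j i' : ℂ) * P.v k i' = P.v k i := by
        simp only [Finset.mul_sum]
        rw [Finset.sum_comm]
        calc ∑ i', ∑ j, (P.v j i : ℂ) * (w j i' * P.v k i')
            = ∑ i', (∑ j, (w j i' : ℂ) * P.v j i) * P.v k i' := by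
              refine Finset.sum_congr rfl fun i' _ => ?_
              rw [Finset.sum_mul]
              exact Finset.sum_congr rfl fun j _ => by ring
          _ = P.v k i := by simp [hwR]
      have h2 : ∑ j, (P.v j i : ℂ) * a j = Complex.I * t *
          (∑ j, (P.v j i : ℂ) * ∑ i', (w j i' : ℂ) * P.v k i' -
            ∑ j, (P.v j i : ℂ) * if j = k then 1 else 0) := by
        rw [← Finset.sum_sub_distrib, Finset.mul_sum]
        exact Finset.sum_congr rfl fun j _ => by simp only [a]; ring
      rw [h2, h1]
      simp
    have hzz : ∀ j, (P.torusPt w (y + τ t)).1 j = Complex.exp (a j) * z'.1 j := by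
      intro j
      have h1 : (P.torusPt w (y + τ t)).1 j =
          z.1 j * Complex.exp (Complex.I * t * ∑ i, (w j i : ℂ) * P.v k i) := by
        simp only [torusPt, mFourier_add_apply, hphase, hz]
        congr 2
        simp only [Pi.neg_apply, Int.cast_neg, neg_mul, Finset.sum_neg_distrib, mul_neg, neg_neg]
      rw [h1]
      by_cases hj : j = k
      · subst hj
        simp only [z', Function.update_self, a, if_true, circleMap]
        rw [mul_comm (z.1 j), zero_add, Complex.ofReal_one, one_mul, ← mul_assoc,
          ← Complex.exp_add]
        congr 2
        ring
      · simp only [z', Function.update_of_ne hj, a, hj, if_false, sub_zero]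
        ring
    have h1 := P.section_exp_smul hs.1.1 ha hzz
    have h2 : P.extend s (Function.update z.1 k (circleMap 0 1 t * z.1 k)) = s z' :=
      P.extend_apply s z'
    simp only [h, hF, h1, h2, mFourier_add_apply, hphase]
    have h3 : circleMap 0 1 t ^ q = Complex.exp (-(Complex.I * t * ∑ i, (u i : ℂ) * P.v k i)) *
        Complex.exp (-(Complex.I * t * ∑ i, (((∑ k, P.lam k • w k) i : ℤ) : ℂ) * P.v k i)) *
        Complex.exp (∑ j, (P.lam j : ℂ) * a j) := by
      rw [← Complex.exp_add, ← Complex.exp_add, circleMap, zero_add, Complex.ofReal_one, one_mul,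
        ← Complex.exp_nat_mul]
      congr 1
      have hqC : (q : ℂ) = -(∑ i, (P.v k i : ℂ) * u i + P.lam k) := by
        have : ((q : ℤ) : ℂ) = ((-P.ellZ k u : ℤ) : ℂ) := by rw [hq]
        simpa [ellZ] using this
      have h4 : ∑ j, (P.lam j : ℂ) * a j = Complex.I * t *
          (∑ i, (((∑ k, P.lam k • w k) i : ℤ) : ℂ) * P.v k i - P.lam k) := by
        simp only [a, Finset.sum_apply, Pi.smul_apply, smul_eq_mul, Int.cast_sum, Int.cast_mul,
          Finset.sum_mul]
        rw [Finset.sum_comm]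
        have h5 : (P.lam k : ℂ) = ∑ j, (P.lam j : ℂ) * if j = k then 1 else 0 := by simp
        rw [h5, ← Finset.sum_sub_distrib, Finset.mul_sum]
        refine Finset.sum_congr rfl fun j _ => ?_
        rw [mul_left_comm, mul_sub (P.lam j : ℂ), Finset.mul_sum]
        simp only [mul_assoc]
      rw [hqC, h4]
      have h6 : ∑ i, (P.v k i : ℂ) * u i = ∑ i, (u i : ℂ) * P.v k i :=
        Finset.sum_congr rfl fun i _ => mul_comm _ _
      rw [h6]
      ring
    rw [h3]
    ring
  simp only [key]
  rw [intervalIntegral.integral_const_mul, hmean, mul_zero]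

/-- Every holomorphic section is a combination of the character sections of the lattice points. -/
theorem exists_eq_sum_mono {c : (Fin n → ℤ) → ℝ} {s : P.coxSet → ℂ}
    (hs : s ∈ P.ComplexPolarized c) : ∃ a : (Fin n → ℤ) → ℂ,
      s = fun z => ∑ u ∈ P.latticeFinset, a u * P.mono u z.1 := by
  obtain ⟨w, hw, hsec⟩ := P.exists_coords_section
  obtain ⟨F, hF⟩ := P.exists_torus_function hs w
  have hcoef : ∀ m, -m ∉ P.latticePts → UnitAddTorus.mFourierCoeff F m = 0 := by
    intro m hm
    have : ∃ k, P.ellZ k (-m) < 0 := by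
      by_contra! hcon
      refine hm fun k => ?_
      change 0 ≤ P.ell k (toReal (-m))
      rw [ell_toReal]
      exact_mod_cast hcon k
    obtain ⟨k, hk⟩ := this
    have := P.mFourierCoeff_section_eq_zero hs hw hF hk
    rwa [neg_neg] at this
  let a : (Fin n → ℤ) → ℂ := fun u => UnitAddTorus.mFourierCoeff F (-u)
  have hfin : ∀ m ∉ P.latticeFinset.image (fun u => -u), UnitAddTorus.mFourierCoeff F m = 0 := by
    intro m hm
    refine hcoef m fun h => hm (Finset.mem_image.2 ⟨-m, P.mem_latticeFinset.2 h, neg_neg m⟩)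
  -- Only finitely many coefficients survive, so the Fourier series is summable and represents the
  -- continuous `F` pointwise.
  have hsum : ∀ y, F y = ∑ u ∈ P.latticeFinset, a u * UnitAddTorus.mFourier (-u) y := by
    intro y
    have h1 := UnitAddTorus.hasSum_mFourier_series_apply_of_summable
      (summable_of_ne_finset_zero hfin) y
    have h2 : HasSum (fun m => UnitAddTorus.mFourierCoeff F m • UnitAddTorus.mFourier m y)
        (∑ m ∈ P.latticeFinset.image (fun u => -u),
          UnitAddTorus.mFourierCoeff F m • UnitAddTorus.mFourier m y) :=
      hasSum_sum_of_ne_finset_zero fun m hm => by rw [hfin m hm, zero_smul]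
    rw [h1.unique h2, Finset.sum_image fun a _ b _ h => neg_injective h]
    rfl
  refine ⟨a, ?_⟩
  let D : P.coxSet → ℂ := s - ∑ u ∈ P.latticeFinset, a u • fun z : P.coxSet => P.mono u z.1
  have hD : D ∈ P.ComplexPolarized c := sub_mem hs (Submodule.sum_mem _ fun u hu =>
    Submodule.smul_mem _ _ (P.mono_mem_complexPolarized c (P.mem_latticeFinset.1 hu)))
  have hDz : ∀ z, D z = s z - ∑ u ∈ P.latticeFinset, a u * P.mono u z.1 := by
    intro z; simp [D, Finset.sum_apply]
  have hwR : ∀ i i', ∑ j, (w j i : ℂ) * P.v j i' = if i = i' then 1 else 0 := by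
    intro i i'; exact_mod_cast hw i i'
  have hmono : ∀ u y, P.mono u (P.torusPt w y).1 * UnitAddTorus.mFourier (∑ k, P.lam k • w k) y =
      UnitAddTorus.mFourier (-u) y := by
    intro u y
    obtain ⟨r, rfl⟩ : ∃ r : Fin n → ℝ, (fun i => (r i : UnitAddCircle)) = y := by
      choose r hr using fun i => QuotientAddGroup.mk_surjective (y i)
      exact ⟨r, funext hr⟩
    let θ : Fin d → ℂ := fun k => -∑ i, (w k i : ℂ) * r i
    have hθ : ∀ i, ∑ k, (P.v k i : ℂ) * θ k = -r i := by
      intro i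
      simp only [θ, mul_neg, Finset.sum_neg_distrib, Finset.mul_sum]
      rw [Finset.sum_comm]
      congr 1
      calc ∑ i', ∑ k, (P.v k i : ℂ) * (w k i' * r i')
          = ∑ i', (∑ k, (w k i' : ℂ) * P.v k i) * r i' := by
            refine Finset.sum_congr rfl fun i' _ => ?_
            rw [Finset.sum_mul]
            exact Finset.sum_congr rfl fun j _ => by ring
        _ = r i := by simp [hwR]
    have h1 : P.mono u (P.torusPt w fun i => (r i : UnitAddCircle)).1 =
        Complex.exp (2 * Real.pi * Complex.I * ∑ k, (P.ellZ k u : ℂ) * θ k) := by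
      simp only [mono, torusPt, mFourier_coe, ← Complex.exp_int_mul]
      rw [← Complex.exp_sum, Finset.mul_sum]
      congr 1
      refine Finset.sum_congr rfl fun k _ => ?_
      simp only [θ, Pi.neg_apply, Int.cast_neg, neg_mul, Finset.sum_neg_distrib]
      ring
    rw [h1, P.sum_ellZ_mul, mFourier_coe, mFourier_coe, ← Complex.exp_add, ← mul_add]
    congr 2
    simp only [hθ, Finset.sum_apply, Pi.smul_apply, smul_eq_mul, Int.cast_sum, Int.cast_mul,
      Finset.sum_mul]
    rw [Finset.sum_comm (s := Finset.univ (α := Fin n))]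
    have h2 : ∑ k, (P.lam k : ℂ) * θ k + ∑ k, ∑ i, (P.lam k : ℂ) * w k i * r i = 0 := by
      rw [← Finset.sum_add_distrib]
      refine Finset.sum_eq_zero fun k _ => ?_
      simp only [θ, mul_assoc, ← Finset.mul_sum]
      ring
    rw [add_assoc, h2, add_zero]
    exact Finset.sum_congr rfl fun i _ => by simp
  have hDt : ∀ y, D (P.torusPt w y) = 0 := by
    intro y
    have h1 := hsum y
    rw [hF] at h1
    refine (mul_eq_zero.1 (?_ : UnitAddTorus.mFourier (∑ k, P.lam k • w k) y *
      D (P.torusPt w y) = 0)).resolve_left (mFourier_ne_zero _ _)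
    rw [hDz, mul_sub, h1, Finset.mul_sum, ← Finset.sum_sub_distrib]
    refine Finset.sum_eq_zero fun u _ => ?_
    rw [← hmono u y]; ring
  have hD0 : D = 0 := by
    refine P.eq_zero_of_eq_zero_on_compact_torus hD fun b => ?_
    let yb : Fin n → ℝ := fun i => -∑ k, (P.v k i : ℝ) * b k
    -- Every point with coordinates of modulus one is `G`-equivalent to a `torusPt`; `a'` is the
    -- logarithm of the group element relating them.
    let a' : Fin d → ℂ := fun k =>
      2 * Real.pi * (Complex.I * b k + Complex.I * ∑ i, (w k i : ℂ) * yb i)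
    have ha' : ∀ i, ∑ k, (P.v k i : ℂ) * a' k = 0 := by
      intro i
      have h1 : ∑ k, (P.v k i : ℂ) * ∑ i', (w k i' : ℂ) * yb i' = yb i := by
        simp only [Finset.mul_sum]
        rw [Finset.sum_comm]
        calc ∑ i', ∑ k, (P.v k i : ℂ) * (w k i' * yb i')
            = ∑ i', (∑ k, (w k i' : ℂ) * P.v k i) * yb i' := by
              refine Finset.sum_congr rfl fun i' _ => ?_
              rw [Finset.sum_mul]
              exact Finset.sum_congr rfl fun j _ => by ring
          _ = yb i := by simp [hwR]
      have h2 : ∑ k, (P.v k i : ℂ) * a' k = 2 * Real.pi * Complex.I *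
          (∑ k, (P.v k i : ℂ) * b k + ∑ k, (P.v k i : ℂ) * ∑ i', (w k i' : ℂ) * yb i') := by
        rw [← Finset.sum_add_distrib, Finset.mul_sum]
        exact Finset.sum_congr rfl fun k _ => by simp only [a']; ring
      rw [h2, h1]
      simp only [yb]
      push_cast
      ring
    have h3 := P.section_exp_smul hD.1.1 (z := P.torusPt w fun i => (yb i : UnitAddCircle))
      (w := P.expPt fun k => Complex.I * b k) ha' fun k => by
        simp only [expPt, torusPt, mFourier_coe, a']
        rw [← Complex.exp_add]
        congr 1
        simp only [Pi.neg_apply, Int.cast_neg, neg_mul, Finset.sum_neg_distrib]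
        ring
    rw [h3, hDt, mul_zero]
  funext z
  have := congrFun hD0 z
  rw [hDz] at this
  exact sub_eq_zero.1 this

/-- Independence is Dedekind's theorem for characters of `(ℂˣ)^d`. The exponents `ℓ_k(u)` determine
`u` because the normals generate the lattice. -/
theorem exists_basis_complexPolarized (c : (Fin n → ℤ) → ℝ) :
    ∃ b : Module.Basis P.latticePts ℂ (P.ComplexPolarized c),
      ∀ u, (b u : P.coxSet → ℂ) = fun z => P.mono u.1 z.1 := by
  classical
  have : Fintype P.latticePts := P.latticePts_finite.fintype
  let f : P.latticePts → P.ComplexPolarized c := fun u =>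
    ⟨fun z => P.mono u.1 z.1, P.mono_mem_complexPolarized c u.2⟩
  have hli : LinearIndependent ℂ f := by
    let pt : (Fin d → ℂˣ) → P.coxSet := fun t => ⟨fun k => t k, by
      obtain ⟨x, hx⟩ := P.body_nonempty
      exact ⟨x, hx, fun k hk => absurd hk (t k).ne_zero⟩⟩
    let χ : P.latticePts → ((Fin d → ℂˣ) →* ℂ) := fun u =>
      { toFun := fun t => P.mono u.1 (pt t).1
        map_one' := by simp [pt, mono]
        map_mul' := fun t t' => by
          simp [pt, mono, mul_zpow, Finset.prod_mul_distrib] }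
    have hχ : Function.Injective χ := by
      intro u u' h
      have h1 : ∀ k, P.ellZ k u.1 = P.ellZ k u'.1 := by
        intro k
        -- At the point with `2` in place `k` and `1` elsewhere, the monomial is `2 ^ ℓ_k(u)`, which
        -- recovers the exponent.
        have h2 := DFunLike.congr_fun h (Pi.mulSingle k (Units.mk0 2 two_ne_zero))
        change P.mono _ _ = P.mono _ _ at h2
        have h3 : ∀ u : Fin n → ℤ, P.mono u
            (pt (Pi.mulSingle k (Units.mk0 (2 : ℂ) two_ne_zero))).1 = 2 ^ P.ellZ k u := by
          intro u
          rw [mono, Finset.prod_eq_single k]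
          · simp [pt]
          · intro j _ hj
            simp [pt, Pi.mulSingle_eq_of_ne hj]
          · simp
        rw [h3, h3] at h2
        have h4 : ((2 : ℝ) ^ P.ellZ k u.1) = (2 : ℝ) ^ P.ellZ k u'.1 := by
          simpa using congrArg norm h2
        exact zpow_right_injective₀ (by norm_num) (by norm_num) h4
      obtain ⟨w, hw⟩ := P.exists_generators
      have h5 : ∀ (v : Fin n → ℤ) i, v i = ∑ k, w k i * (P.ellZ k v - P.lam k) := by
        intro v i
        simp only [ellZ, add_sub_cancel_right, Finset.mul_sum]
        rw [Finset.sum_comm]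
        simp only [← mul_assoc, ← Finset.sum_mul, hw]
        simp
      refine Subtype.ext (funext fun i => ?_)
      rw [h5 u.1, h5 u'.1]
      simp only [h1]
    have h1 := (linearIndependent_monoidHom (Fin d → ℂˣ) ℂ).comp χ hχ
    refine LinearIndependent.of_comp
      ((LinearMap.funLeft ℂ ℂ pt).comp (P.ComplexPolarized c).subtype) ?_
    exact h1
  have hsp : ⊤ ≤ Submodule.span ℂ (Set.range f) := by
    rintro ⟨s, hs⟩ -
    obtain ⟨a, ha⟩ := P.exists_eq_sum_mono hs
    have h1 : (⟨s, hs⟩ : P.ComplexPolarized c) = ∑ u, a u.1 • f u := by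
      refine Subtype.ext (funext fun z => ?_)
      have h2 : ((∑ u, a u.1 • f u : P.ComplexPolarized c) : P.coxSet → ℂ) z =
          ∑ u : P.latticePts, a u.1 * P.mono u.1 z.1 := by
        simp [f, Finset.sum_apply]
      rw [h2]
      change s z = _
      rw [ha, ← Finset.sum_subtype P.latticeFinset (fun u => P.mem_latticeFinset)
        fun u => a u * P.mono u z.1]
    rw [h1]
    exact Submodule.sum_mem _ fun u _ => Submodule.smul_mem _ _ (Submodule.subset_span ⟨u, rfl⟩)
  exact ⟨Module.Basis.mk hli hsp, fun u => by rw [Module.Basis.mk_apply]⟩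

/-! ### The SYZ transform and the character sections -/

/-- The character sections over the dense torus. -/
theorem mono_expPt (c : (Fin n → ℤ) → ℝ) (u : Fin n → ℤ) (θ : Fin d → ℂ) :
    P.mono u (P.expPt θ).1 = Complex.exp (-(2 * Real.pi * P.phi c (P.coords θ).1 : ℝ)) *
      Complex.exp ((2 * Real.pi * pair u (P.coords θ).1 : ℝ)) *
      Complex.exp (-(2 * Real.pi * Complex.I * (pair u (P.coords θ).2 : ℝ))) * P.frame c θ := by
  have h1 : P.mono u (P.expPt θ).1 =
      Complex.exp (2 * Real.pi * ∑ k, (P.ellZ k u : ℂ) * θ k) := by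
    simp only [mono, expPt, ← Complex.exp_int_mul]
    rw [← Complex.exp_sum, Finset.mul_sum]
    congr 1
    exact Finset.sum_congr rfl fun k _ => by ring
  have h2 : ∀ i, ∑ k, (P.v k i : ℂ) * θ k =
      (P.coords θ).1 i - Complex.I * (P.coords θ).2 i := by
    intro i
    have h3 : ∀ k, (P.v k i : ℂ) * θ k = (P.v k i : ℂ) * (θ k).re +
        Complex.I * ((P.v k i : ℂ) * (θ k).im) := by
      intro k
      conv_lhs => rw [← Complex.re_add_im (θ k)]
      ring
    simp only [coords, h3, Finset.sum_add_distrib, ← Finset.mul_sum]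
    push_cast
    ring
  have h4 : ∑ i, (u i : ℂ) * ((P.coords θ).1 i - Complex.I * (P.coords θ).2 i) =
      (pair u (P.coords θ).1 : ℝ) - Complex.I * (pair u (P.coords θ).2 : ℝ) := by
    simp only [pair, mul_sub, Finset.sum_sub_distrib]
    push_cast
    rw [Finset.mul_sum]
    congr 1
    exact Finset.sum_congr rfl fun i _ => by ring
  rw [h1, P.sum_ellZ_mul, frame, Complex.ofReal_exp, ← mul_assoc, ← Complex.exp_add,
    ← Complex.exp_add, ← Complex.exp_add, ← Complex.exp_add]
  simp only [h2, h4]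
  congr 1
  push_cast
  ring

theorem wittenFun_mul_exp_mul_frame (c : (Fin n → ℤ) → ℝ) (u : Fin n → ℤ) (θ : Fin d → ℂ) :
    P.wittenFun c u (P.coords θ).1 (-u) *
      Complex.exp (2 * Real.pi * Complex.I * (pair (-u) (P.coords θ).2 : ℝ)) * P.frame c θ =
      P.mono u (P.expPt θ).1 := by
  rw [P.mono_expPt c, wittenFun_self, pair_neg]
  push_cast
  rw [mul_neg]

/-- The SYZ transform is an isomorphism of the kernel of the Witten differential with the
holomorphic sections. -/
theorem restrictsTo_basis_equiv {c : (Fin n → ℤ) → ℝ} (hc : P.IsEmbeddingWeight c)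
    (bW : Module.Basis P.latticePts ℂ (P.WittenKernel c))
    (hW : ∀ u, (bW u : (Fin n → ℝ) → (Fin n → ℤ) → ℂ) = P.wittenFun c u.1)
    (bC : Module.Basis P.latticePts ℂ (P.ComplexPolarized c))
    (hC : ∀ u, (bC u : P.coxSet → ℂ) = fun z => P.mono u.1 z.1) (f : P.WittenKernel c) :
    P.RestrictsTo c (bW.equiv bC (Equiv.refl _) f).1 (syzTransform f.1) := by
  classical
  have : Fintype P.latticePts := P.latticePts_finite.fintype
  intro θ
  have hf : ∀ u : P.latticePts, f.1 (P.coords θ).1 (-u.1) =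
      bW.repr f u * P.wittenFun c u.1 (P.coords θ).1 (-u.1) := by
    intro u
    have h1 : f.1 (P.coords θ).1 (-u.1) =
        ∑ w, bW.repr f w * P.wittenFun c w.1 (P.coords θ).1 (-u.1) := by
      conv_lhs => rw [← bW.sum_repr f]
      simp only [AddSubmonoidClass.coe_finsetSum, Submodule.coe_smul, hW, Finset.sum_apply,
        Pi.smul_apply, smul_eq_mul]
    rw [h1]
    refine Finset.sum_eq_single u (fun w _ hne => ?_) fun h => absurd (Finset.mem_univ u) h
    rw [P.wittenFun_of_ne c, mul_zero]
    exact fun h => hne (Subtype.ext (neg_injective h).symm)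
  have hT : (bW.equiv bC (Equiv.refl _) f).1 (P.expPt θ) =
      ∑ u, bW.repr f u * P.mono u.1 (P.expPt θ).1 := by
    conv_lhs => rw [← bW.sum_repr f]
    simp only [map_sum, map_smul, Module.Basis.equiv_apply, Equiv.refl_apply,
      AddSubmonoidClass.coe_finsetSum, Submodule.coe_smul, hC, Finset.sum_apply, Pi.smul_apply,
      smul_eq_mul]
  rw [hT, P.syzTransform_eq_sum hc f.2, Finset.sum_mul,
    Finset.sum_subtype P.latticeFinset (fun u => P.mem_latticeFinset)]
  refine Finset.sum_congr rfl fun u _ => ?_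
  rw [hf u, ← P.wittenFun_mul_exp_mul_frame c]
  ring

end DelzantPolytope
end ToricSYZ

/-! ### The main theorem -/

theorem mainTheorem2 {n d : ℕ} (P : ToricSYZ.DelzantPolytope n d) (c : (Fin n → ℤ) → ℝ)
    (hc : P.IsEmbeddingWeight c) :
    -- the moment map has image `B` and is `dφ ∘ π` on the dense torus
    (Set.range (P.moment c) = P.body ∧
      ∀ θ, P.moment c (P.proj (P.expPt θ)) = P.dphi c (P.coords θ).1) ∧
    -- over the dense torus the line bundle with connection is the SYZ transform of the graph of `dφ`
    (∀ s, P.IsSmooth s → ∀ σ, P.RestrictsTo c s σ → ∀ θ η : Fin d → ℂ,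
      P.nabla c s (P.expPt θ) (fun k => 2 * Real.pi * η k * Complex.exp (2 * Real.pi * θ k)) =
        ToricSYZ.syzNabla (P.phi c) σ (P.coords θ) (P.coords η) * P.frame c θ) ∧
    -- and it is prequantum
    (∀ p a b, Complex.I / (2 * Real.pi) * ToricSYZ.syzCurvature (P.phi c) p a b =
      (ToricSYZ.kahlerForm (P.phi c) p a b : ℝ)) ∧
    -- Bohr-Sommerfeld fibres, intersection points and lattice points correspond
    ∃ (β : P.BSFibres c ≃ P.IntersectionAtInfinity c)
      (pt : P.IntersectionAtInfinity c ≃ P.latticePts),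
      (∀ F : P.BSFibres c, (F : Set P.Space) = P.fibre c (ToricSYZ.toReal (pt (β F)).1)) ∧
      (∀ r : P.IntegralRay c, Tendsto (fun t => P.dphi c (r.1 t)) atTop
        (𝓝 (ToricSYZ.toReal (pt (Quotient.mk (P.integralEquiv c) r)).1))) ∧
      (∀ q, ToricSYZ.toReal (pt q).1 ∈ interior P.body ↔
        ∃ x ∈ ToricSYZ.DelzantPolytope.zeroSection n ∩ P.lagrangian c,
          P.dphi c x.1 = ToricSYZ.toReal (pt q).1) ∧
      -- the real polarized sections have a basis indexed by the Bohr-Sommerfeld fibres, the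
      -- `d_W`-closed functions one indexed by the intersection points, the SYZ transform is an
      -- isomorphism onto the holomorphic sections, and all this induces the isomorphism `Φ`
      ∃ (bR : Module.Basis (P.BSFibres c) ℂ (P.RealPolarized c))
        (bW : Module.Basis (P.IntersectionAtInfinity c) ℂ (P.WittenKernel c))
        (T : P.WittenKernel c ≃ₗ[ℂ] P.ComplexPolarized c)
        (Φ : P.RealPolarized c ≃ₗ[ℂ] P.ComplexPolarized c),
        (∀ F, (bR F : P.coxSet → ℂ) = P.fibreSection c (pt (β F)).1) ∧
        (∀ q, (bW q : (Fin n → ℝ) → (Fin n → ℤ) → ℂ) = P.wittenFun c (pt q).1) ∧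
        (∀ f : P.WittenKernel c, P.RestrictsTo c (T f).1 (ToricSYZ.syzTransform f.1)) ∧
        (∀ F, Φ (bR F) = T (bW (β F))) ∧
        (∀ F, P.RestrictsTo c (Φ (bR F)).1 (fun p =>
          Complex.exp (-(2 * Real.pi * P.phi c p.1 : ℝ)) *
            Complex.exp ((2 * Real.pi * ToricSYZ.pair (pt (β F)).1 p.1 : ℝ)) *
            Complex.exp (-(2 * Real.pi * Complex.I *
              (ToricSYZ.pair (pt (β F)).1 p.2 : ℝ))))) := by
  obtain ⟨e, he⟩ := P.exists_equiv_BSFibres hc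
  obtain ⟨pt, hpt⟩ := P.exists_equiv_intersection hc
  obtain ⟨bR, hR⟩ := P.exists_basis_realPolarized hc
  obtain ⟨bW, hW⟩ := P.exists_basis_wittenKernel hc
  obtain ⟨bC, hC⟩ := P.exists_basis_complexPolarized c
  have hpe : ∀ F, pt ((e.trans pt.symm) F) = e F := fun F => by simp
  -- All three bases are first indexed by `B ∩ M`, so `T` and `Φ` are the basis isomorphisms for the
  -- identity of indices; reindexing the real and Witten bases then gives the required forms.
  refine ⟨⟨P.range_moment hc, P.moment_expPt hc⟩,
    fun s hs σ hσ θ η => P.nabla_expPt hc hs hσ θ η,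
    ToricSYZ.prequantum_of_contDiff (P.contDiff_phi hc), e.trans pt.symm, pt,
    fun F => ?_, hpt, fun q => P.mem_interior_iff_intersection hc _,
    bR.reindex e.symm, bW.reindex pt.symm, bW.equiv bC (Equiv.refl _),
    bR.equiv bC (Equiv.refl _), fun F => ?_, fun q => ?_, P.restrictsTo_basis_equiv hc bW hW bC hC,
    fun F => ?_, fun F θ => ?_⟩
  · rw [hpe]; exact he F
  · rw [Module.Basis.reindex_apply, hR, hpe]; rfl
  · rw [Module.Basis.reindex_apply, hW]; rfl
  · simp
  · have h1 : bR.equiv bC (Equiv.refl _) (bR.reindex e.symm F) = bC (e F) := by simp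
    rw [h1, hC, hpe]
    exact P.mono_expPt c _ θ
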